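/- Let $d\ge 1$ be an integer. For a compact set $A\subset\mathbb{R}^\ell$, $s>0$ and $N\in\mathbb{N}$ put $$\mathcal{P}_s(A;N):=\sup_{x_1,\dots,x_N\in A}\ \inf_{y\in A}\sum_{j=1}^N\frac{1}{|y-x_j|^s},\qquad \rho_A(N):=\min_{x_1,\dots,x_N\in A}\ \max_{y\in A}\ \min_{1\le j\le N}|y-x_j|,$$ where repetitions among the $x_j$ are allowed and $|\cdot|$ is the Euclidean norm. Let $\mathcal{H}_d$ be the $d$-dimensional Hausdorff measure normalized by $\mathcal{H}_d([0,1]^d)=1$. A set $A$ is called $d$-admissible if it is one of the following: (i) a strongly convex body in $\mathbb{R}^d$, that is, a nonempty compact convex set $A\subset\mathbb{R}^d$ which is the closure of its interior and whose boundary is a $(d-1)$-dimensional $C^2$-smooth manifold with nowhere vanishing Gaussian curvature; (ii) the unit sphere $\mathbb{S}^d\subset\mathbb{R}^{d+1}$; (iii) a spherical cap $\{x\in\mathbb{S}^d: x\cdot e\ge t\}$ with $e\in\mathbb{S}^d$ and $-1<t<1$. For $s>d$ let $\sigma_{s,d}:=\lim_{N\to\infty}\mathcal{P}_s([0,1]^d;N)/N^{s/d}$.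 Then this limit exists and is a positive real number, and for every set $A$ that is $d$-admissible or equal to $[0,1]^d$ the following holds. For every $s>d$ the limit $\lim_{N\to\infty}\mathcal{P}_s(A;N)/N^{s/d}$ exists and equals $\sigma_{s,d}/\mathcal{H}_d(A)^{s/d}$. Moreover, the following limits exist as positive real numbers and satisfy $$\lim_{s\to\infty}\left(\frac{\sigma_{s,d}}{\mathcal{H}_d(A)^{s/d}}\right)^{1/s}=\lim_{s\to\infty}\left(\lim_{N\to\infty}\frac{\mathcal{P}_s(A;N)}{N^{s/d}}\right)^{1/s}=\frac{1}{\lim_{N\to\infty}N^{1/d}\rho_A(N)}.$$ In particular, for $A=[0,1]^d$, $$\lim_{s\to\infty}\sigma_{s,d}^{1/s}=\frac{1}{\lim_{N\to\infty}N^{1/d}\rho_{[0,1]^d}(N)}=\left(\frac{V_d}{\Gamma_d}\right)^{1/d},$$ where $V_d$ is the volume of the unit ball of $\mathbb{R}^d$ and $\Gamma_d>0$ is the optimal covering density of $\mathbb{R}^d$, i.e. the infimum, over all families $\mathcal{B}$ of closed unit balls that cover $\mathbb{R}^d$ and for which the limit exists, of $$\Delta(\mathcal{B})=\lim_{R\to\infty}\frac{1}{(2R)^d}\sum_{B\in\mathcal{B}}\mathcal{H}_d(B\cap[-R,R]^d).$$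 -/

import Mathlib

open Filter Topology MeasureTheory Metric
open scoped ENNReal

namespace RieszPolarization

noncomputable section

/-- `ℝⁿ` with the Euclidean norm. -/
abbrev E (n : ℕ) : Type := EuclideanSpace ℝ (Fin n)

/-- `P_s(A; ω) = inf_{y ∈ A} ∑_j |y - x_j|^{-s}` for an `N`-point configuration (repetitions
allowed) `ω = (x_1, …, x_N)` in `A`; for `s > 0` a term with `y = x_j` equals `+∞`. -/
def configPolarization {n N : ℕ} (s : ℝ) (A : Set (E n)) (ω : Fin N → A) : ℝ≥0∞ :=
  ⨅ y : A, ∑ j, edist (y : E n) (ω j : E n) ^ (-s)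

/-- The `N`-th Riesz `s`-polarization constant `𝒫_s(A; N)`. -/
def polarization {n : ℕ} (s : ℝ) (A : Set (E n)) (N : ℕ) : ℝ≥0∞ :=
  ⨆ ω : Fin N → A, configPolarization s A ω

/-- `ρ_A(ω) = sup_{y ∈ A} min_j |y - x_j|`. -/
def coveringRadius {n N : ℕ} (A : Set (E n)) (ω : Fin N → A) : ℝ≥0∞ :=
  ⨆ y : A, ⨅ j, edist (y : E n) (ω j : E n)

/-- The best `N`-point covering radius `ρ_A(N)`. -/
def bestCoveringRadius {n : ℕ} (A : Set (E n)) (N : ℕ) : ℝ≥0∞ :=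
  ⨅ ω : Fin N → A, coveringRadius A ω

/-- The sequence `N ↦ 𝒫_s(A; N) / N^{s/d}`. -/
def normalizedPolarization {n : ℕ} (d : ℕ) (s : ℝ) (A : Set (E n)) (N : ℕ) : ℝ≥0∞ :=
  polarization s A N / (N : ℝ≥0∞) ^ (s / d)

/-- `lim_{N → ∞} 𝒫_s(A; N) / N^{s/d}` (meaningful when the limit exists). -/
def polarizationLimit {n : ℕ} (d : ℕ) (s : ℝ) (A : Set (E n)) : ℝ≥0∞ :=
  limUnder atTop (normalizedPolarization d s A)

/-- The cube `[0,1]^d`. -/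
def unitCube (d : ℕ) : Set (E d) := {x | ∀ i, x i ∈ Set.Icc (0 : ℝ) 1}

/-- The constant `σ_{s,d}`: the value for which
`lim_N 𝒫_s(A; N) / N^{s/d} = σ_{s,d} / H_d(A)^{s/d}` with the same `σ_{s,d}` for all `A`,
read off at the cube, where `H_d(A) = 1`. -/
def sigma (d : ℕ) (s : ℝ) : ℝ := (polarizationLimit d s (unitCube d)).toReal

/-- `H_d(A)`, the `d`-dimensional Hausdorff measure normalized by `H_d([0,1]^d) = 1`. -/
def hausdorffVol {n : ℕ} (d : ℕ) (A : Set (E n)) : ℝ :=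
  (Measure.euclideanHausdorffMeasure d A).toReal

/-- The unit normal field `∇F / |∇F|` of the level sets of `F`. -/
def unitNormal {n : ℕ} (F : E n → ℝ) (x : E n) : E n := ‖gradient F x‖⁻¹ • gradient F x

/-- The tangent space at `p` of the level set of `F` through `p` (a regular point). -/
abbrev tangent {n : ℕ} (F : E n → ℝ) (p : E n) : Submodule ℝ (E n) :=
  (Submodule.span ℝ {gradient F p})ᗮ

/-- The shape operator (Weingarten map) at `p` of the level set of `F` through `p`: the derivative
of the unit normal field, as an endomorphism of the tangent space. -/
def shapeOperator {n : ℕ} (F : E n → ℝ) (p : E n) : tangent F p →ₗ[ℝ] tangent F p :=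
  ((tangent F p).orthogonalProjectionOnto ∘L
    (fderiv ℝ (unitNormal F) p ∘L (tangent F p).subtypeL)).toLinearMap

/-- Gaussian curvature (up to the choice of orientation) at `p` of the level set of `F` through `p`:
the product of the principal curvatures. -/
def gaussianCurvature {n : ℕ} (F : E n → ℝ) (p : E n) : ℝ := LinearMap.det (shapeOperator F p)

/-- `S` is a `C²`-smooth embedded hypersurface with nowhere vanishing Gaussian curvature: near each
of its points it is the zero set of a `C²` function without critical points. -/
def IsCurvedHypersurface {n : ℕ} (S : Set (E n)) : Prop :=
  ∀ p ∈ S, ∃ (U : Set (E n)) (F : E n → ℝ), IsOpen U ∧ p ∈ U ∧ ContDiffOn ℝ 2 F U ∧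
    (∀ x ∈ U, gradient F x ≠ 0) ∧ (∀ x ∈ U, x ∈ S ↔ F x = 0) ∧ gaussianCurvature F p ≠ 0

/-- Strongly convex bodies. -/
structure IsStronglyConvexBody {n : ℕ} (A : Set (E n)) : Prop where
  isCompact : IsCompact A
  nonempty : A.Nonempty
  closure_interior : closure (interior A) = A
  convex : Convex ℝ A
  boundary : IsCurvedHypersurface (frontier A)

/-- `d`-admissible subsets of `ℝ^ℓ`: strongly convex bodies in `ℝ^d`, the unit sphere
`𝕊^d ⊂ ℝ^{d+1}`, and spherical caps in `𝕊^d`. -/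
inductive IsAdmissible (d : ℕ) : (ℓ : ℕ) → Set (E ℓ) → Prop
  | stronglyConvex (A : Set (E d)) (hA : IsStronglyConvexBody A) : IsAdmissible d d A
  | sphere : IsAdmissible d (d + 1) (Metric.sphere 0 1)
  | cap (e : E (d + 1)) (he : ‖e‖ = 1) (t : ℝ) (ht : -1 < t) (ht' : t < 1) :
      IsAdmissible d (d + 1) {x | x ∈ Metric.sphere (0 : E (d + 1)) 1 ∧ t ≤ inner ℝ e x}

/-- `A` is `d`-admissible or `A = [0,1]^d`. -/
inductive IsAdmissibleOrCube (d : ℕ) : (ℓ : ℕ) → Set (E ℓ) → Prop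
  | admissible (ℓ : ℕ) (A : Set (E ℓ)) (hA : IsAdmissible d ℓ A) : IsAdmissibleOrCube d ℓ A
  | cube : IsAdmissibleOrCube d d (unitCube d)

/-- The cube `[-R,R]^d`. -/
def cube (d : ℕ) (R : ℝ) : Set (E d) := {x | ∀ i, x i ∈ Set.Icc (-R) R}

/-- The family of closed unit balls with centers in `C` has density `δ`. -/
def HasBallDensity {d : ℕ} (C : Set (E d)) (δ : ℝ≥0∞) : Prop :=
  Tendsto (fun R : ℝ => (∑' x : C, volume (closedBall (x : E d) 1 ∩ cube d R)) /
    ENNReal.ofReal ((2 * R) ^ d)) atTop (𝓝 δ)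

/-- The optimal covering density `Γ_d` of `ℝ^d`: the infimum of the densities of families of unit
balls that cover `ℝ^d` and have a density. -/
def coveringDensity (d : ℕ) : ℝ :=
  (sInf {δ : ℝ≥0∞ | ∃ C : Set (E d),
    (⋃ x ∈ C, closedBall x 1) = Set.univ ∧ HasBallDensity C δ}).toReal

/-- `V_d = H_d(𝔹^d)`, the volume of the unit ball. -/
def ballVolume (d : ℕ) : ℝ := hausdorffVol d (closedBall (0 : E d) 1)

end

end RieszPolarization

open RieszPolarization

/-! Replacing the sum over the configuration by a maximum turns polarization into covering: since `x
↦ x ^ (-s)` reverses order, the max-version of the polarization constant is `ρ_A(N) ^ (-s)`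
(`genPol_false`). The asymptotics in `N` use only properties shared by finite sums and finite
maxima, so one argument about `genPol b` gives both limits.

For the cube, scaled copies of one configuration placed in `n ^ d` subcubes show that the normalized
constants converge to their supremum `cubeConst` (`tendsto_genPol_cube`). For `s > d` this is
finite: average the potential over the part of the cube that is not too close to the configuration.

Another set inherits this limit once it is, up to small volume, made of almost isometric cubes. For
the lower bound each cube receives points in proportion to its volume (`LowerApprox`). For the upper
bound some cube holds at most its share of any configuration, and the remaining points, at distance
at least `δ`, contribute `O(N) = o(N ^ (s / d))` (`UpperApprox`). Both properties hold for images of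
compact sets with null frontier under charts with `|φ x - φ y| = w x * w y * |x - y|`: the identity
for convex bodies, stereographic projection for caps. The sphere is exhausted by caps.

As `s → ∞`, one inequality is max ≤ sum. Conversely, if the sum is large everywhere, the points far
from the configuration form a set of volume exponentially small in `s`, so few extra points complete
the configuration to an efficient covering (`exists_coverConst_mul_le`). Finally the covering
constant of the cube is matched with `Γ_d`: a covering of space restricts to large cubes, and a
covering of the cube extends periodically (`coveringDensity_eq`). -/

namespace RieszPolarization

noncomputable section

/-! ### Aggregating a finite family: sums and suprema at once -/

/-- The sum (`b = true`) or the supremum (`b = false`) of a finite family. -/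
def agg (b : Bool) {ι : Type*} (t : Finset ι) (f : ι → ℝ≥0∞) : ℝ≥0∞ :=
  bif b then ∑ j ∈ t, f j else t.sup f

section agg

variable {ι κ : Type*} (b : Bool)

theorem agg_mono {t : Finset ι} {f g : ι → ℝ≥0∞} (h : ∀ j ∈ t, f j ≤ g j) :
    agg b t f ≤ agg b t g := by
  cases b
  · exact Finset.sup_mono_fun h
  · exact Finset.sum_le_sum h

theorem agg_mono_set {t u : Finset ι} (f : ι → ℝ≥0∞) (h : t ⊆ u) : agg b t f ≤ agg b u f := by
  cases b
  · exact Finset.sup_mono h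
  · exact Finset.sum_le_sum_of_subset h

theorem agg_const_mul (t : Finset ι) (c : ℝ≥0∞) (f : ι → ℝ≥0∞) :
    agg b t (fun j => c * f j) = c * agg b t f := by
  cases b
  · change t.sup (fun j => c * f j) = c * t.sup f
    simp only [Finset.sup_eq_iSup, ENNReal.mul_iSup]
  · exact (Finset.mul_sum _ _ _).symm

theorem agg_map (t : Finset κ) (e : κ ↪ ι) (f : ι → ℝ≥0∞) :
    agg b (t.map e) f = agg b t (f ∘ e) := by
  cases b
  · exact Finset.sup_map _ _ _
  · exact Finset.sum_map _ _ _

theorem agg_comp_le [Fintype ι] (t : Finset κ) {e : κ → ι} (he : Function.Injective e)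
    (f : ι → ℝ≥0∞) : agg b t (fun j => f (e j)) ≤ agg b Finset.univ f := by
  have := agg_map b t ⟨e, he⟩ f
  calc _ = _ := this.symm
    _ ≤ _ := agg_mono_set b f (Finset.subset_univ _)

theorem agg_univ_coe (t : Finset ι) (f : ι → ℝ≥0∞) :
    agg b (Finset.univ : Finset t) (fun j => f j) = agg b t f := by
  have := agg_map b (Finset.univ : Finset t) (Function.Embedding.subtype _) f
  rw [Finset.univ_eq_attach, Finset.attach_map_val] at this
  exact this.symm

theorem agg_le_card_mul {t : Finset ι} {f : ι → ℝ≥0∞} {c : ℝ≥0∞} (h : ∀ j ∈ t, f j ≤ c) :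
    agg b t f ≤ t.card * c := by
  cases b
  · refine Finset.sup_le fun j hj => (h j hj).trans ?_
    have : (1 : ℝ≥0∞) ≤ t.card := by exact_mod_cast Finset.card_pos.2 ⟨j, hj⟩
    exact le_mul_of_one_le_left' this
  · exact (Finset.sum_le_card_nsmul _ _ _ h).trans (by simp)

theorem agg_le_filter_add (t : Finset ι) (p : ι → Prop) [DecidablePred p] (f : ι → ℝ≥0∞) :
    agg b t f ≤ agg b (t.filter p) f + agg b (t.filter fun j => ¬ p j) f := by
  cases b
  · refine Finset.sup_le fun j hj => ?_
    by_cases hp : p j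
    · exact le_add_right (Finset.le_sup (f := f) (Finset.mem_filter.2 ⟨hj, hp⟩))
    · exact le_add_left (Finset.le_sup (f := f) (Finset.mem_filter.2 ⟨hj, hp⟩))
  · exact (Finset.sum_filter_add_sum_filter_not t p f).ge

theorem le_agg {t : Finset ι} (f : ι → ℝ≥0∞) {j : ι} (hj : j ∈ t) : f j ≤ agg b t f := by
  cases b
  · exact Finset.le_sup hj
  · exact Finset.single_le_sum (fun _ _ => zero_le) hj

theorem agg_le_sum (t : Finset ι) (f : ι → ℝ≥0∞) : agg b t f ≤ ∑ j ∈ t, f j := by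
  cases b
  · exact Finset.sup_le fun j hj => Finset.single_le_sum (fun _ _ => zero_le) hj
  · exact le_rfl

end agg

/-! ### Polarization constants for sums and suprema -/

/-- The polarization constant with the terms `|y - x_j|^{-s}` summed (`b = true`), or with their
maximum taken (`b = false`). -/
def genPol (b : Bool) {n : ℕ} (s : ℝ) (A : Set (E n)) (N : ℕ) : ℝ≥0∞ :=
  ⨆ ω : Fin N → A, ⨅ y : A, agg b Finset.univ fun j => edist (y : E n) (ω j : E n) ^ (-s)

theorem rpow_neg_iSup {ι : Sort*} {s : ℝ} (hs : 0 < s) (f : ι → ℝ≥0∞) :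
    (⨆ i, f i) ^ (-s) = ⨅ i, f i ^ (-s) := by
  simp only [ENNReal.rpow_neg]
  rw [← ENNReal.inv_iSup]
  congr 1
  exact (ENNReal.orderIsoRpow s hs).map_iSup f

theorem rpow_neg_iInf {ι : Sort*} {s : ℝ} (hs : 0 < s) (f : ι → ℝ≥0∞) :
    (⨅ i, f i) ^ (-s) = ⨆ i, f i ^ (-s) := by
  simp only [ENNReal.rpow_neg]
  rw [← ENNReal.inv_iInf]
  congr 1
  exact (ENNReal.orderIsoRpow s hs).map_iInf f

/-- The power `-s` is an order-reversing bijection of `[0, ∞]`, so it exchanges every supremum with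
an infimum in the definition of the covering radius. This link lets one proof treat both extremal
problems. -/
theorem genPol_false {n : ℕ} {s : ℝ} (hs : 0 < s) (A : Set (E n)) (N : ℕ) :
    genPol false s A N = bestCoveringRadius A N ^ (-s) := by
  unfold genPol bestCoveringRadius coveringRadius
  rw [rpow_neg_iInf hs]
  refine iSup_congr fun ω => ?_
  rw [rpow_neg_iSup hs]
  refine iInf_congr fun y => ?_
  rw [rpow_neg_iInf hs]
  simp [agg, Finset.sup_eq_iSup]

section genPol

variable {n : ℕ} {b : Bool} {s : ℝ} {A : Set (E n)}

theorem rpow_neg_le_rpow_neg {s : ℝ} (hs : 0 ≤ s) {x y : ℝ≥0∞} (h : x ≤ y) :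
    y ^ (-s) ≤ x ^ (-s) := by
  simp only [ENNReal.rpow_neg]
  exact ENNReal.inv_le_inv.2 (ENNReal.rpow_le_rpow h hs)

/-- Surplus places are filled with an arbitrary point of `A`; extra points never lower a sum or a
maximum. Arbitrary index types are allowed because configurations are later glued over disjoint
unions. -/
theorem le_genPol {ι : Type*} [Fintype ι] (hA : A.Nonempty) {N : ℕ} (hN : Fintype.card ι ≤ N)
    (ω : ι → E n) (hω : ∀ j, ω j ∈ A) {v : ℝ≥0∞}
    (hv : ∀ y ∈ A, v ≤ agg b Finset.univ fun j => edist y (ω j) ^ (-s)) :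
    v ≤ genPol b s A N := by
  classical
  obtain ⟨a, ha⟩ := hA
  let e : ι → Fin N := fun j => Fin.castLE hN (Fintype.equivFin ι j)
  have he : Function.Injective e := fun i j h => by
    simpa [e] using h
  let ω' : Fin N → A := Function.extend e (fun j => (⟨ω j, hω j⟩ : A)) fun _ => ⟨a, ha⟩
  unfold genPol
  refine le_iSup_of_le ω' (le_iInf fun y => ?_)
  refine (hv y y.2).trans ?_
  have h := agg_comp_le b (Finset.univ : Finset ι) he
    (fun j => edist (y : E n) (ω' j : E n) ^ (-s))
  refine le_trans (agg_mono b fun j _ => ?_) h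
  simp [ω', he.extend_apply]

theorem iInf_agg_le_genPol {ι : Type*} (hA : A.Nonempty) (t : Finset ι) (ω : ι → E n)
    (hω : ∀ j ∈ t, ω j ∈ A) :
    (⨅ y : A, agg b t fun j => edist (y : E n) (ω j) ^ (-s)) ≤ genPol b s A t.card := by
  refine le_genPol (ι := t) hA (by simp) (fun j => ω j) (fun j => hω j j.2) fun y hy => ?_
  refine (iInf_le _ (⟨y, hy⟩ : A)).trans ?_
  rw [← agg_univ_coe b t]

theorem exists_config_of_lt_genPol {N : ℕ} {v : ℝ≥0∞} (h : v < genPol b s A N) :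
    ∃ ω : Fin N → E n, (∀ j, ω j ∈ A) ∧
      ∀ y ∈ A, v ≤ agg b Finset.univ fun j => edist y (ω j) ^ (-s) := by
  unfold genPol at h
  obtain ⟨ω, hω⟩ := lt_iSup_iff.1 h
  refine ⟨fun j => ω j, fun j => (ω j).2, fun y hy => hω.le.trans ?_⟩
  exact iInf_le (fun y : A => agg b Finset.univ fun j => edist (y : E n) (ω j : E n) ^ (-s)) ⟨y, hy⟩

theorem genPol_mono (hA : A.Nonempty) : Monotone (genPol b s A) := by
  intro N M hNM
  refine le_of_forall_lt fun v hv => ?_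
  obtain ⟨v', hv', hv''⟩ := exists_between hv
  obtain ⟨ω, hω, h⟩ := exists_config_of_lt_genPol hv''
  exact hv'.trans_le (le_genPol hA (by simpa using hNM) ω hω h)

theorem genPol_le_genPol_true (b : Bool) (N : ℕ) : genPol b s A N ≤ genPol true s A N :=
  iSup_mono fun _ => iInf_mono fun _ => agg_le_sum b _ _

theorem genPol_zero (hA : A.Nonempty) : genPol b s A 0 = 0 := by
  obtain ⟨a, ha⟩ := hA
  refine le_antisymm (iSup_le fun ω => (iInf_le _ ⟨a, ha⟩).trans ?_) zero_le
  cases b <;> simp [agg]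

end genPol

/-! ### Transporting configurations from the unit cube -/

theorem mul_rpow_neg {a x : ℝ≥0∞} (ha : a ≠ 0) (ha' : a ≠ ⊤) {s : ℝ} (hs : 0 < s) :
    (a * x) ^ (-s) = a ^ (-s) * x ^ (-s) := by
  simp only [ENNReal.rpow_neg]
  rw [ENNReal.mul_rpow_of_nonneg _ _ hs.le, ENNReal.mul_inv]
  · left; simp [ENNReal.rpow_eq_zero_iff, ha, ha']
  · left; simp [ha', hs.le]

theorem unitCube_nonempty (d : ℕ) : (unitCube d).Nonempty :=
  ⟨0, fun i => by simp⟩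

/-- If `A` is covered by finitely many pieces into which the cube is mapped with controlled
distances, then configurations in the cube combine to a configuration in `A`. -/
theorem le_genPol_of_cover {d ℓ : ℕ} {b : Bool} {s : ℝ} (hs : 0 < s) {A : Set (E ℓ)}
    (hA : A.Nonempty) {ι : Type*} [Fintype ι] (f : ι → E d → E ℓ)
    (hf : ∀ i, ∀ x ∈ unitCube d, f i x ∈ A) (L : ι → ℝ≥0∞) (hL : ∀ i, L i ≠ 0)
    (hL' : ∀ i, L i ≠ ⊤)
    (hcov : ∀ y ∈ A, ∃ i, ∃ u ∈ unitCube d, ∀ x ∈ unitCube d,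
      edist y (f i x) ≤ L i * edist u x)
    (m : ι → ℕ) {N : ℕ} (hN : ∑ i, m i ≤ N) {v : ℝ≥0∞}
    (hv : ∀ i, v ≤ L i ^ (-s) * genPol b s (unitCube d) (m i)) : v ≤ genPol b s A N := by
  -- The supremum over configurations need not be attained, so it suffices to reach every strictly
  -- smaller level.
  refine le_of_forall_lt fun c hc => ?_
  obtain ⟨v', hv', hv''⟩ := exists_between hc
  refine hv'.trans_le ?_
  replace hv : ∀ i, v' < L i ^ (-s) * genPol b s (unitCube d) (m i) := fun i => hv''.trans_le (hv i)
  clear! v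
  rename' v' => v
  have H : ∀ i, ∃ ω : Fin (m i) → unitCube d, ∀ u : unitCube d,
      v ≤ L i ^ (-s) * agg b Finset.univ fun j => edist (u : E d) (ω j : E d) ^ (-s) := by
    intro i
    have h := hv i
    unfold genPol at h
    rw [ENNReal.mul_iSup] at h
    obtain ⟨ω, hω⟩ := lt_iSup_iff.1 h
    refine ⟨ω, fun u => hω.le.trans ?_⟩
    gcongr
    exact iInf_le
      (fun u : unitCube d => agg b Finset.univ fun j => edist (u : E d) (ω j : E d) ^ (-s)) u
  choose ω hω using H
  refine le_genPol (ι := Σ i, Fin (m i)) hA (by simpa using hN) (fun p => f p.1 (ω p.1 p.2))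
    (fun p => hf _ _ (ω p.1 p.2).2) fun y hy => ?_
  obtain ⟨i, u, hu, hiu⟩ := hcov y hy
  refine (hω i ⟨u, hu⟩).trans ?_
  rw [← agg_const_mul]
  refine le_trans (agg_mono b fun j _ => ?_)
    (agg_comp_le b (Finset.univ : Finset (Fin (m i)))
      (e := fun j => (⟨i, j⟩ : Σ i, Fin (m i))) (fun j k h => by simpa using h) _)
  rw [← mul_rpow_neg (hL i) (hL' i) hs]
  exact rpow_neg_le_rpow_neg hs.le (hiu _ (ω i j).2)

theorem edist_smul_add {n : ℕ} (c : ℝ) (a x y : E n) :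
    edist (c • (a + x)) (c • (a + y)) = ENNReal.ofReal |c| * edist x y := by
  rw [edist_smul₀, edist_add_left, ENNReal.smul_def, smul_eq_mul]
  congr 1
  rw [← Real.norm_eq_abs, ofReal_norm, enorm_eq_nnnorm]

theorem exists_subcube {d n : ℕ} (hn : 0 < n) {y : E d} (hy : y ∈ unitCube d) :
    ∃ k : Fin d → Fin n, ∃ u ∈ unitCube d,
      y = (n : ℝ)⁻¹ • (WithLp.toLp 2 (fun i => ((k i : ℕ) : ℝ)) + u) := by
  have hn' : (0 : ℝ) < n := by exact_mod_cast hn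
  -- The minimum with `n - 1` matters only when `y i = 1`, which belongs to the last closed subcube.
  have hk : ∀ i, min ⌊(n : ℝ) * y i⌋₊ (n - 1) < n := fun i =>
    (min_le_right _ _).trans_lt (Nat.sub_lt hn one_pos)
  refine ⟨fun i => ⟨_, hk i⟩,
    WithLp.toLp 2 fun i => n * y i - (min ⌊(n : ℝ) * y i⌋₊ (n - 1) : ℕ), fun i => ?_, ?_⟩
  · have h0 := (hy i).1
    have h1 := (hy i).2
    have hfl : ((⌊(n : ℝ) * y i⌋₊ : ℕ) : ℝ) ≤ n * y i := Nat.floor_le (by positivity)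
    have hfl' := Nat.lt_floor_add_one ((n : ℝ) * y i)
    have hny : (n : ℝ) * y i ≤ n := by nlinarith
    simp only [Set.mem_Icc]
    rcases le_total ⌊(n : ℝ) * y i⌋₊ (n - 1) with h | h
    · rw [min_eq_left h]; constructor <;> linarith
    · rw [min_eq_right h]
      have : ((n - 1 : ℕ) : ℝ) = n - 1 := by rw [Nat.cast_sub hn]; simp
      have h' : ((n - 1 : ℕ) : ℝ) ≤ (⌊(n : ℝ) * y i⌋₊ : ℕ) := by exact_mod_cast h
      constructor <;> linarith
  · ext i
    simp
    field_simp
    ring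

theorem subcube_mem {d n : ℕ} (hn : 0 < n) (k : Fin d → Fin n) {u : E d} (hu : u ∈ unitCube d) :
    (n : ℝ)⁻¹ • (WithLp.toLp 2 (fun i => ((k i : ℕ) : ℝ)) + u) ∈ unitCube d := by
  intro i
  have hn' : (0 : ℝ) < n := by exact_mod_cast hn
  have h0 := (hu i).1
  have h1 := (hu i).2
  have h2 : ((k i : ℕ) : ℝ) + 1 ≤ n := by exact_mod_cast (k i).2
  simp only [PiLp.smul_apply, PiLp.add_apply, smul_eq_mul, Set.mem_Icc]
  constructor
  · positivity
  · rw [inv_mul_le_iff₀ hn']; linarith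

/-- Put a copy scaled by `1 / n` in each of the `n ^ d` subcubes. A point already receives enough
from the copy in its own subcube, whose potential is scaled by `n ^ s`. -/
theorem genPol_cube_mul {d : ℕ} {b : Bool} {s : ℝ} (hs : 0 < s) {n : ℕ} (hn : 0 < n) (N : ℕ) :
    (n : ℝ≥0∞) ^ s * genPol b s (unitCube d) N ≤ genPol b s (unitCube d) (n ^ d * N) := by
  have hpow : (n : ℝ≥0∞) ^ s = ((n : ℝ≥0∞)⁻¹) ^ (-s) := by
    rw [ENNReal.rpow_neg, ENNReal.inv_rpow, inv_inv]
  refine le_genPol_of_cover (ι := Fin d → Fin n) hs (unitCube_nonempty d)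
    (fun k u => (n : ℝ)⁻¹ • (WithLp.toLp 2 (fun i => ((k i : ℕ) : ℝ)) + u))
    (fun k u hu => subcube_mem hn k hu) (fun _ => (n : ℝ≥0∞)⁻¹) (by simp)
    (fun _ => by simpa using hn.ne') ?_ (fun _ => N) (by simp) (fun _ => by rw [← hpow])
  intro y hy
  obtain ⟨k, u, hu, rfl⟩ := exists_subcube hn hy
  refine ⟨k, u, hu, fun x _ => ?_⟩
  rw [edist_smul_add, abs_of_nonneg (by positivity),
    ENNReal.ofReal_inv_of_pos (by exact_mod_cast hn), ENNReal.ofReal_natCast]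

/-! ### The limit for the cube -/

/-- The limit of the normalized polarization constants of the cube. -/
def cubeConst (b : Bool) (d : ℕ) (s : ℝ) : ℝ≥0∞ :=
  ⨆ N : ℕ, genPol b s (unitCube d) N / (N : ℝ≥0∞) ^ (s / d)

theorem genPol_cube_le {d : ℕ} (hd : 1 ≤ d) (b : Bool) {s : ℝ} (hs : 0 < s) (N : ℕ) :
    genPol b s (unitCube d) N ≤ cubeConst b d s * (N : ℝ≥0∞) ^ (s / d) := by
  rcases N.eq_zero_or_pos with rfl | hN
  · rw [genPol_zero (unitCube_nonempty d)]; exact zero_le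
  · have hsd : 0 < s / d := by positivity
    rw [← ENNReal.div_le_iff]
    · exact le_iSup (fun N : ℕ => genPol b s (unitCube d) N / (N : ℝ≥0∞) ^ (s / d)) N
    · simp [ENNReal.rpow_eq_zero_iff, hN.ne', hsd]
    · simp [hsd.le]

/-- A Fekete-type argument: self-similarity propagates a nearly optimal value at one `N` to all the
numbers `n ^ d * N`, and monotonicity fills the gaps between them. -/
theorem tendsto_genPol_cube {d : ℕ} (hd : 1 ≤ d) (b : Bool) {s : ℝ} (hs : 0 < s) :
    Tendsto (fun N : ℕ => genPol b s (unitCube d) N / (N : ℝ≥0∞) ^ (s / d)) atTop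
      (𝓝 (cubeConst b d s)) := by
  have hd0 : (0 : ℝ) < d := by exact_mod_cast hd
  have hsd : 0 < s / d := by positivity
  refine tendsto_order.2 ⟨fun v hv => ?_, fun v hv => Eventually.of_forall fun N =>
    (le_iSup (fun N : ℕ => genPol b s (unitCube d) N / (N : ℝ≥0∞) ^ (s / d)) N).trans_lt hv⟩
  obtain ⟨N, hN⟩ := lt_iSup_iff.1 hv
  have hN0 : 0 < N := by
    rcases N.eq_zero_or_pos with rfl | h
    · rw [genPol_zero (unitCube_nonempty d)] at hN; simp at hN
    · exact h
  have hN0' : (0 : ℝ) < N := by exact_mod_cast hN0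
  set a := genPol b s (unitCube d) N / (N : ℝ≥0∞) ^ (s / d) with ha
  -- Chosen so that `x M ^ d * N = M`. Using `⌊x M⌋₊` subcubes per side costs only the factor `(⌊x
  -- M⌋₊ / x M) ^ s`, which tends to 1.
  let x : ℕ → ℝ := fun M => ((M : ℝ) / N) ^ (1 / (d : ℝ))
  have hx : Tendsto x atTop atTop :=
    (tendsto_rpow_atTop (by positivity)).comp
      (tendsto_natCast_atTop_atTop.atTop_div_const hN0')
  have hlim : Tendsto (fun M => ENNReal.ofReal (((⌊x M⌋₊ : ℝ) / x M) ^ s) * a) atTop (𝓝 a) := by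
    have h1 : Tendsto (fun M => ((⌊x M⌋₊ : ℝ) / x M) ^ s) atTop (𝓝 1) := by
      have := (tendsto_nat_floor_div_atTop (R := ℝ)).comp hx
      simpa using this.rpow_const (p := s) (Or.inl one_ne_zero)
    have h2 := ENNReal.Tendsto.mul_const (b := a) (ENNReal.tendsto_ofReal h1) (Or.inl (by simp))
    simpa using h2
  filter_upwards [hlim.eventually (lt_mem_nhds hN), hx.eventually_ge_atTop 1,
    eventually_ge_atTop 1] with M hM hxM hM1
  refine hM.trans_le ?_
  have hM0 : (0 : ℝ) < M := by exact_mod_cast hM1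
  have hx0 : 0 < x M := by linarith
  have hfl : 0 < ⌊x M⌋₊ := Nat.floor_pos.2 hxM
  have hxd : (x M) ^ d * N = M := by
    simp only [x]
    rw [← Real.rpow_natCast, ← Real.rpow_mul (by positivity), one_div_mul_cancel hd0.ne',
      Real.rpow_one]
    field_simp
  have hle : ⌊x M⌋₊ ^ d * N ≤ M := by
    have : ((⌊x M⌋₊ ^ d * N : ℕ) : ℝ) ≤ M := by
      push_cast
      rw [← hxd]
      gcongr
      exact Nat.floor_le hx0.le
    exact_mod_cast this
  have key := (genPol_cube_mul (d := d) (b := b) hs hfl N).trans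
    (genPol_mono (unitCube_nonempty d) hle)
  have hMp : (M : ℝ≥0∞) ^ (s / d) = ENNReal.ofReal ((x M) ^ s) * (N : ℝ≥0∞) ^ (s / d) := by
    rw [← ENNReal.ofReal_natCast M, ← ENNReal.ofReal_natCast N,
      ENNReal.ofReal_rpow_of_pos hM0, ENNReal.ofReal_rpow_of_pos hN0',
      ← ENNReal.ofReal_mul (by positivity)]
    congr 1
    nth_rewrite 1 [← hxd]
    rw [Real.mul_rpow (by positivity) hN0'.le, ← Real.rpow_natCast, ← Real.rpow_mul hx0.le]
    congr 2
    field_simp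
  calc ENNReal.ofReal (((⌊x M⌋₊ : ℝ) / x M) ^ s) * a
      = (⌊x M⌋₊ : ℝ≥0∞) ^ s * genPol b s (unitCube d) N / (M : ℝ≥0∞) ^ (s / d) := by
        rw [hMp, ha, Real.div_rpow (by positivity) hx0.le, ENNReal.ofReal_div_of_pos (by positivity),
          ← ENNReal.ofReal_rpow_of_pos (by exact_mod_cast hfl), ENNReal.ofReal_natCast,
          ENNReal.div_eq_inv_mul, ENNReal.div_eq_inv_mul, ENNReal.div_eq_inv_mul,
          ENNReal.mul_inv (by left; simpa using by positivity) (by left; simp)]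
        ring
    _ ≤ _ := by gcongr

/-! ### Integrals of Riesz kernels away from the diagonal -/

/-- For `|y - x| ≥ r` one has `|y - x| ≥ (r + |y - x|) / 2`, so the kernel is dominated by a
multiple of `(1 + |y - x| / r) ^ (-s)`, integrable because `s > d`. Rescaling by `r` produces the
power `r ^ (d - s)`. -/
theorem exists_lintegral_kernel_le {d : ℕ} {s : ℝ} (hs : (d : ℝ) < s) :
    ∃ C : ℝ, 0 < C ∧ ∀ (x : E d) (r : ℝ), 0 < r →
      ∫⁻ y in {y | r ≤ dist y x}, edist y x ^ (-s) ≤ ENNReal.ofReal (C * r ^ (d - s)) := by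
  have hs0 : 0 < s := lt_of_le_of_lt d.cast_nonneg hs
  set J : ℝ≥0∞ := ∫⁻ y : E d, ENNReal.ofReal ((1 + ‖y‖) ^ (-s)) with hJ
  have hJt : J < ⊤ := finite_integral_one_add_norm (by simpa using hs)
  refine ⟨2 ^ s * J.toReal + 1, by positivity, fun x r hr => ?_⟩
  have hmeas : Measurable fun y : E d => ENNReal.ofReal ((1 + ‖y‖) ^ (-s)) := by fun_prop
  have hpt : ∀ y ∈ {y : E d | r ≤ dist y x}, edist y x ^ (-s) ≤
      ENNReal.ofReal (2 ^ s * r ^ (-s)) * ENNReal.ofReal ((1 + ‖r⁻¹ • (y - x)‖) ^ (-s)) := by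
    intro y hy
    have hy' : r ≤ ‖y - x‖ := by simpa [dist_eq_norm] using hy
    have hpos : 0 < ‖y - x‖ := hr.trans_le hy'
    rw [edist_dist, dist_eq_norm, ENNReal.ofReal_rpow_of_pos hpos,
      ← ENNReal.ofReal_mul (by positivity)]
    apply ENNReal.ofReal_le_ofReal
    have h2 : (2 : ℝ) ^ s = (2⁻¹ : ℝ) ^ (-s) := by
      rw [Real.rpow_neg (by norm_num), Real.inv_rpow (by norm_num), inv_inv]
    rw [h2, ← Real.mul_rpow (by norm_num) hr.le, ← Real.mul_rpow (by positivity) (by positivity)]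
    apply Real.rpow_le_rpow_of_nonpos (by positivity) _ (by linarith)
    rw [norm_smul, norm_inv, Real.norm_of_nonneg hr.le]
    have : 2⁻¹ * r * (1 + r⁻¹ * ‖y - x‖) = 2⁻¹ * (r + ‖y - x‖) := by field_simp
    rw [this]; linarith
  have hmap : ∫⁻ y : E d, ENNReal.ofReal ((1 + ‖r⁻¹ • (y - x)‖) ^ (-s)) =
      ENNReal.ofReal (r ^ d) * J := by
    rw [lintegral_sub_right_eq_self (fun y : E d => ENNReal.ofReal ((1 + ‖r⁻¹ • y‖) ^ (-s))) x]
    have hmm : Measurable fun y : E d => r⁻¹ • y := by fun_prop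
    rw [← lintegral_map (f := fun y : E d => ENNReal.ofReal ((1 + ‖y‖) ^ (-s))) hmeas hmm,
      Measure.map_addHaar_smul _ (inv_ne_zero hr.ne'), lintegral_smul_measure]
    simp only [inv_pow, inv_inv, finrank_euclideanSpace_fin, abs_of_pos (pow_pos hr d),
      smul_eq_mul, hJ]
  calc ∫⁻ y in {y | r ≤ dist y x}, edist y x ^ (-s)
      ≤ ∫⁻ y in {y | r ≤ dist y x},
        ENNReal.ofReal (2 ^ s * r ^ (-s)) * ENNReal.ofReal ((1 + ‖r⁻¹ • (y - x)‖) ^ (-s)) :=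
        setLIntegral_mono' (measurableSet_le (by fun_prop) (by fun_prop)) hpt
    _ ≤ ∫⁻ y, ENNReal.ofReal (2 ^ s * r ^ (-s)) *
        ENNReal.ofReal ((1 + ‖r⁻¹ • (y - x)‖) ^ (-s)) := setLIntegral_le_lintegral _ _
    _ = ENNReal.ofReal (2 ^ s * r ^ (-s)) * (ENNReal.ofReal (r ^ d) * J) := by
        rw [lintegral_const_mul' _ _ (by simp), hmap]
    _ = ENNReal.ofReal (2 ^ s * J.toReal * r ^ (d - s)) := by
        rw [← ENNReal.ofReal_toReal hJt.ne, ← ENNReal.ofReal_mul (by positivity),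
          ← ENNReal.ofReal_mul (by positivity), ENNReal.toReal_ofReal (by positivity),
          Real.rpow_sub hr, Real.rpow_neg hr.le, Real.rpow_natCast]
        congr 1
        ring
    _ ≤ _ := ENNReal.ofReal_le_ofReal (by gcongr; linarith)

/-- The set of points at distance at least `r` from all points of a configuration, on which a sum of
kernels is at least `v`, has small volume. -/
theorem exists_mul_volume_le {d : ℕ} {s : ℝ} (hs : (d : ℝ) < s) :
    ∃ C : ℝ, 0 < C ∧ ∀ (N : ℕ) (ω : Fin N → E d) (r : ℝ), 0 < r → ∀ (Y : Set (E d)) (v : ℝ≥0∞),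
      (∀ y ∈ Y, ∀ j, r ≤ dist y (ω j)) → (∀ y ∈ Y, v ≤ ∑ j, edist y (ω j) ^ (-s)) →
      v * volume Y ≤ ENNReal.ofReal (C * N * r ^ (d - s)) := by
  obtain ⟨C, hC, h⟩ := exists_lintegral_kernel_le hs
  refine ⟨C, hC, fun N ω r hr Y v hY hv => ?_⟩
  have hm : ∀ j : Fin N, Measurable fun y : E d => edist y (ω j) ^ (-s) := fun j => by fun_prop
  calc v * volume Y = ∫⁻ _ in Y, v := by rw [setLIntegral_const]
    _ ≤ ∫⁻ y in Y, ∑ j, edist y (ω j) ^ (-s) :=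
        setLIntegral_mono (Finset.measurable_sum _ fun j _ => hm j) hv
    _ = ∑ j, ∫⁻ y in Y, edist y (ω j) ^ (-s) := lintegral_finsetSum _ fun j _ => hm j
    _ ≤ ∑ j : Fin N, ENNReal.ofReal (C * r ^ (d - s)) := by
        refine Finset.sum_le_sum fun j _ => le_trans ?_ (h (ω j) r hr)
        exact lintegral_mono_set fun y hy => hY y hy j
    _ = ENNReal.ofReal (C * N * r ^ (d - s)) := by
        rw [Finset.sum_const, Finset.card_univ, Fintype.card_fin, nsmul_eq_mul,
          ← ENNReal.ofReal_natCast, ← ENNReal.ofReal_mul (by positivity)]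
        congr 1; ring

/-! ### Finiteness and positivity of the cube constant. -/

theorem volume_setOf_forall_mem {d : ℕ} (S : Fin d → Set ℝ) :
    volume {x : E d | ∀ i, x i ∈ S i} = ∏ i, volume (S i) := by
  rw [← Measure.pi_pi (fun _ : Fin d => (volume : Measure ℝ)) S]
  have h := (PiLp.volume_preserving_ofLp (Fin d)).measure_preimage_equiv
    (f := (MeasurableEquiv.toLp 2 (Fin d → ℝ)).symm) (Set.univ.pi S)
  rw [← volume_pi, ← h]
  congr 1
  ext x
  simp [Set.mem_pi]

theorem volume_unitCube (d : ℕ) : volume (unitCube d) = 1 := by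
  unfold unitCube
  rw [volume_setOf_forall_mem fun _ => Set.Icc (0 : ℝ) 1]
  simp

/-- Delete from the cube balls of total volume at most one half around the configuration. On the
rest the minimum of the potential is at most its average, which the kernel integral bounds by a
multiple of `N ^ (s / d)`. -/
theorem cubeConst_lt_top {d : ℕ} (hd : 1 ≤ d) (b : Bool) {s : ℝ} (hs : (d : ℝ) < s) :
    cubeConst b d s < ⊤ := by
  have hd0 : (0 : ℝ) < d := by exact_mod_cast hd
  have hs0 : 0 < s := hd0.trans hs
  have : Nonempty (Fin d) := ⟨⟨0, hd⟩⟩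
  obtain ⟨C, hC, h⟩ := exists_mul_volume_le hs
  set V : ℝ := (volume (ball (0 : E d) 1)).toReal with hV
  have hVpos : 0 < V := ENNReal.toReal_pos (measure_ball_pos _ _ one_pos).ne' measure_ball_lt_top.ne
  refine lt_of_le_of_lt (iSup_le fun N => ?_)
    (ENNReal.ofReal_lt_top (r := 2 * C * (2 * V) ^ (-(d - s) / d)))
  rcases N.eq_zero_or_pos with rfl | hN
  · rw [genPol_zero (unitCube_nonempty d)]; simp
  have hN0 : (0 : ℝ) < N := by exact_mod_cast hN
  have hsd : 0 < s / d := by positivity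
  rw [ENNReal.div_le_iff (by simp [ENNReal.rpow_eq_zero_iff, hN.ne', hsd]) (by simp [hsd.le])]
  refine (genPol_le_genPol_true b N).trans (le_of_forall_lt fun v hv => ?_)
  obtain ⟨v', hv', hv''⟩ := exists_between hv
  refine hv'.trans_le ?_
  obtain ⟨ω, -, hU⟩ := exists_config_of_lt_genPol hv''
  -- With this radius the `N` balls have total volume exactly `1 / 2`.
  set r : ℝ := (2 * V * N) ^ (-(1 / (d : ℝ))) with hr
  have hrpos : 0 < r := by positivity
  have hrd : r ^ d = (2 * V * N)⁻¹ := by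
    rw [hr, ← Real.rpow_natCast, ← Real.rpow_mul (by positivity), neg_mul,
      one_div_mul_cancel hd0.ne', Real.rpow_neg_one]
  set Y : Set (E d) := unitCube d \ ⋃ j, ball (ω j) r with hY
  have hvol : 2⁻¹ ≤ volume Y := by
    have h1 : volume (⋃ j, ball (ω j) r) ≤ 2⁻¹ := by
      refine (measure_iUnion_fintype_le _ _).trans ?_
      simp only [Measure.addHaar_ball _ _ hrpos.le, finrank_euclideanSpace_fin, Finset.sum_const,
        Finset.card_univ, Fintype.card_fin, nsmul_eq_mul]
      rw [← ENNReal.ofReal_toReal (measure_ball_lt_top (μ := volume) (x := (0 : E d)) (r := 1)).ne,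
        ← hV, ← ENNReal.ofReal_mul (by positivity), ← ENNReal.ofReal_natCast,
        ← ENNReal.ofReal_mul (by positivity), hrd, ← ENNReal.ofReal_ofNat 2,
        ← ENNReal.ofReal_inv_of_pos (by norm_num)]
      apply ENNReal.ofReal_le_ofReal
      field_simp
      exact le_rfl
    have h2 := le_measure_sdiff (μ := volume) (s₁ := unitCube d) (s₂ := ⋃ j, ball (ω j) r)
    rw [volume_unitCube] at h2
    refine le_trans ?_ h2
    rw [ENNReal.le_sub_iff_add_le_left (h1.trans_lt (by simp)).ne (h1.trans (by simp))]
    calc _ ≤ (2⁻¹ : ℝ≥0∞) + 2⁻¹ := by gcongr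
      _ = 1 := ENNReal.inv_two_add_inv_two
  have key := h N ω r hrpos Y v' (fun y hy j => by
    have := hy.2
    simp only [Set.mem_iUnion, mem_ball, not_exists, not_lt] at this
    exact this j) fun y hy => hU y hy.1
  have hfin : v' ≤ 2 * ENNReal.ofReal (C * N * r ^ (d - s)) := by
    calc v' = 2 * (v' * 2⁻¹) := by
          rw [mul_comm v', ← mul_assoc, ENNReal.mul_inv_cancel (by simp) (by simp), one_mul]
      _ ≤ _ := by gcongr; exact (by gcongr : v' * 2⁻¹ ≤ v' * volume Y).trans key
  refine hfin.trans (le_of_eq ?_)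
  rw [← ENNReal.ofReal_ofNat 2, ← ENNReal.ofReal_mul (by norm_num), ← ENNReal.ofReal_natCast N,
    ENNReal.ofReal_rpow_of_pos hN0, ← ENNReal.ofReal_mul (by positivity)]
  congr 1
  rw [hr, ← Real.rpow_mul (by positivity)]
  have e1 : -(1 / (d : ℝ)) * (d - s) = -(d - s) / d := by ring
  rw [e1, Real.mul_rpow (by positivity) hN0.le]
  have e2 : s / d = 1 + -(d - s) / d := by field_simp; ring
  rw [e2, Real.rpow_add hN0, Real.rpow_one]
  ring

/-- The single-point configuration suffices, since the cube has finite diameter. -/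
theorem cubeConst_pos {d : ℕ} (b : Bool) {s : ℝ} (hs : 0 < s) : 0 < cubeConst b d s := by
  have hle : genPol b s (unitCube d) 1 / ((1 : ℕ) : ℝ≥0∞) ^ (s / d) ≤ cubeConst b d s :=
    le_iSup (fun N : ℕ => genPol b s (unitCube d) N / (N : ℝ≥0∞) ^ (s / d)) 1
  refine lt_of_lt_of_le ?_ hle
  simp only [Nat.cast_one, ENNReal.one_rpow, div_one]
  have hb : Bornology.IsBounded (unitCube d) := by
    refine (isBounded_closedBall (x := (0 : E d)) (r := Real.sqrt d)).subset fun x hx => ?_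
    rw [mem_closedBall_zero_iff, EuclideanSpace.norm_eq]
    apply Real.sqrt_le_sqrt
    calc ∑ i, ‖x i‖ ^ 2 ≤ ∑ i : Fin d, (1 : ℝ) := Finset.sum_le_sum fun i _ => by
          have := hx i
          rw [Real.norm_of_nonneg this.1]
          exact pow_le_one₀ this.1 this.2
      _ = d := by simp
  have hdiam : ediam (unitCube d) ≠ ⊤ := hb.ediam_ne_top
  refine lt_of_lt_of_le (b := ediam (unitCube d) ^ (-s)) ?_ ?_
  · rw [ENNReal.rpow_neg, ENNReal.inv_pos]
    exact ENNReal.rpow_ne_top_of_nonneg hs.le hdiam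
  · refine le_genPol (ι := Fin 1) (unitCube_nonempty d) (by simp) (fun _ => 0)
      (fun _ => by intro i; simp) fun y hy => ?_
    refine le_trans ?_ (le_agg b _ (Finset.mem_univ (0 : Fin 1)))
    exact rpow_neg_le_rpow_neg hs.le (edist_le_ediam_of_mem hy (by intro i; simp))

/-! ### Sets that are almost tiled by images of the cube -/

/-- `A` can be covered by almost isometric images of scaled cubes whose total volume is at most
`V + ε`, where the cubes carry their configurations into `A`. -/
def LowerApprox (d : ℕ) {ℓ : ℕ} (A : Set (E ℓ)) (V : ℝ) : Prop :=
  ∀ ε > 0, ∃ (ι : Type) (_ : Fintype ι) (f : ι → E d → E ℓ) (L : ι → ℝ),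
    (∀ i, 0 < L i) ∧ (∀ i, ∀ x ∈ unitCube d, f i x ∈ A) ∧
    (∀ y ∈ A, ∃ i, ∃ u ∈ unitCube d, ∀ x ∈ unitCube d, dist y (f i x) ≤ L i * dist u x) ∧
    ∑ i, L i ^ d ≤ V + ε

/-- `A` contains separated almost isometric images of scaled cubes, of total volume at least
`V - ε`, such that the points of `A` near one of them can be replaced by points of that cube. -/
def UpperApprox (d : ℕ) {ℓ : ℕ} (A : Set (E ℓ)) (V : ℝ) : Prop :=
  ∀ ε > 0, ∃ (ι : Type) (_ : Fintype ι) (g : ι → E d → E ℓ) (W : ι → Set (E ℓ)) (l : ι → ℝ)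
    (δ : ℝ), 0 < δ ∧ (∀ i, 0 < l i) ∧ (∀ i, ∀ u ∈ unitCube d, g i u ∈ A) ∧
    Pairwise (fun i j => Disjoint (W i) (W j)) ∧
    (∀ i, ∀ z ∈ A, z ∉ W i → ∀ u ∈ unitCube d, δ ≤ dist (g i u) z) ∧
    (∀ i, ∀ z ∈ A, z ∈ W i → ∃ x ∈ unitCube d, ∀ u ∈ unitCube d,
      l i * dist u x ≤ dist (g i u) z) ∧
    V - ε ≤ ∑ i, l i ^ d

theorem LowerApprox.union {d ℓ : ℕ} {A A' : Set (E ℓ)} {V V' : ℝ} (h : LowerApprox d A V)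
    (h' : LowerApprox d A' V') : LowerApprox d (A ∪ A') (V + V') := by
  intro ε hε
  obtain ⟨ι, _, f, L, h1, h2, h3, h4⟩ := h (ε / 2) (by positivity)
  obtain ⟨ι', _, f', L', h1', h2', h3', h4'⟩ := h' (ε / 2) (by positivity)
  refine ⟨ι ⊕ ι', inferInstance, Sum.elim f f', Sum.elim L L', ?_, ?_, ?_, ?_⟩
  · rintro (i | i)
    exacts [h1 i, h1' i]
  · rintro (i | i) x hx
    exacts [Or.inl (h2 i x hx), Or.inr (h2' i x hx)]
  · rintro y (hy | hy)
    · obtain ⟨i, hi⟩ := h3 y hy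
      exact ⟨Sum.inl i, hi⟩
    · obtain ⟨i, hi⟩ := h3' y hy
      exact ⟨Sum.inr i, hi⟩
  · simp only [Fintype.sum_sum_type, Sum.elim_inl, Sum.elim_inr]
    linarith

/-- Giving the cube of scale `L i` a number of points proportional to `L i ^ d` makes all cubes
reach the same level asymptotically, because `L ^ (-s) * (L ^ d) ^ (s / d) = 1`. -/
theorem LowerApprox.eventually_lt {d ℓ : ℕ} (hd : 1 ≤ d) (b : Bool) {s : ℝ}
    (hs : (d : ℝ) < s) {A : Set (E ℓ)} {V : ℝ} (hA : A.Nonempty) (hV : 0 < V) (h : LowerApprox d A V)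
    {v : ℝ≥0∞} (hv : v < ENNReal.ofReal ((cubeConst b d s).toReal * V ^ (-(s / d)))) :
    ∀ᶠ N : ℕ in atTop, v < genPol b s A N / (N : ℝ≥0∞) ^ (s / d) := by
  have hd0 : (0 : ℝ) < d := by exact_mod_cast hd
  have hs0 : 0 < s := hd0.trans hs
  have hsd : 0 < s / d := by positivity
  have hKt := cubeConst_lt_top hd b hs
  set K := (cubeConst b d s).toReal with hK
  have hK0 : 0 < K := ENNReal.toReal_pos (cubeConst_pos b hs0).ne' hKt.ne
  have hKe : cubeConst b d s = ENNReal.ofReal K := (ENNReal.ofReal_toReal hKt.ne).symm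
  have hcont : Tendsto (fun η : ℝ => ENNReal.ofReal (K * (1 - η) * (V + 2 * η) ^ (-(s / d))))
      (𝓝[>] 0) (𝓝 (ENNReal.ofReal (K * V ^ (-(s / d))))) := by
    refine (ENNReal.tendsto_ofReal ?_).mono_left nhdsWithin_le_nhds
    have h1 : Tendsto (fun η : ℝ => K * (1 - η)) (𝓝 0) (𝓝 (K * (1 - 0))) :=
      (continuous_const.mul (continuous_const.sub continuous_id)).tendsto 0
    have h2 : Tendsto (fun η : ℝ => V + 2 * η) (𝓝 0) (𝓝 (V + 2 * 0)) :=
      (continuous_const.add (continuous_const.mul continuous_id)).tendsto 0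
    have h3 := h1.mul (h2.rpow_const (p := -(s / d)) (Or.inl (by simpa using hV.ne')))
    simpa using h3
  obtain ⟨η, hη, hη1⟩ := ((hcont.eventually (lt_mem_nhds hv)).and
    (Ioo_mem_nhdsGT (zero_lt_one (α := ℝ)))).exists
  have hη0 : 0 < η := hη1.1
  obtain ⟨ι, _, f, L, hL, hf, hcov, hsum⟩ := h η hη0
  -- The cubes use `V + η` of this budget; the second `η` pays, for large `N`, for rounding each `m
  -- N i` up.
  set T' := V + 2 * η with hT'
  have hT'0 : 0 < T' := by positivity
  have hκ : ENNReal.ofReal (K * (1 - η)) < cubeConst b d s := by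
    rw [hKe]
    exact (ENNReal.ofReal_lt_ofReal_iff hK0).2 (by nlinarith)
  let m : ℕ → ι → ℕ := fun N i => ⌈L i ^ d * (N / T')⌉₊
  have hm : ∀ i, Tendsto (fun N => m N i) atTop atTop := fun i =>
    tendsto_nat_ceil_atTop.comp <| (tendsto_natCast_atTop_atTop.atTop_div_const hT'0).const_mul_atTop
      (pow_pos (hL i) d)
  have hcard : ∀ᶠ N : ℕ in atTop, (Fintype.card ι : ℝ) ≤ η / T' * N :=
    ((tendsto_natCast_atTop_atTop (R := ℝ)).const_mul_atTop (by positivity)).eventually_ge_atTop _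
  have hev : ∀ᶠ N : ℕ in atTop, ∀ i, ENNReal.ofReal (K * (1 - η)) <
      genPol b s (unitCube d) (m N i) / (m N i : ℝ≥0∞) ^ (s / d) :=
    eventually_all.2 fun i =>
      (hm i).eventually ((tendsto_genPol_cube hd b hs0).eventually (lt_mem_nhds hκ))
  filter_upwards [hcard, hev, eventually_ge_atTop 1] with N hN1 hN2 hN3
  have hN0 : (0 : ℝ) < N := by exact_mod_cast hN3
  refine hη.trans_le ?_
  rw [ENNReal.le_div_iff_mul_le (Or.inl (by simp [ENNReal.rpow_eq_zero_iff, hsd]; omega))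
    (Or.inl (by simp [hsd.le])), ← ENNReal.ofReal_natCast, ENNReal.ofReal_rpow_of_pos hN0,
    ← ENNReal.ofReal_mul (by have := hη1.2; have : 0 ≤ 1 - η := by linarith
                             positivity)]
  refine le_genPol_of_cover hs0 hA f hf (fun i => ENNReal.ofReal (L i)) (by simpa using hL) (by simp)
    ?_ (m N) ?_ fun i => ?_
  · intro y hy
    obtain ⟨i, u, hu, hx⟩ := hcov y hy
    refine ⟨i, u, hu, fun x hx' => ?_⟩
    rw [edist_dist, edist_dist, ← ENNReal.ofReal_mul (hL i).le]
    exact ENNReal.ofReal_le_ofReal (hx x hx')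
  · have h1 : ((∑ i, m N i : ℕ) : ℝ) ≤ N := by
      push_cast
      calc ∑ i, (m N i : ℝ) ≤ ∑ i, (L i ^ d * (N / T') + 1) := Finset.sum_le_sum fun i _ =>
            (Nat.ceil_lt_add_one (by have := hL i; positivity)).le
        _ = (∑ i, L i ^ d) * (N / T') + Fintype.card ι := by
            rw [Finset.sum_add_distrib, ← Finset.sum_mul]; simp
        _ ≤ (V + η) * (N / T') + η / T' * N := by gcongr
        _ = N := by rw [hT']; field_simp; ring
    exact_mod_cast h1
  · have h1 := (hN2 i).le
    have hm0 : L i ^ d * (N / T') ≤ m N i := Nat.le_ceil _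
    have hpos : 0 < L i ^ d * (N / T') := by have := hL i; positivity
    have hmpos : (0 : ℝ) < m N i := hpos.trans_le hm0
    rw [ENNReal.le_div_iff_mul_le
      (Or.inl (by simp [ENNReal.rpow_eq_zero_iff, hsd]; exact_mod_cast hmpos.ne'))
      (Or.inl (by simp [hsd.le]))] at h1
    refine le_trans ?_ (mul_le_mul_right h1 _)
    have hη1' : 0 < 1 - η := by have := hη1.2; linarith
    rw [ENNReal.ofReal_rpow_of_pos (hL i), ← ENNReal.ofReal_natCast,
      ENNReal.ofReal_rpow_of_pos hmpos, ← ENNReal.ofReal_mul (by positivity),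
      ← ENNReal.ofReal_mul (by have := hL i; positivity)]
    apply ENNReal.ofReal_le_ofReal
    calc K * (1 - η) * T' ^ (-(s / d)) * (N : ℝ) ^ (s / d)
        = L i ^ (-s) * (K * (1 - η) * (L i ^ d * (N / T')) ^ (s / d)) := by
          have hLi := hL i
          rw [Real.mul_rpow (by positivity) (by positivity), ← Real.rpow_natCast (L i),
            ← Real.rpow_mul hLi.le, Real.div_rpow hN0.le hT'0.le, Real.rpow_neg hT'0.le,
            mul_div_cancel₀ _ hd0.ne', Real.rpow_neg hLi.le]
          field_simp
      _ ≤ _ := by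
          have := hL i
          gcongr

/-- Only test points in one underpopulated cube are needed. The configuration points belonging to it
are replaced by points of the unit cube, and the others are bounded crudely through their distance
`δ`. -/
theorem UpperApprox.eventually_lt {d ℓ : ℕ} (hd : 1 ≤ d) (b : Bool) {s : ℝ}
    (hs : (d : ℝ) < s) {A : Set (E ℓ)} {V : ℝ} (hV : 0 < V) (h : UpperApprox d A V)
    {v : ℝ≥0∞} (hv : ENNReal.ofReal ((cubeConst b d s).toReal * V ^ (-(s / d))) < v) :
    ∀ᶠ N : ℕ in atTop, genPol b s A N / (N : ℝ≥0∞) ^ (s / d) < v := by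
  classical
  have hd0 : (0 : ℝ) < d := by exact_mod_cast hd
  have hs0 : 0 < s := hd0.trans hs
  have hsd : 0 < s / d := by positivity
  have hKt := cubeConst_lt_top hd b hs
  set K := (cubeConst b d s).toReal with hK
  have hK0 : 0 < K := ENNReal.toReal_pos (cubeConst_pos b hs0).ne' hKt.ne
  have hKe : cubeConst b d s = ENNReal.ofReal K := (ENNReal.ofReal_toReal hKt.ne).symm
  have hcont : Tendsto (fun η : ℝ => ENNReal.ofReal (K * (V - η) ^ (-(s / d))))
      (𝓝[>] 0) (𝓝 (ENNReal.ofReal (K * V ^ (-(s / d))))) := by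
    refine (ENNReal.tendsto_ofReal ?_).mono_left nhdsWithin_le_nhds
    have h2 : Tendsto (fun η : ℝ => V - η) (𝓝 0) (𝓝 (V - 0)) :=
      (continuous_const.sub continuous_id).tendsto 0
    have h3 := (h2.rpow_const (p := -(s / d)) (Or.inl (by simpa using hV.ne'))).const_mul K
    simpa using h3
  obtain ⟨η, hη, hη1⟩ := ((hcont.eventually (gt_mem_nhds hv)).and
    (Ioo_mem_nhdsGT hV)).exists
  have hη0 : 0 < η := hη1.1
  obtain ⟨ι, _, g, W, l, δ, hδ, hl, hg, hW, hfar, hnear, hsum⟩ := h η hη0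
  set T := ∑ i, l i ^ d with hT
  have hVη : 0 < V - η := by have := hη1.2; linarith
  have hT0 : 0 < T := hVη.trans_le hsum
  -- The far points contribute at most `N * δ ^ (-s)`, negligible against `N ^ (s / d)` because `s >
  -- d`.
  have hlim : Tendsto (fun N : ℕ => ENNReal.ofReal (K * (V - η) ^ (-(s / d))) +
      ENNReal.ofReal ((N : ℝ) ^ (-(s / d - 1)) * δ ^ (-s))) atTop
      (𝓝 (ENNReal.ofReal (K * (V - η) ^ (-(s / d))))) := by
    have h1 : Tendsto (fun N : ℕ => (N : ℝ) ^ (-(s / d - 1)) * δ ^ (-s)) atTop (𝓝 (0 * δ ^ (-s))) :=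
      ((tendsto_rpow_neg_atTop (by rw [sub_pos, lt_div_iff₀ hd0]; linarith)).comp
        tendsto_natCast_atTop_atTop).mul_const _
    have h2 := (ENNReal.tendsto_ofReal h1).const_add (ENNReal.ofReal (K * (V - η) ^ (-(s / d))))
    simpa using h2
  filter_upwards [hlim.eventually (gt_mem_nhds hη), eventually_ge_atTop 1] with N hN hN3
  have hN0 : (0 : ℝ) < N := by exact_mod_cast hN3
  refine lt_of_le_of_lt ?_ hN
  rw [ENNReal.div_le_iff (by simp [ENNReal.rpow_eq_zero_iff, hsd]; omega) (by simp [hsd.le])]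
  have hgoal : ENNReal.ofReal (K * (N / T) ^ (s / d)) + N * ENNReal.ofReal δ ^ (-s) ≤
      (ENNReal.ofReal (K * (V - η) ^ (-(s / d))) +
        ENNReal.ofReal ((N : ℝ) ^ (-(s / d - 1)) * δ ^ (-s))) * (N : ℝ≥0∞) ^ (s / d) := by
    rw [← ENNReal.ofReal_natCast, ENNReal.ofReal_rpow_of_pos hN0, ENNReal.ofReal_rpow_of_pos hδ,
      add_mul, ← ENNReal.ofReal_mul (by positivity), ← ENNReal.ofReal_mul (by positivity),
      ← ENNReal.ofReal_mul (by positivity)]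
    refine add_le_add (ENNReal.ofReal_le_ofReal ?_) (ENNReal.ofReal_le_ofReal (le_of_eq ?_))
    · rw [mul_assoc]
      gcongr
      rw [Real.rpow_neg hVη.le, ← Real.inv_rpow hVη.le, ← Real.mul_rpow (by positivity) hN0.le]
      gcongr
      rw [div_eq_inv_mul]
      gcongr
    · have : (N : ℝ) = (N : ℝ) ^ (-(s / d - 1)) * (N : ℝ) ^ (s / d) := by
        rw [← Real.rpow_add hN0]; simp
      nth_rewrite 1 [this]
      ring
  refine le_trans ?_ hgoal
  refine iSup_le fun ω => ?_
  let c : ι → ℕ := fun i => (Finset.univ.filter fun j => (ω j : E ℓ) ∈ W i).card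
  have hc : ∑ i, c i ≤ N := by
    have hdis : (↑(Finset.univ : Finset ι) : Set ι).PairwiseDisjoint
        fun i => Finset.univ.filter fun j => (ω j : E ℓ) ∈ W i := by
      intro i _ k _ hik
      rw [Function.onFun, Finset.disjoint_left]
      intro j hj hj'
      simp only [Finset.mem_filter, Finset.mem_univ, true_and] at hj hj'
      exact Set.disjoint_left.1 (hW hik) hj hj'
    rw [← Finset.card_biUnion hdis]
    exact (Finset.card_le_univ _).trans (by simp)
  -- Pigeonhole: the sets `W i` are disjoint, so the counts sum to at most `N`, which is the sum of
  -- the shares `l i ^ d * (N / T)`.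
  obtain ⟨i, hi⟩ : ∃ i, (c i : ℝ) ≤ l i ^ d * (N / T) := by
    have hne : (Finset.univ : Finset ι).Nonempty := by
      by_contra hcon
      rw [Finset.not_nonempty_iff_eq_empty] at hcon
      simp [hT, hcon] at hT0
    have : ∑ i, (c i : ℝ) ≤ ∑ i, l i ^ d * (N / T) := by
      rw [← Finset.sum_mul, ← hT, mul_div_cancel₀ _ hT0.ne']
      exact_mod_cast hc
    obtain ⟨i, _, hi⟩ := Finset.exists_le_of_sum_le hne this
    exact ⟨i, hi⟩
  -- The implication gives a function defined for every `j`; the value for points outside `W i` is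
  -- arbitrary.
  have hx : ∀ j, ∃ x : E d, (ω j : E ℓ) ∈ W i → x ∈ unitCube d ∧ ∀ u ∈ unitCube d,
      l i * dist u x ≤ dist (g i u) (ω j : E ℓ) := by
    intro j
    by_cases hj : (ω j : E ℓ) ∈ W i
    · obtain ⟨x, hx⟩ := hnear i _ (ω j).2 hj
      exact ⟨x, fun _ => hx⟩
    · exact ⟨0, fun h => (hj h).elim⟩
  choose x hx using hx
  set t := Finset.univ.filter fun j => (ω j : E ℓ) ∈ W i with ht
  have hl0 : ENNReal.ofReal (l i) ^ (-s) ≠ ⊤ := by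
    rw [ENNReal.ofReal_rpow_of_pos (hl i)]; exact ENNReal.ofReal_ne_top
  have hbound : (⨅ y : A, agg b Finset.univ fun j => edist (y : E ℓ) (ω j : E ℓ) ^ (-s)) ≤
      ENNReal.ofReal (l i) ^ (-s) * genPol b s (unitCube d) (c i) +
        N * ENNReal.ofReal δ ^ (-s) := by
    refine le_trans ?_ (add_le_add_left (mul_le_mul_right
      (iInf_agg_le_genPol (unitCube_nonempty d) t x fun j hj =>
        (hx j (Finset.mem_filter.1 hj).2).1) _) _)
    have : Nonempty (unitCube d) := (unitCube_nonempty d).to_subtype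
    rw [ENNReal.mul_iInf_of_ne (by simp [ENNReal.rpow_eq_zero_iff, hs0.le]) hl0,
      ENNReal.iInf_add]
    refine le_iInf fun u => ?_
    refine (iInf_le _ (⟨g i u, hg i u u.2⟩ : A)).trans ?_
    refine (agg_le_filter_add b _ (fun j => (ω j : E ℓ) ∈ W i) _).trans ?_
    refine add_le_add ?_ ?_
    · rw [← agg_const_mul]
      refine agg_mono b fun j hj => ?_
      rw [← mul_rpow_neg (by simpa using hl i) (by simp) hs0]
      refine rpow_neg_le_rpow_neg hs0.le ?_
      rw [edist_dist, edist_dist, ← ENNReal.ofReal_mul (hl i).le]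
      exact ENNReal.ofReal_le_ofReal ((hx j (Finset.mem_filter.1 hj).2).2 u u.2)
    · refine (agg_le_card_mul b (c := ENNReal.ofReal δ ^ (-s)) fun j hj => ?_).trans ?_
      · refine rpow_neg_le_rpow_neg hs0.le ?_
        rw [edist_dist]
        exact ENNReal.ofReal_le_ofReal (hfar i _ (ω j).2 (Finset.mem_filter.1 hj).2 u u.2)
      · gcongr
        exact (Finset.card_le_univ _).trans (Fintype.card_fin N).le
  refine hbound.trans (add_le_add_left ?_ _)
  clear_value c
  refine (mul_le_mul_right (genPol_cube_le hd b hs0 (c i)) _).trans ?_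
  have hli := hl i
  rw [hKe, ENNReal.ofReal_rpow_of_pos hli, ← ENNReal.ofReal_natCast,
    ENNReal.ofReal_rpow_of_nonneg (by positivity) hsd.le, ← ENNReal.ofReal_mul hK0.le,
    ← ENNReal.ofReal_mul (by positivity)]
  apply ENNReal.ofReal_le_ofReal
  calc l i ^ (-s) * (K * (c i : ℝ) ^ (s / d))
      ≤ l i ^ (-s) * (K * (l i ^ d * (N / T)) ^ (s / d)) := by gcongr
    _ = K * (N / T) ^ (s / d) := by
        rw [Real.mul_rpow (by positivity) (by positivity), ← Real.rpow_natCast (l i),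
          ← Real.rpow_mul hli.le, mul_div_cancel₀ _ hd0.ne', Real.rpow_neg hli.le]
        field_simp

theorem tendsto_genPol {d ℓ : ℕ} (hd : 1 ≤ d) (b : Bool) {s : ℝ}
    (hs : (d : ℝ) < s) {A : Set (E ℓ)} {V : ℝ} (hA : A.Nonempty) (hV : 0 < V) (h : LowerApprox d A V)
    (hupper : UpperApprox d A V) :
    Tendsto (fun N : ℕ => genPol b s A N / (N : ℝ≥0∞) ^ (s / d)) atTop
      (𝓝 (ENNReal.ofReal ((cubeConst b d s).toReal * V ^ (-(s / d))))) :=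
  tendsto_order.2 ⟨fun _ hv => LowerApprox.eventually_lt hd b hs hA hV h hv,
    fun _ hv => UpperApprox.eventually_lt hd b hs hV hupper hv⟩

/-! ### The grid of half-open cubes -/

/-- The affine map taking `[0,1]^d` to the grid cube of side `r` with index `k`. -/
def cellMap {d : ℕ} (r : ℝ) (k : Fin d → ℤ) (u : E d) : E d :=
  r • (WithLp.toLp 2 (fun i => (k i : ℝ)) + u)

/-- The half-open grid cube of side `r` with index `k`. -/
def cell {d : ℕ} (r : ℝ) (k : Fin d → ℤ) : Set (E d) :=
  {x | ∀ i, x i ∈ Set.Ico (r * k i) (r * (k i + 1))}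

section cells

variable {d : ℕ} {r : ℝ}

theorem cellMap_apply (k : Fin d → ℤ) (u : E d) (i : Fin d) :
    cellMap r k u i = r * (k i + u i) := by
  simp [cellMap, mul_add]

theorem dist_cellMap (hr : 0 < r) (k : Fin d → ℤ) (u v : E d) :
    dist (cellMap r k u) (cellMap r k v) = r * dist u v := by
  simp [cellMap, dist_smul₀, abs_of_pos hr]

theorem volume_cell (hr : 0 < r) (k : Fin d → ℤ) :
    volume (cell r k) = ENNReal.ofReal (r ^ d) := by
  unfold cell
  rw [volume_setOf_forall_mem fun i => Set.Ico (r * (k i : ℝ)) (r * (k i + 1))]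
  have : ∀ i : Fin d, r * ((k i : ℝ) + 1) - r * k i = r := fun i => by ring
  simp [Real.volume_Ico, this, ENNReal.ofReal_pow hr.le]

theorem measurableSet_cell (k : Fin d → ℤ) : MeasurableSet (cell r k) := by
  have : cell r k = ⋂ i, (fun x : E d => x i) ⁻¹' Set.Ico (r * (k i : ℝ)) (r * (k i + 1)) := by
    ext; simp [cell]
  rw [this]
  exact MeasurableSet.iInter fun i => measurableSet_Ico.preimage (by fun_prop)

theorem eq_floor_of_mem_cell (hr : 0 < r) {k : Fin d → ℤ} {x : E d} (hx : x ∈ cell r k) :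
    k = fun i => ⌊x i / r⌋ := by
  funext i
  symm
  rw [Int.floor_eq_iff, le_div_iff₀ hr, div_lt_iff₀ hr]
  have := hx i
  exact ⟨by linarith [this.1], by linarith [this.2]⟩

theorem exists_mem_cell (hr : 0 < r) (x : E d) : ∃ k, x ∈ cell r k := by
  refine ⟨fun i => ⌊x i / r⌋, fun i => ⟨?_, ?_⟩⟩
  · have := Int.floor_le (x i / r)
    rw [le_div_iff₀ hr] at this
    linarith
  · have := Int.lt_floor_add_one (x i / r)
    rw [div_lt_iff₀ hr] at this
    linarith

theorem pairwise_disjoint_cell (hr : 0 < r) :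
    Pairwise fun k k' : Fin d → ℤ => Disjoint (cell r k) (cell r k') := by
  intro k k' hkk'
  rw [Set.disjoint_left]
  intro x hx hx'
  exact hkk' ((eq_floor_of_mem_cell hr hx).trans (eq_floor_of_mem_cell hr hx').symm)

theorem cell_subset (hr : 0 < r) (k : Fin d → ℤ) : cell r k ⊆ cellMap r k '' unitCube d := by
  intro x hx
  refine ⟨WithLp.toLp 2 fun i => x i / r - k i, fun i => ?_, ?_⟩
  · have := hx i
    simp only [Set.mem_Icc]
    constructor
    · rw [sub_nonneg, le_div_iff₀ hr]; linarith [this.1]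
    · rw [sub_le_iff_le_add, div_le_iff₀ hr]; linarith [this.2]
  · ext i
    rw [cellMap_apply]
    simp only
    field_simp
    ring

theorem dist_le_sqrt_of_mem_unitCube {u v : E d} (hu : u ∈ unitCube d) (hv : v ∈ unitCube d) :
    dist u v ≤ Real.sqrt d := by
  rw [EuclideanSpace.dist_eq]
  apply Real.sqrt_le_sqrt
  calc ∑ i, dist (u i) (v i) ^ 2 ≤ ∑ i : Fin d, (1 : ℝ) := Finset.sum_le_sum fun i _ => by
        refine pow_le_one₀ dist_nonneg ?_
        rw [Real.dist_eq, abs_le]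
        have := hu i
        have := hv i
        simp only [Set.mem_Icc] at *
        constructor <;> linarith
    _ = d := by simp

theorem finite_cell_inter_nonempty (hr : 0 < r) {A : Set (E d)} (hA : Bornology.IsBounded A) :
    {k : Fin d → ℤ | (cell r k ∩ A).Nonempty}.Finite := by
  obtain ⟨R, hR⟩ := hA.subset_closedBall 0
  refine (Set.finite_Icc (fun _ : Fin d => ⌊-R / r⌋) (fun _ => ⌊R / r⌋)).subset ?_
  rintro k ⟨x, hxk, hxA⟩
  have hx : ‖x‖ ≤ R := by simpa using hR hxA
  rw [eq_floor_of_mem_cell hr hxk]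
  have hi : ∀ i, |x i| ≤ R := fun i => (PiLp.norm_apply_le x i).trans hx
  constructor <;> intro i <;> apply Int.floor_le_floor <;> gcongr
  · exact (abs_le.1 (hi i)).1
  · exact (abs_le.1 (hi i)).2

theorem convex_unitCube (d : ℕ) : Convex ℝ (unitCube d) := by
  have : unitCube d = ⋂ i, (EuclideanSpace.proj i : E d →L[ℝ] ℝ) ⁻¹' Set.Icc (0 : ℝ) 1 := by
    ext; simp [unitCube]
  rw [this]
  exact convex_iInter fun i => (convex_Icc (0 : ℝ) 1).linear_preimage
    (EuclideanSpace.proj i : E d →L[ℝ] ℝ).toLinearMap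

theorem isCompact_unitCube (d : ℕ) : IsCompact (unitCube d) := by
  have hc : IsClosed (unitCube d) := by
    have : unitCube d = ⋂ i, (fun x : E d => x i) ⁻¹' Set.Icc (0 : ℝ) 1 := by
      ext; simp [unitCube]
    rw [this]
    exact isClosed_iInter fun i => isClosed_Icc.preimage (by fun_prop)
  refine Metric.isCompact_of_isClosed_isBounded hc ?_
  refine (isBounded_closedBall (x := (0 : E d)) (r := Real.sqrt d)).subset fun x hx => ?_
  exact dist_le_sqrt_of_mem_unitCube hx fun i => by simp

theorem continuous_cellMap (k : Fin d → ℤ) : Continuous (cellMap r k) := by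
  unfold cellMap; fun_prop

/-- Indices of the grid cubes contained in `A`. -/
def innerCells (r : ℝ) (A : Set (E d)) : Set (Fin d → ℤ) := {k | cellMap r k '' unitCube d ⊆ A}

/-- Indices of the grid cubes that meet `A` without being contained in it. -/
def boundaryCells (r : ℝ) (A : Set (E d)) : Set (Fin d → ℤ) :=
  {k | (cell r k ∩ A).Nonempty ∧ ¬ cellMap r k '' unitCube d ⊆ A}

theorem cellMap_zero_mem_cell (hr : 0 < r) (k : Fin d → ℤ) : cellMap r k 0 ∈ cell r k := by
  intro i
  rw [cellMap_apply]
  simp only [PiLp.zero_apply, add_zero, Set.mem_Ico, le_refl, true_and]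
  nlinarith

theorem finite_innerCells (hr : 0 < r) {A : Set (E d)} (hA : Bornology.IsBounded A) :
    (innerCells r A).Finite :=
  (finite_cell_inter_nonempty hr hA).subset fun k hk =>
    ⟨_, cellMap_zero_mem_cell hr k, hk ⟨0, fun i => by simp, rfl⟩⟩

theorem finite_boundaryCells (hr : 0 < r) {A : Set (E d)} (hA : Bornology.IsBounded A) :
    (boundaryCells r A).Finite :=
  (finite_cell_inter_nonempty hr hA).subset fun _ hk => hk.1

theorem subset_iUnion_cells (hr : 0 < r) {A : Set (E d)} {x : E d} (hx : x ∈ A) :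
    (∃ k ∈ innerCells r A, x ∈ cell r k) ∨ ∃ k ∈ boundaryCells r A, x ∈ cell r k := by
  obtain ⟨k, hk⟩ := exists_mem_cell hr x
  by_cases h : cellMap r k '' unitCube d ⊆ A
  · exact Or.inl ⟨k, h, hk⟩
  · exact Or.inr ⟨k, ⟨⟨x, hk, hx⟩, h⟩, hk⟩

theorem nonempty_inter_frontier {X : Type*} [TopologicalSpace X] {S A : Set X}
    (hS : IsPreconnected S) (h : (S ∩ A).Nonempty) (h' : (S ∩ Aᶜ).Nonempty) :
    (S ∩ frontier A).Nonempty := by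
  by_contra hne
  have hsub : S ⊆ interior A ∪ interior Aᶜ := by
    rw [← compl_frontier_eq_union_interior]
    exact fun x hx hxf => hne ⟨x, hx, hxf⟩
  obtain ⟨x, hxS, hxA⟩ := h
  obtain ⟨y, hyS, hyA⟩ := h'
  obtain ⟨z, -, hz, hz'⟩ := hS _ _ isOpen_interior isOpen_interior hsub
    ⟨x, hxS, (hsub hxS).resolve_right fun h => interior_subset h hxA⟩
    ⟨y, hyS, (hsub hyS).resolve_left fun h => hyA (interior_subset h)⟩
  exact interior_subset hz' (interior_subset hz)

/-- The closed cube is connected and meets both `A` and its complement, hence meets the frontier;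
its diameter is at most `r * √d`. -/
theorem boundary_cell_subset (hr : 0 < r) {A : Set (E d)} {k : Fin d → ℤ}
    (hk : k ∈ boundaryCells r A) : cell r k ⊆ cthickening (r * Real.sqrt d) (frontier A) := by
  obtain ⟨⟨a, hak, haA⟩, hk2⟩ := hk
  obtain ⟨c, hc, hcA⟩ := Set.not_subset.1 hk2
  have hpre : IsPreconnected (cellMap r k '' unitCube d) :=
    (convex_unitCube d).isPreconnected.image _ (continuous_cellMap k).continuousOn
  obtain ⟨z, hz, hzA⟩ : (cellMap r k '' unitCube d ∩ frontier A).Nonempty :=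
    nonempty_inter_frontier hpre ⟨a, cell_subset hr k hak, haA⟩ ⟨c, hc, hcA⟩
  intro x hx
  obtain ⟨u, hu, rfl⟩ := cell_subset hr k hx
  obtain ⟨v, hv, rfl⟩ := hz
  refine mem_cthickening_of_dist_le _ _ _ _ hzA ?_
  rw [dist_cellMap hr]
  gcongr
  exact dist_le_sqrt_of_mem_unitCube hu hv

theorem volume_biUnion_cells (hr : 0 < r) {S : Set (Fin d → ℤ)} (hS : S.Finite) :
    volume (⋃ k ∈ S, cell r k) = hS.toFinset.card * ENNReal.ofReal (r ^ d) := by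
  have : (⋃ k ∈ S, cell r k) = ⋃ k ∈ hS.toFinset, cell r k := by simp
  rw [this, measure_biUnion_finset (fun i _ j _ h => pairwise_disjoint_cell hr h)
    fun k _ => measurableSet_cell k]
  simp [volume_cell hr]

theorem eventually_volume_boundary_le {A : Set (E d)} (hA : IsCompact A)
    (hfr : volume (frontier A) = 0) {ε : ℝ} (hε : 0 < ε) :
    ∀ᶠ r : ℝ in 𝓝[>] 0, volume (⋃ k ∈ boundaryCells r A, cell r k) ≤ ENNReal.ofReal ε := by
  have hcomp : IsCompact (frontier A) :=
    hA.of_isClosed_subset isClosed_frontier hA.isClosed.frontier_subset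
  have h1 : Tendsto (fun r : ℝ => volume (cthickening (r * Real.sqrt d) (frontier A))) (𝓝[>] 0)
      (𝓝 0) := by
    rw [← hfr]
    refine (tendsto_measure_cthickening_of_isCompact hcomp).comp ?_
    refine Tendsto.mono_left ?_ nhdsWithin_le_nhds
    have : Continuous fun r : ℝ => r * Real.sqrt d := by fun_prop
    simpa using this.tendsto 0
  filter_upwards [h1.eventually (gt_mem_nhds (ENNReal.ofReal_pos.2 hε)), self_mem_nhdsWithin]
    with r hr hr0
  exact (measure_mono (Set.iUnion₂_subset fun k hk => boundary_cell_subset hr0 hk)).trans hr.le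

/-- The nearest-point projection onto the unit cube. -/
def clamp (v : E d) : E d := WithLp.toLp 2 fun i => max 0 (min 1 (v i))

theorem clamp_mem (v : E d) : clamp v ∈ unitCube d := fun i => by
  simp [clamp]

/-- Clamping a coordinate to `[0, 1]` moves it no farther from any value in `[0, 1]`. -/
theorem dist_clamp_le {u : E d} (hu : u ∈ unitCube d) (v : E d) :
    dist u (clamp v) ≤ dist u v := by
  rw [EuclideanSpace.dist_eq, EuclideanSpace.dist_eq]
  apply Real.sqrt_le_sqrt
  refine Finset.sum_le_sum fun i _ => ?_
  rw [Real.dist_eq, Real.dist_eq, sq_abs, sq_abs, ← sq_abs, ← sq_abs (u i - v i)]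
  refine pow_le_pow_left₀ (abs_nonneg _) ?_ 2
  have h0 := (hu i).1
  have h1 := (hu i).2
  simp only [clamp]
  rcases le_total (v i) 0 with h | h
  · rw [min_eq_right (h.trans zero_le_one), max_eq_left h, abs_of_nonneg (by linarith),
      abs_of_nonneg (by linarith)]
    linarith
  · rcases le_total (v i) 1 with h' | h'
    · rw [min_eq_right h', max_eq_right h]
    · rw [min_eq_left h', max_eq_right zero_le_one, abs_of_nonpos (by linarith),
        abs_of_nonpos (by linarith)]
      linarith

end cells

/-! ### Conformal charts -/

/-- A map that distorts distances by a product of values of a continuous positive weight. -/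
structure IsConformalChart {d ℓ : ℕ} (φ : E d → E ℓ) (w : E d → ℝ) : Prop where
  continuous_weight : Continuous w
  weight_pos : ∀ x, 0 < w x
  dist_eq : ∀ x y, dist (φ x) (φ y) = w x * w y * dist x y

theorem isConformalChart_id (d : ℕ) : IsConformalChart (id : E d → E d) fun _ => 1 :=
  ⟨continuous_const, fun _ => one_pos, fun x y => by simp⟩

theorem euclideanHausdorffMeasure_image_le {m n : ℕ} {d : ℕ} {C : ℝ} (hC : 0 ≤ C)
    {f : E m → E n} {S : Set (E m)} (h : ∀ x ∈ S, ∀ y ∈ S, dist (f x) (f y) ≤ C * dist x y) :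
    Measure.euclideanHausdorffMeasure d (f '' S) ≤
      ENNReal.ofReal (C ^ d) * Measure.euclideanHausdorffMeasure d S := by
  have hL : LipschitzOnWith C.toNNReal f S := LipschitzOnWith.of_dist_le_mul fun x hx y hy => by
    rw [Real.coe_toNNReal _ hC]; exact h x hx y hy
  have h1 := hL.hausdorffMeasure_image_le (d := d) (Nat.cast_nonneg d)
  rw [ENNReal.rpow_natCast] at h1
  simp only [Measure.euclideanHausdorffMeasure_def, Measure.smul_apply, ENNReal.smul_def,
    smul_eq_mul]
  calc _ ≤ _ := mul_le_mul_right h1 _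
    _ = _ := by
      rw [ENNReal.ofReal_pow hC]
      change _ * ((ENNReal.ofReal C) ^ d * _) = _
      ring

namespace IsConformalChart

variable {d ℓ : ℕ} {φ : E d → E ℓ} {w : E d → ℝ}

theorem injective (h : IsConformalChart φ w) : Function.Injective φ := by
  intro x y hxy
  have := h.dist_eq x y
  rw [hxy, dist_self] at this
  have hw := mul_pos (h.weight_pos x) (h.weight_pos y)
  exact dist_eq_zero.1 ((mul_eq_zero.1 this.symm).resolve_left hw.ne')

theorem continuous (h : IsConformalChart φ w) : Continuous φ := by
  rw [continuous_iff_continuousAt]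
  intro x
  rw [ContinuousAt, tendsto_iff_dist_tendsto_zero]
  have hc : Continuous fun y => w y * w x * dist y x := by
    have := h.continuous_weight
    fun_prop
  have := hc.tendsto x
  simpa [h.dist_eq] using this

theorem measurableEmbedding (h : IsConformalChart φ w) : MeasurableEmbedding φ :=
  h.continuous.measurableEmbedding h.injective

/-- The pullback of the Hausdorff measure under a chart. -/
def pullback (φ : E d → E ℓ) : Measure (E d) :=
  Measure.comap φ (Measure.euclideanHausdorffMeasure d)

theorem pullback_apply (h : IsConformalChart φ w) (S : Set (E d)) :
    pullback φ S = Measure.euclideanHausdorffMeasure d (φ '' S) :=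
  h.measurableEmbedding.comap_apply _ _

theorem pullback_le (h : IsConformalChart φ w) {S : Set (E d)} {C : ℝ} (hC : 0 ≤ C)
    (hS : ∀ x ∈ S, ∀ y ∈ S, w x * w y ≤ C) :
    pullback φ S ≤ ENNReal.ofReal (C ^ d) * volume S := by
  rw [h.pullback_apply, ← EuclideanSpace.euclideanHausdorffMeasure_eq_volume]
  refine euclideanHausdorffMeasure_image_le hC fun x hx y hy => ?_
  rw [h.dist_eq]
  exact mul_le_mul_of_nonneg_right (hS x hx y hy) dist_nonneg

/-- The inverse chart is Lipschitz with constant `c⁻¹` on the image, so the upper estimate for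
Lipschitz images applies to it. -/
theorem le_pullback (h : IsConformalChart φ w) {S : Set (E d)} {c : ℝ} (hc : 0 < c)
    (hS : ∀ x ∈ S, ∀ y ∈ S, c ≤ w x * w y) :
    ENNReal.ofReal (c ^ d) * volume S ≤ pullback φ S := by
  rw [h.pullback_apply, ← EuclideanSpace.euclideanHausdorffMeasure_eq_volume]
  have hinv : ∀ x, Function.invFun φ (φ x) = x := Function.leftInverse_invFun h.injective
  have himg : Function.invFun φ '' (φ '' S) = S := by
    rw [← Set.image_comp]; simp [hinv]
  have h1 := euclideanHausdorffMeasure_image_le (d := d) (C := c⁻¹) (f := Function.invFun φ)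
    (S := φ '' S) (by positivity) (by
      rintro _ ⟨x, hx, rfl⟩ _ ⟨y, hy, rfl⟩
      rw [hinv, hinv, h.dist_eq, le_inv_mul_iff₀ hc]
      exact mul_le_mul_of_nonneg_right (hS x hx y hy) dist_nonneg)
  rw [himg] at h1
  calc _ ≤ _ := mul_le_mul_right h1 _
    _ = _ := by
      rw [← mul_assoc, ← ENNReal.ofReal_mul (by positivity), ← mul_pow, mul_inv_cancel₀ hc.ne']
      simp

theorem exists_weight_bounds (h : IsConformalChart φ w) {B : Set (E d)} (hB : IsCompact B) :
    ∃ m M : ℝ, 0 < m ∧ 0 < M ∧ ∀ x ∈ B, m ≤ w x ∧ w x ≤ M := by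
  rcases B.eq_empty_or_nonempty with rfl | hne
  · exact ⟨1, 1, one_pos, one_pos, by simp⟩
  obtain ⟨a, -, ha⟩ := hB.exists_isMinOn hne h.continuous_weight.continuousOn
  obtain ⟨c, -, hc⟩ := hB.exists_isMaxOn hne h.continuous_weight.continuousOn
  exact ⟨w a, w c, h.weight_pos a, h.weight_pos c, fun x hx => ⟨ha hx, hc hx⟩⟩

theorem pullback_lt_top (h : IsConformalChart φ w) {A : Set (E d)} (hA : IsCompact A) :
    pullback φ A < ⊤ := by
  obtain ⟨m, M, hm, hM, hb⟩ := h.exists_weight_bounds hA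
  refine (h.pullback_le (C := M * M) (by positivity) fun x hx y hy => ?_).trans_lt
    (ENNReal.mul_lt_top ENNReal.ofReal_lt_top hA.measure_lt_top)
  have := hb x hx
  have := hb y hy
  have := h.weight_pos y
  gcongr <;> simp_all

theorem pullback_pos (h : IsConformalChart φ w) {A : Set (E d)} (hA : IsCompact A)
    (hpos : 0 < volume A) : 0 < pullback φ A := by
  obtain ⟨m, M, hm, hM, hb⟩ := h.exists_weight_bounds hA
  refine lt_of_lt_of_le ?_ (h.le_pullback (c := m * m) (by positivity) fun x hx y hy => ?_)
  · exact ENNReal.mul_pos (by simp; positivity) hpos.ne'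
  · have := hb x hx
    have := hb y hy
    have := h.weight_pos x
    gcongr <;> simp_all

/-- Uniform continuity of `w` together with its positive minimum gives relative error `η / 3` per
factor, and the product of two factors stays within `1 ± η`. -/
theorem exists_distortion (h : IsConformalChart φ w) {A : Set (E d)} (hA : IsCompact A) {η : ℝ}
    (hη : 0 < η) (hη1 : η < 1) : ∃ ρ > 0, ∀ c ∈ A, ∀ x ∈ A, ∀ y ∈ A, dist x c < ρ → dist y c < ρ →
      (1 - η) * w c ^ 2 ≤ w x * w y ∧ w x * w y ≤ (1 + η) * w c ^ 2 := by
  obtain ⟨m, M, hm, hM, hb⟩ := h.exists_weight_bounds hA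
  have huc := hA.uniformContinuousOn_of_continuous h.continuous_weight.continuousOn
  obtain ⟨ρ, hρ, hρ'⟩ := Metric.uniformContinuousOn_iff.1 huc (η / 3 * m) (by positivity)
  refine ⟨ρ, hρ, fun c hc x hx y hy hxc hyc => ?_⟩
  have key : ∀ z ∈ A, dist z c < ρ →
      (1 - η / 3) * w c ≤ w z ∧ w z ≤ (1 + η / 3) * w c := by
    intro z hz hzc
    have h1 := hρ' z hz c hc hzc
    rw [Real.dist_eq, abs_lt] at h1
    have h2 : η / 3 * m ≤ η / 3 * w c := by gcongr; exact (hb c hc).1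
    constructor <;> linarith [h1.1, h1.2]
  have hwc := h.weight_pos c
  obtain ⟨x1, x2⟩ := key x hx hxc
  obtain ⟨y1, y2⟩ := key y hy hyc
  have hwx := h.weight_pos x
  have hwy := h.weight_pos y
  have hpos : 0 < 1 - η / 3 := by linarith
  constructor
  · calc (1 - η) * w c ^ 2 ≤ ((1 - η / 3) * w c) * ((1 - η / 3) * w c) := by
          nlinarith [sq_nonneg (η * w c), mul_pos hη (pow_pos hwc 2)]
      _ ≤ _ := by gcongr
  · calc w x * w y ≤ ((1 + η / 3) * w c) * ((1 + η / 3) * w c) := by gcongr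
      _ ≤ _ := by nlinarith [mul_pos (mul_pos hη (sub_pos.2 hη1)) (pow_pos hwc 2),
                    mul_pos hη (pow_pos hwc 2)]

/-- All constants of a chart at once: on a fine grid, the Hausdorff measure of the image of a cube
inside `A` is comparable with the volume of the cube scaled by the weight. -/
theorem exists_grid (h : IsConformalChart φ w) {A : Set (E d)} (hA : IsCompact A)
    (hfr : volume (frontier A) = 0) {η ε : ℝ} (hη : 0 < η) (hη1 : η < 1) (hε : 0 < ε) :
    ∃ r > 0, volume (⋃ k ∈ boundaryCells r A, cell r k) ≤ ENNReal.ofReal ε ∧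
      ∀ k ∈ innerCells r A, ∃ c : ℝ, 0 < c ∧
        (∀ x ∈ cellMap r k '' unitCube d, ∀ y ∈ cellMap r k '' unitCube d,
          (1 - η) * c ≤ w x * w y ∧ w x * w y ≤ (1 + η) * c) ∧
        ENNReal.ofReal (((1 - η) * c * r) ^ d) ≤ pullback φ (cell r k) ∧
        pullback φ (cell r k) ≤ ENNReal.ofReal (((1 + η) * c * r) ^ d) := by
  obtain ⟨ρ, hρ, hdist⟩ := h.exists_distortion hA hη hη1
  have hsmall : ∀ᶠ r : ℝ in 𝓝[>] 0, r * Real.sqrt d < ρ := by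
    have : Continuous fun r : ℝ => r * Real.sqrt d := by fun_prop
    have h0 : Tendsto (fun r : ℝ => r * Real.sqrt d) (𝓝[>] 0) (𝓝 0) := by
      simpa using (this.tendsto 0).mono_left nhdsWithin_le_nhds
    exact h0.eventually (gt_mem_nhds hρ)
  obtain ⟨r, hvol, hrρ, hr⟩ := ((eventually_volume_boundary_le hA hfr hε).and
    (hsmall.and (eventually_mem_nhdsWithin (s := Set.Ioi (0 : ℝ))))).exists
  replace hr : 0 < r := hr
  refine ⟨r, hr, hvol, fun k hk => ⟨w (cellMap r k 0) ^ 2, pow_pos (h.weight_pos _) 2, ?_⟩⟩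
  have hc := pow_pos (h.weight_pos (cellMap r k 0)) 2
  have h0 : (0 : E d) ∈ unitCube d := fun i => by simp
  have hnear : ∀ x ∈ cellMap r k '' unitCube d, dist x (cellMap r k 0) < ρ := by
    rintro _ ⟨u, hu, rfl⟩
    rw [dist_cellMap hr]
    refine lt_of_le_of_lt ?_ hrρ
    gcongr
    exact dist_le_sqrt_of_mem_unitCube hu h0
  have hb : ∀ x ∈ cellMap r k '' unitCube d, ∀ y ∈ cellMap r k '' unitCube d,
      (1 - η) * w (cellMap r k 0) ^ 2 ≤ w x * w y ∧ w x * w y ≤ (1 + η) * w (cellMap r k 0) ^ 2 :=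
    fun x hx y hy => hdist _ (hk ⟨0, h0, rfl⟩) x (hk hx) y (hk hy) (hnear x hx) (hnear y hy)
  have hη' : 0 < 1 - η := by linarith
  refine ⟨hb, ?_, ?_⟩
  · rw [mul_pow, ENNReal.ofReal_mul (by positivity), ← volume_cell hr k]
    exact h.le_pullback (by positivity) fun x hx y hy =>
      (hb x (cell_subset hr k hx) y (cell_subset hr k hy)).1
  · rw [mul_pow, ENNReal.ofReal_mul (by positivity), ← volume_cell hr k]
    exact h.pullback_le (by positivity) fun x hx y hy =>
      (hb x (cell_subset hr k hx) y (cell_subset hr k hy)).2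

theorem sum_pullback_cell {r : ℝ} (hr : 0 < r) (μ : Measure (E d)) (S : Finset (Fin d → ℤ)) :
    ∑ k ∈ S, μ (cell r k) = μ (⋃ k ∈ S, cell r k) :=
  (measure_biUnion_finset (fun _ _ _ _ h => pairwise_disjoint_cell hr h)
    fun k _ => measurableSet_cell k).symm

/-- Interior grid cubes are mapped by the chart. Configurations in boundary cubes may leave `A`, so
they are first sent to nearest points of `A`; this loses only a constant factor on cubes of small
total volume. -/
theorem lowerApprox (h : IsConformalChart φ w) {A : Set (E d)} (hA : IsCompact A)
    (hfr : volume (frontier A) = 0) : LowerApprox d (φ '' A) (pullback φ A).toReal := by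
  intro ε hε
  rcases A.eq_empty_or_nonempty with rfl | hne
  · exact ⟨Empty, inferInstance, fun i => i.elim, fun i => i.elim, fun i => i.elim,
      fun i => i.elim, by simp, by simp; exact hε.le⟩
  obtain ⟨m, M, hm, hM, hMb⟩ := h.exists_weight_bounds hA
  set v := (pullback φ A).toReal with hv
  have hvtop := (h.pullback_lt_top hA).ne
  obtain ⟨η, hηb, hη0, hη1⟩ : ∃ η : ℝ, ((1 + η) / (1 - η)) ^ d * v < v + ε / 2 ∧ 0 < η ∧ η < 1 := by
    have hc : Tendsto (fun η : ℝ => ((1 + η) / (1 - η)) ^ d * v) (𝓝[>] 0) (𝓝 v) := by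
      have h1 : ContinuousAt (fun η : ℝ => ((1 + η) / (1 - η)) ^ d * v) 0 := by
        refine ContinuousAt.mul (ContinuousAt.pow (ContinuousAt.div ?_ ?_ (by norm_num)) d) ?_ <;>
          fun_prop
      have := h1.tendsto.mono_left (nhdsWithin_le_nhds (s := Set.Ioi 0))
      simpa using this
    obtain ⟨η, h1, h2⟩ := ((hc.eventually (gt_mem_nhds (by linarith : v < v + ε / 2))).and
      (Ioo_mem_nhdsGT (zero_lt_one (α := ℝ)))).exists
    exact ⟨η, h1, h2.1, h2.2⟩
  have hη' : 0 < 1 - η := by linarith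
  -- Each boundary cube will be charged `(2 * M ^ 2 * r) ^ d`: a factor 2 for the nearest-point map
  -- and `M ^ 2` for the weights.
  set ε' := ε / 2 / (2 * M ^ 2) ^ d with hε'
  have hε'0 : 0 < ε' := by positivity
  obtain ⟨r, hr, hvol, hgrid⟩ := h.exists_grid hA hfr hη0 hη1 hε'0
  choose! c hc hcb hcl hcu using hgrid
  have hI := finite_innerCells hr hA.isBounded
  have hJ := finite_boundaryCells hr hA.isBounded
  choose p hpA hp using fun x => hA.exists_infDist_eq_dist hne x
  refine ⟨hI.toFinset ⊕ hJ.toFinset, inferInstance,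
    Sum.elim (fun k u => φ (cellMap r k u)) (fun k u => φ (p (cellMap r k u))),
    Sum.elim (fun k => (1 + η) * c k * r) (fun _ => 2 * M ^ 2 * r), ?_, ?_, ?_, ?_⟩
  · rintro (k | k)
    · have := hc k (hI.mem_toFinset.1 k.2)
      simp only [Sum.elim_inl]; positivity
    · simp only [Sum.elim_inr]; positivity
  · rintro (k | k) x hx
    · have hk : (k : Fin d → ℤ) ∈ innerCells r A := hI.mem_toFinset.1 k.2
      exact ⟨_, hk ⟨x, hx, rfl⟩, rfl⟩
    · exact ⟨_, hpA _, rfl⟩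
  · rintro _ ⟨y, hy, rfl⟩
    rcases subset_iUnion_cells hr hy with ⟨k, hk, hyk⟩ | ⟨k, hk, hyk⟩
    · obtain ⟨u, hu, rfl⟩ := cell_subset hr k hyk
      refine ⟨Sum.inl ⟨k, by simpa using hk⟩, u, hu, fun x hx => ?_⟩
      simp only [Sum.elim_inl]
      rw [h.dist_eq, dist_cellMap hr, mul_assoc _ r]
      exact mul_le_mul_of_nonneg_right (hcb k hk _ ⟨u, hu, rfl⟩ _ ⟨x, hx, rfl⟩).2 (by positivity)
    · obtain ⟨u, hu, rfl⟩ := cell_subset hr k hyk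
      refine ⟨Sum.inr ⟨k, by simpa using hk⟩, u, hu, fun x hx => ?_⟩
      simp only [Sum.elim_inr]
      rw [h.dist_eq]
      -- As `cellMap r k u` itself lies in `A`, the nearest point of `A` to `cellMap r k x` is no
      -- farther from it; then the triangle inequality gives the 2.
      have h1 : dist (cellMap r k u) (p (cellMap r k x)) ≤ 2 * (r * dist u x) := by
        have h2 : dist (cellMap r k x) (p (cellMap r k x)) ≤ dist (cellMap r k x) (cellMap r k u) :=
          (hp _).symm.le.trans (infDist_le_dist_of_mem hy)
        have h3 := dist_triangle (cellMap r k u) (cellMap r k x) (p (cellMap r k x))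
        rw [dist_comm (cellMap r k x) (cellMap r k u)] at h2
        rw [dist_cellMap hr] at h2 h3
        linarith
      have h4 := hMb _ hy
      have h5 := hMb _ (hpA (cellMap r k x))
      have h6 := h.weight_pos (p (cellMap r k x))
      calc _ ≤ M * M * (2 * (r * dist u x)) := by
            gcongr
            · exact h4.2
            · exact h5.2
        _ = _ := by ring
  · rw [Fintype.sum_sum_type]
    simp only [Sum.elim_inl, Sum.elim_inr]
    have hin : ∑ k : hI.toFinset, ((1 + η) * c k * r) ^ d ≤ ((1 + η) / (1 - η)) ^ d * v := by
      have e1 : ∑ k : hI.toFinset, ((1 + η) * c k * r) ^ d =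
          ((1 + η) / (1 - η)) ^ d * ∑ k ∈ hI.toFinset, ((1 - η) * c k * r) ^ d := by
        rw [Finset.sum_coe_sort hI.toFinset fun k => ((1 + η) * c k * r) ^ d, Finset.mul_sum]
        refine Finset.sum_congr rfl fun k _ => ?_
        rw [← mul_pow]
        congr 1
        field_simp
      rw [e1]
      gcongr
      rw [hv, ← ENNReal.ofReal_le_iff_le_toReal hvtop, ENNReal.ofReal_sum_of_nonneg]
      · calc ∑ k ∈ hI.toFinset, ENNReal.ofReal (((1 - η) * c k * r) ^ d)
            ≤ ∑ k ∈ hI.toFinset, pullback φ (cell r k) :=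
              Finset.sum_le_sum fun k hk => hcl k (by simpa using hk)
          _ = pullback φ (⋃ k ∈ hI.toFinset, cell r k) := sum_pullback_cell hr _ _
          _ ≤ pullback φ A := measure_mono (Set.iUnion₂_subset fun k hk =>
              (cell_subset hr k).trans (by simpa using hk : k ∈ innerCells r A))
      · intro k hk
        have := hc k (by simpa using hk)
        positivity
    have hbd : ∑ _k : hJ.toFinset, (2 * M ^ 2 * r) ^ d ≤ ε / 2 := by
      rw [volume_biUnion_cells hr hJ, ← ENNReal.ofReal_natCast,
        ← ENNReal.ofReal_mul (by positivity), ENNReal.ofReal_le_ofReal_iff hε'0.le] at hvol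
      rw [Finset.sum_const, Finset.card_univ, Fintype.card_coe, nsmul_eq_mul, mul_pow]
      calc (hJ.toFinset.card : ℝ) * ((2 * M ^ 2) ^ d * r ^ d)
          = (2 * M ^ 2) ^ d * (hJ.toFinset.card * r ^ d) := by ring
        _ ≤ (2 * M ^ 2) ^ d * ε' := by gcongr
        _ = ε / 2 := by rw [hε']; field_simp
    linarith

/-- Test points are confined to a slightly shrunken copy of each interior grid cube, which separates
them from points outside the cube. The larger compact set `B` gives weight bounds near `A`, while
`hfar` controls the points of `Z` not reached from `B`. -/
theorem upperApprox (h : IsConformalChart φ w) {A B : Set (E d)} (hA : IsCompact A)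
    (hfr : volume (frontier A) = 0) (hB : IsCompact B) (hAB : A ⊆ B) {Z : Set (E ℓ)}
    (hZ : φ '' A ⊆ Z) {δ₀ : ℝ} (hδ₀ : 0 < δ₀)
    (hfar : ∀ z ∈ Z, z ∉ φ '' B → ∀ y ∈ A, δ₀ ≤ dist (φ y) z) :
    UpperApprox d Z (pullback φ A).toReal := by
  intro ε hε
  obtain ⟨m, M, hm, hM, hMb⟩ := h.exists_weight_bounds hB
  set v := (pullback φ A).toReal with hv
  have hvtop := (h.pullback_lt_top hA).ne
  obtain ⟨η, hηb, hη0, hη1⟩ : ∃ η : ℝ, v - ε / 2 < ((1 - η) * (1 - η) / (1 + η)) ^ d * v ∧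
      0 < η ∧ η < 1 := by
    have hc : Tendsto (fun η : ℝ => ((1 - η) * (1 - η) / (1 + η)) ^ d * v) (𝓝[>] 0) (𝓝 v) := by
      have h1 : ContinuousAt (fun η : ℝ => ((1 - η) * (1 - η) / (1 + η)) ^ d * v) 0 := by
        refine ContinuousAt.mul (ContinuousAt.pow (ContinuousAt.div ?_ ?_ (by norm_num)) d) ?_ <;>
          fun_prop
      have := h1.tendsto.mono_left (nhdsWithin_le_nhds (s := Set.Ioi 0))
      simpa using this
    obtain ⟨η, h1, h2⟩ := ((hc.eventually (lt_mem_nhds (by linarith : v - ε / 2 < v))).and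
      (Ioo_mem_nhdsGT (zero_lt_one (α := ℝ)))).exists
    exact ⟨η, h1, h2.1, h2.2⟩
  have hη' : 0 < 1 - η := by linarith
  -- In the numerator, one factor comes from shrinking the cube and one from the lower distortion
  -- bound; the denominator comes from the upper bound on the measure of a cell.
  set q := ((1 - η) * (1 - η) / (1 + η)) with hq
  have hq0 : 0 < q := by positivity
  have hq1 : q ≤ 1 := by
    rw [hq, div_le_one (by positivity)]; nlinarith
  set ε' := ε / 2 / (M * M) ^ d with hε'
  have hε'0 : 0 < ε' := by positivity
  obtain ⟨r, hr, hvol, hgrid⟩ := h.exists_grid hA hfr hη0 hη1 hε'0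
  choose! c hc hcb hcl hcu using hgrid
  have hI := finite_innerCells hr hA.isBounded
  have hJ := finite_boundaryCells hr hA.isBounded
  -- Homothety onto the concentric cube `[η/2, 1 - η/2]^d`; the margin `η / 2` on every side yields
  -- the separation `r * (η / 2)`.
  let sh : E d → E d := fun u => WithLp.toLp 2 (fun _ => η / 2) + (1 - η) • u
  have hsh : ∀ u i, sh u i = η / 2 + (1 - η) * u i := fun u i => by simp [sh]
  have hshQ : ∀ u ∈ unitCube d, sh u ∈ unitCube d := by
    intro u hu i
    have := hu i
    rw [hsh]
    simp only [Set.mem_Icc] at *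
    constructor <;> nlinarith
  have hdsh : ∀ u u', dist (sh u) (sh u') = (1 - η) * dist u u' := by
    intro u u'
    simp [sh, dist_smul₀, abs_of_pos hη']
  have hin : ∀ k : hI.toFinset, (k : Fin d → ℤ) ∈ innerCells r A := fun k => hI.mem_toFinset.1 k.2
  refine ⟨hI.toFinset, inferInstance, fun k u => φ (cellMap r k (sh u)), fun k => φ '' cell r k,
    fun k => (1 - η) * (1 - η) * c k * r, min δ₀ (m * m * (r * (η / 2))), by positivity,
    fun k => ?_, fun k u hu => hZ ⟨_, hin k ⟨_, hshQ u hu, rfl⟩, rfl⟩, ?_, ?_, ?_, ?_⟩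
  · have := hc k (hin k)
    positivity
  · intro k k' hkk'
    refine (Set.disjoint_image_iff h.injective).2 (pairwise_disjoint_cell hr ?_)
    exact fun hcon => hkk' (Subtype.ext hcon)
  · intro k z hz hzW u hu
    have hyA : cellMap r k (sh u) ∈ A := hin k ⟨_, hshQ u hu, rfl⟩
    by_cases hzB : z ∈ φ '' B
    · obtain ⟨x, hxB, rfl⟩ := hzB
      have hx : x ∉ cell r (k : Fin d → ℤ) := fun hx => hzW ⟨x, hx, rfl⟩
      refine (min_le_right _ _).trans ?_
      rw [h.dist_eq]
      have hd1 : r * (η / 2) ≤ dist (cellMap r k (sh u)) x := by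
        simp only [cell, Set.mem_ofPred_eq, not_forall] at hx
        obtain ⟨i, hi⟩ := hx
        have h1 : |cellMap r k (sh u) i - x i| ≤ dist (cellMap r k (sh u)) x := by
          rw [dist_eq_norm]
          exact PiLp.norm_apply_le (cellMap r k (sh u) - x) i
        refine le_trans ?_ h1
        rw [cellMap_apply, hsh, le_abs]
        have hui := hu i
        simp only [Set.mem_Icc] at hui
        rw [Set.mem_Ico, not_and_or, not_le, not_lt] at hi
        rcases hi with hi | hi
        · left
          nlinarith [mul_nonneg hr.le (mul_nonneg hη'.le hui.1)]
        · right
          nlinarith [mul_nonneg hr.le (mul_nonneg hη'.le (sub_nonneg.2 hui.2))]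
      have h2 := hMb _ (hAB hyA)
      have h3 := hMb _ hxB
      have h4 := h.weight_pos (cellMap r k (sh u))
      have h5 := h.weight_pos x
      gcongr
      · exact h2.1
      · exact h3.1
    · exact (min_le_left _ _).trans (hfar z hz hzB _ hyA)
  · rintro k z hz ⟨x, hx, rfl⟩
    obtain ⟨x', hx', rfl⟩ := cell_subset hr _ hx
    -- A point in the margin pulls back under `sh` outside the unit cube. Clamping it brings it
    -- closer to every test point, the direction needed.
    refine ⟨clamp ((1 - η)⁻¹ • (x' - WithLp.toLp 2 (fun _ => η / 2))), clamp_mem _,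
      fun u hu => ?_⟩
    have hx'' : x' = sh ((1 - η)⁻¹ • (x' - WithLp.toLp 2 (fun _ => η / 2))) := by
      simp only [sh]
      rw [smul_inv_smul₀ hη'.ne']
      abel
    have h1 := dist_clamp_le hu ((1 - η)⁻¹ • (x' - WithLp.toLp 2 (fun _ => η / 2)))
    rw [h.dist_eq, dist_cellMap hr]
    have h2 : dist (sh u) x' =
        (1 - η) * dist u ((1 - η)⁻¹ • (x' - WithLp.toLp 2 (fun _ => η / 2))) := by
      conv_lhs => rw [hx'', hdsh]
    rw [h2]
    have h3 := (hcb k (hin k) _ ⟨sh u, hshQ u hu, rfl⟩ _ ⟨x', hx', rfl⟩).1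
    have h4 := hc k (hin k)
    calc _ ≤ (1 - η) * (1 - η) * c k * r *
          dist u ((1 - η)⁻¹ • (x' - WithLp.toLp 2 (fun _ => η / 2))) := by gcongr
      _ = (1 - η) * c k *
          (r * ((1 - η) * dist u ((1 - η)⁻¹ • (x' - WithLp.toLp 2 (fun _ => η / 2))))) := by ring
      _ ≤ _ := by gcongr
  · have e1 : ∑ k : hI.toFinset, ((1 - η) * (1 - η) * c k * r) ^ d =
        q ^ d * ∑ k ∈ hI.toFinset, ((1 + η) * c k * r) ^ d := by
      rw [Finset.sum_coe_sort hI.toFinset fun k => ((1 - η) * (1 - η) * c k * r) ^ d,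
        Finset.mul_sum]
      refine Finset.sum_congr rfl fun k _ => ?_
      rw [← mul_pow, hq]
      congr 1
      field_simp
    have e2 : v - ε / 2 ≤ ∑ k ∈ hI.toFinset, ((1 + η) * c k * r) ^ d := by
      have hnn : ∀ k ∈ hI.toFinset, 0 ≤ ((1 + η) * c k * r) ^ d := fun k hk => by
        have := hc k (by simpa using hk)
        positivity
      rw [sub_le_iff_le_add, hv]
      refine ENNReal.toReal_le_of_le_ofReal (add_nonneg (Finset.sum_nonneg hnn) (by positivity)) ?_
      rw [ENNReal.ofReal_add (Finset.sum_nonneg hnn) (by positivity),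
        ENNReal.ofReal_sum_of_nonneg hnn]
      have hsub : A ⊆ (⋃ k ∈ hI.toFinset, cell r k) ∪
          (A ∩ ⋃ k ∈ boundaryCells r A, cell r k) := by
        intro x hx
        rcases subset_iUnion_cells hr hx with ⟨k, hk, hxk⟩ | ⟨k, hk, hxk⟩
        · exact Or.inl (Set.mem_iUnion₂.2 ⟨k, by simpa using hk, hxk⟩)
        · exact Or.inr ⟨hx, Set.mem_iUnion₂.2 ⟨k, hk, hxk⟩⟩
      refine (measure_mono hsub).trans ((measure_union_le _ _).trans (add_le_add ?_ ?_))
      · rw [← sum_pullback_cell hr]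
        exact Finset.sum_le_sum fun k hk => hcu k (by simpa using hk)
      · refine (h.pullback_le (C := M * M) (by positivity) fun x hx y hy => ?_).trans ?_
        · have := hMb x (hAB hx.1)
          have := hMb y (hAB hy.1)
          have := h.weight_pos y
          gcongr <;> simp_all
        · calc _ ≤ ENNReal.ofReal ((M * M) ^ d) * ENNReal.ofReal ε' :=
                mul_le_mul_right ((measure_mono Set.inter_subset_right).trans hvol) _
            _ = ENNReal.ofReal (ε / 2) := by
                rw [← ENNReal.ofReal_mul (by positivity), hε']
                congr 1
                field_simp
    rw [e1]
    have hqd : q ^ d ≤ 1 := pow_le_one₀ hq0.le hq1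
    have hqd0 : 0 < q ^ d := pow_pos hq0 d
    have h3 : q ^ d * (v - ε / 2) ≤ q ^ d * ∑ k ∈ hI.toFinset, ((1 + η) * c k * r) ^ d := by
      gcongr
    nlinarith

end IsConformalChart

/-! ### The admissible sets -/

/-- The two approximation properties of a `d`-dimensional set, for its Hausdorff measure. -/
structure IsWellTiled (d : ℕ) {ℓ : ℕ} (A : Set (E ℓ)) : Prop where
  nonempty : A.Nonempty
  vol_pos : 0 < hausdorffVol d A
  lower : LowerApprox d A (hausdorffVol d A)
  upper : UpperApprox d A (hausdorffVol d A)

theorem IsConformalChart.isWellTiled_image {d ℓ : ℕ} {φ : E d → E ℓ} {w : E d → ℝ}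
    (h : IsConformalChart φ w) {A : Set (E d)} (hA : IsCompact A) (hfr : volume (frontier A) = 0)
    (hpos : 0 < volume A) : IsWellTiled d (φ '' A) := by
  have hv : hausdorffVol d (φ '' A) = (IsConformalChart.pullback φ A).toReal := by
    rw [h.pullback_apply]; rfl
  refine ⟨(nonempty_of_measure_ne_zero hpos.ne').image φ, ?_, ?_, ?_⟩
  · rw [hv]
    exact ENNReal.toReal_pos (h.pullback_pos hA hpos).ne' (h.pullback_lt_top hA).ne
  · rw [hv]
    exact h.lowerApprox hA hfr
  · rw [hv]
    exact h.upperApprox hA hfr hA subset_rfl subset_rfl one_pos fun z hz hz' => (hz' hz).elim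

/-- The identity is a chart, and the frontier of a convex set is Lebesgue null. -/
theorem isWellTiled_of_convex {d : ℕ} {A : Set (E d)} (hA : IsCompact A) (hc : Convex ℝ A)
    (hi : (interior A).Nonempty) : IsWellTiled d A := by
  have := (isConformalChart_id d).isWellTiled_image hA (hc.addHaar_frontier volume)
    (Measure.measure_pos_of_nonempty_interior _ hi)
  rwa [Set.image_id] at this

theorem IsStronglyConvexBody.isWellTiled {d : ℕ} {A : Set (E d)} (hA : IsStronglyConvexBody A) :
    IsWellTiled d A := by
  refine isWellTiled_of_convex hA.isCompact hA.convex ?_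
  rw [← closure_nonempty_iff, hA.closure_interior]
  exact hA.nonempty

theorem interior_unitCube_nonempty (d : ℕ) : (interior (unitCube d)).Nonempty := by
  refine ⟨WithLp.toLp 2 fun _ => 1 / 2, ?_⟩
  have hopen : IsOpen {x : E d | ∀ i, x i ∈ Set.Ioo (0 : ℝ) 1} := by
    simp only [Set.ofPred_forall]
    exact isOpen_iInter_of_finite fun i => isOpen_Ioo.preimage (by fun_prop)
  have hsub : {x : E d | ∀ i, x i ∈ Set.Ioo (0 : ℝ) 1} ⊆ unitCube d := fun x hx i =>
    Set.Ioo_subset_Icc_self (hx i)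
  refine interior_maximal hsub hopen fun i => ?_
  simp only [Set.mem_Ioo]
  norm_num

theorem isWellTiled_unitCube (d : ℕ) : IsWellTiled d (unitCube d) :=
  isWellTiled_of_convex (isCompact_unitCube d) (convex_unitCube d) (interior_unitCube_nonempty d)

/-! ### Stereographic charts of the sphere -/

/-- The spherical cap with center `e` and height `t`. -/
def sphereCap {d : ℕ} (e : E (d + 1)) (t : ℝ) : Set (E (d + 1)) :=
  {x | x ∈ Metric.sphere (0 : E (d + 1)) 1 ∧ t ≤ inner ℝ e x}

/-- Inverse stereographic projection from the pole `-e`, in coordinates given by an isometry. -/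
def stereoInv {d : ℕ} (e : E (d + 1)) (j : E d →ₗᵢ[ℝ] E (d + 1)) (x : E d) : E (d + 1) :=
  (‖x‖ ^ 2 + 4)⁻¹ • ((4 : ℝ) • j x + (4 - ‖x‖ ^ 2) • e)

section stereographic

variable {d : ℕ} {e : E (d + 1)} {j : E d →ₗᵢ[ℝ] E (d + 1)}

theorem exists_isometry_orthogonal (he : ‖e‖ = 1) : ∃ j : E d →ₗᵢ[ℝ] E (d + 1),
    (∀ x, inner ℝ e (j x) = 0) ∧ ∀ z, inner ℝ e z = 0 → ∃ x, j x = z := by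
  have : Fact (Module.finrank ℝ (E (d + 1)) = d + 1) := ⟨by simp⟩
  have he0 : e ≠ 0 := by rintro rfl; simp at he
  let B := (OrthonormalBasis.fromOrthogonalSpanSingleton (𝕜 := ℝ) d he0).repr
  refine ⟨(Submodule.span ℝ {e})ᗮ.subtypeₗᵢ.comp B.symm.toLinearIsometry, fun x => ?_,
    fun z hz => ?_⟩
  · exact Submodule.mem_orthogonal_singleton_iff_inner_right.1 (B.symm x).2
  · refine ⟨B ⟨z, Submodule.mem_orthogonal_singleton_iff_inner_right.2 hz⟩, ?_⟩
    simp

theorem inner_stereoInv (he : ‖e‖ = 1) (hj : ∀ x, inner ℝ e (j x) = 0)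
    (x y : E d) : inner ℝ (stereoInv e j x) (stereoInv e j y) =
    (16 * inner ℝ x y + (4 - ‖x‖ ^ 2) * (4 - ‖y‖ ^ 2)) / ((‖x‖ ^ 2 + 4) * (‖y‖ ^ 2 + 4)) := by
  have hj' : ∀ x, inner ℝ (j x) e = 0 := fun x => by rw [real_inner_comm]; exact hj x
  simp only [stereoInv, inner_add_left, inner_add_right, inner_smul_left, inner_smul_right, hj, hj',
    j.inner_map_map, real_inner_self_eq_norm_sq, he]
  simp
  field_simp
  ring

theorem inner_pole_stereoInv (he : ‖e‖ = 1) (hj : ∀ x, inner ℝ e (j x) = 0)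
    (x : E d) :
    inner ℝ e (stereoInv e j x) = (4 - ‖x‖ ^ 2) / (‖x‖ ^ 2 + 4) := by
  simp only [stereoInv, inner_add_right, inner_smul_right, hj, real_inner_self_eq_norm_sq, he]
  field_simp
  ring

theorem norm_stereoInv (he : ‖e‖ = 1) (hj : ∀ x, inner ℝ e (j x) = 0)
    (x : E d) : ‖stereoInv e j x‖ = 1 := by
  have h := inner_stereoInv he hj x x
  rw [real_inner_self_eq_norm_sq, real_inner_self_eq_norm_sq] at h
  have h1 : ‖stereoInv e j x‖ ^ 2 = 1 := by
    rw [h, div_eq_one_iff_eq (by positivity)]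
    ring
  exact (pow_eq_one_iff_of_nonneg (norm_nonneg _) two_ne_zero).1 h1

/-- Between unit vectors the squared distance is `2 - 2⟪p, q⟫`, and the explicit inner product makes
it factor exactly as required. -/
theorem isConformalChart_stereoInv (he : ‖e‖ = 1) (hj : ∀ x, inner ℝ e (j x) = 0)
    :
    IsConformalChart (stereoInv e j) fun x => 2 / Real.sqrt (‖x‖ ^ 2 + 4) := by
  refine ⟨?_, fun x => by positivity, fun x y => ?_⟩
  · refine continuous_const.div (by fun_prop) fun x => by positivity
  · have ha : 0 < ‖x‖ ^ 2 + 4 := by positivity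
    have hb : 0 < ‖y‖ ^ 2 + 4 := by positivity
    rw [← sq_eq_sq₀ dist_nonneg (by positivity), dist_eq_norm, dist_eq_norm, mul_pow, mul_pow,
      div_pow, div_pow, Real.sq_sqrt ha.le, Real.sq_sqrt hb.le, norm_sub_sq_real, norm_sub_sq_real,
      inner_stereoInv he hj, norm_stereoInv he hj, norm_stereoInv he hj]
    field_simp
    ring

theorem sphereCap_eq_image (he : ‖e‖ = 1) (hj : ∀ x, inner ℝ e (j x) = 0)
    (hj' : ∀ z, inner ℝ e z = 0 → ∃ x, j x = z) {t : ℝ} (ht : -1 < t)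
    (ht' : t < 1) :
    sphereCap e t = stereoInv e j '' closedBall 0 (Real.sqrt (4 * (1 - t) / (1 + t))) := by
  have h1t : 0 < 1 + t := by linarith
  have hiff : ∀ x : E d, t ≤ inner ℝ e (stereoInv e j x) ↔
      x ∈ closedBall (0 : E d) (Real.sqrt (4 * (1 - t) / (1 + t))) := by
    intro x
    rw [inner_pole_stereoInv he hj, mem_closedBall_zero_iff, Real.le_sqrt (norm_nonneg _)
      (div_nonneg (by linarith) h1t.le), le_div_iff₀ (by positivity), le_div_iff₀ h1t]
    constructor <;> intro h <;> linarith
  ext z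
  constructor
  · rintro ⟨hz, hzt⟩
    have hz1 : ‖z‖ = 1 := by simpa using hz
    set τ := inner ℝ e z with hτ
    have hτ1 : 0 < 1 + τ := by linarith
    obtain ⟨x, hx⟩ := hj' ((2 / (1 + τ)) • (z - τ • e)) (by
      rw [inner_smul_right, inner_sub_right, inner_smul_right, real_inner_self_eq_norm_sq, he, ← hτ]
      ring)
    have hnx : ‖x‖ ^ 2 = 4 * (1 - τ) / (1 + τ) := by
      rw [← j.norm_map, hx, norm_smul, mul_pow, norm_sub_sq_real, norm_smul, inner_smul_right,
        real_inner_comm, ← hτ, hz1, he, Real.norm_eq_abs, sq_abs, Real.norm_eq_abs, mul_pow, sq_abs]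
      field_simp
      ring
    have hxz : stereoInv e j x = z := by
      have e1 : 4 * (1 - τ) / (1 + τ) + 4 = 8 / (1 + τ) := by field_simp; ring
      have e2 : 4 - 4 * (1 - τ) / (1 + τ) = 8 * τ / (1 + τ) := by field_simp; ring
      rw [stereoInv, hx, hnx, e1, e2, smul_smul, smul_sub, smul_smul, inv_div]
      have e3 : 4 * (2 / (1 + τ)) * τ = 8 * τ / (1 + τ) := by ring
      rw [e3, sub_add_cancel, smul_smul]
      have e4 : (1 + τ) / 8 * (4 * (2 / (1 + τ))) = 1 := by field_simp; norm_num
      rw [e4, one_smul]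
    exact ⟨x, (hiff x).1 (by rw [hxz]; exact hzt), hxz⟩
  · rintro ⟨x, hx, rfl⟩
    exact ⟨by simpa using norm_stereoInv he hj x, (hiff x).2 hx⟩

end stereographic

section caps

variable {d : ℕ} {e : E (d + 1)}

theorem radius_pos {t : ℝ} (ht : -1 < t) (ht' : t < 1) :
    0 < Real.sqrt (4 * (1 - t) / (1 + t)) :=
  Real.sqrt_pos.2 (div_pos (by linarith) (by linarith))

theorem isWellTiled_sphereCap (he : ‖e‖ = 1) {t : ℝ} (ht : -1 < t) (ht' : t < 1) :
    IsWellTiled d (sphereCap e t) := by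
  obtain ⟨j, hj, hj'⟩ := exists_isometry_orthogonal he
  rw [sphereCap_eq_image he hj hj' ht ht']
  refine (isConformalChart_stereoInv he hj).isWellTiled_image (isCompact_closedBall _ _)
    ((convex_closedBall _ _).addHaar_frontier volume) ?_
  exact measure_closedBall_pos _ _ (radius_pos ht ht')

theorem measure_sphereCap_lt_top (he : ‖e‖ = 1) {t : ℝ} (ht : -1 < t) (ht' : t < 1) :
    Measure.euclideanHausdorffMeasure d (sphereCap e t) < ⊤ := by
  obtain ⟨j, hj, hj'⟩ := exists_isometry_orthogonal he
  have hc := isConformalChart_stereoInv he hj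
  rw [sphereCap_eq_image he hj hj' ht ht', ← hc.pullback_apply]
  exact hc.pullback_lt_top (isCompact_closedBall _ _)

theorem isClosed_sphereCap (e : E (d + 1)) (t : ℝ) : IsClosed (sphereCap e t) :=
  isClosed_sphere.inter
    (isClosed_le (continuous_const (y := t))
      (continuous_const.inner continuous_id : Continuous fun x => inner ℝ e x))

/-- Take `B` to parametrize the larger cap of height `(t - 1) / 2`, midway between `-1` and `t`.
Sphere points outside it differ in height from the cap by more than `t - (t - 1) / 2`, which bounds
their distance below. -/
theorem upperApprox_sphere_of_cap (he : ‖e‖ = 1) {t : ℝ} (ht : -1 < t) (ht' : t < 1) :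
    UpperApprox d (sphere (0 : E (d + 1)) 1) (hausdorffVol d (sphereCap e t)) := by
  obtain ⟨j, hj, hj'⟩ := exists_isometry_orthogonal he
  have hc := isConformalChart_stereoInv he hj
  have hu1 : -1 < (t - 1) / 2 := by linarith
  have hu2 : (t - 1) / 2 < 1 := by linarith
  have hut : (t - 1) / 2 < t := by linarith
  have hA := sphereCap_eq_image he hj hj' ht ht'
  have hB := sphereCap_eq_image he hj hj' hu1 hu2
  have hv : hausdorffVol d (sphereCap e t) = (IsConformalChart.pullback (stereoInv e j)
      (closedBall 0 (Real.sqrt (4 * (1 - t) / (1 + t))))).toReal := by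
    rw [hc.pullback_apply, ← hA]; rfl
  rw [hv]
  refine hc.upperApprox (isCompact_closedBall _ _) ((convex_closedBall _ _).addHaar_frontier volume)
    (isCompact_closedBall (0 : E d) (Real.sqrt (4 * (1 - (t - 1) / 2) / (1 + (t - 1) / 2)))) ?_ ?_
    (sub_pos.2 hut) ?_
  · have hsub : sphereCap e t ⊆ sphereCap e ((t - 1) / 2) := fun x hx => ⟨hx.1, hut.le.trans hx.2⟩
    rw [hA, hB] at hsub
    exact (Set.image_subset_image_iff hc.injective).1 hsub
  · rw [← hA]
    exact fun x hx => hx.1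
  · intro z hz hzB y hy
    rw [← hB] at hzB
    have h1 : inner ℝ e z < (t - 1) / 2 := by
      by_contra hcon
      exact hzB ⟨hz, not_lt.1 hcon⟩
    have h2 : stereoInv e j y ∈ sphereCap e t := by rw [hA]; exact ⟨y, hy, rfl⟩
    have h3 := h2.2
    have h4 : inner ℝ e (stereoInv e j y - z) ≤ ‖e‖ * ‖stereoInv e j y - z‖ :=
      real_inner_le_norm _ _
    rw [he, one_mul, inner_sub_right, ← dist_eq_norm] at h4
    linarith

theorem UpperApprox.of_forall_exists {d ℓ : ℕ} {A : Set (E ℓ)} {V : ℝ}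
    (h : ∀ ε > 0, ∃ V', V - ε ≤ V' ∧ UpperApprox d A V') : UpperApprox d A V := by
  intro ε hε
  obtain ⟨V', hV', h'⟩ := h (ε / 2) (by positivity)
  obtain ⟨ι, i1, g, W, l, δ, h1, h2, h3, h4, h5, h6, h7⟩ := h' (ε / 2) (by positivity)
  exact ⟨ι, i1, g, W, l, δ, h1, h2, h3, h4, h5, h6, by linarith⟩

theorem sphere_eq_union (e : E (d + 1)) :
    sphere (0 : E (d + 1)) 1 = sphereCap e 0 ∪ sphereCap (-e) 0 := by
  ext x
  simp only [sphereCap, Set.mem_union, Set.mem_ofPred_eq, inner_neg_left, ← and_or_left]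
  refine ⟨fun h => ⟨h, ?_⟩, fun h => h.1⟩
  rcases le_total 0 (inner ℝ e x) with h' | h'
  · exact Or.inl h'
  · exact Or.inr (by linarith)

/-- In the stereographic chart the equator is the sphere of radius 2, a null set. -/
theorem measure_equator (he : ‖e‖ = 1) :
    Measure.euclideanHausdorffMeasure d (sphereCap e 0 ∩ sphereCap (-e) 0) = 0 := by
  obtain ⟨j, hj, hj'⟩ := exists_isometry_orthogonal he
  have hc := isConformalChart_stereoInv he hj
  have hsub : sphereCap e 0 ∩ sphereCap (-e) 0 ⊆ stereoInv e j '' sphere 0 2 := by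
    rintro z ⟨h1, h2⟩
    have h3 := h1
    rw [sphereCap_eq_image he hj hj' (by norm_num) (by norm_num)] at h3
    obtain ⟨x, hx, rfl⟩ := h3
    refine ⟨x, ?_, rfl⟩
    have h4 := h1.2
    have h5 := h2.2
    rw [inner_neg_left] at h5
    have h6 : inner ℝ e (stereoInv e j x) = 0 := by linarith
    rw [inner_pole_stereoInv he hj, div_eq_zero_iff] at h6
    have h7 : ‖x‖ ^ 2 = 2 ^ 2 := by
      rcases h6 with h6 | h6
      · linarith
      · have : 0 ≤ ‖x‖ ^ 2 := by positivity
        linarith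
    rw [mem_sphere_zero_iff_norm]
    exact (sq_eq_sq₀ (norm_nonneg _) (by norm_num)).1 h7
  refine measure_mono_null hsub ?_
  rw [← hc.pullback_apply]
  obtain ⟨m, M, hm, hM, hb⟩ := hc.exists_weight_bounds (isCompact_sphere (0 : E d) 2)
  refine le_antisymm ((hc.pullback_le (C := M * M) (by positivity) fun x hx y hy => ?_).trans ?_)
    zero_le
  · exact mul_le_mul (hb x hx).2 (hb y hy).2 (hc.weight_pos y).le hM.le
  · rw [Measure.addHaar_sphere_of_ne_zero _ _ two_ne_zero, mul_zero]

/-- No single chart covers the sphere. The lower property comes from two hemispheres overlapping in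
a null set, the upper one from caps increasing to the sphere minus a pole, which has measure zero
since `d ≥ 1`. -/
theorem isWellTiled_sphere (hd : 1 ≤ d) : IsWellTiled d (sphere (0 : E (d + 1)) 1) := by
  let e : E (d + 1) := EuclideanSpace.single 0 1
  have he : ‖e‖ = 1 := by simp [e]
  have he' : ‖-e‖ = 1 := by rw [norm_neg, he]
  have hn1 : (-1 : ℝ) < 0 := by norm_num
  have hp1 : (0 : ℝ) < 1 := by norm_num
  have hadd : Measure.euclideanHausdorffMeasure d (sphere (0 : E (d + 1)) 1) =
      Measure.euclideanHausdorffMeasure d (sphereCap e 0) +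
        Measure.euclideanHausdorffMeasure d (sphereCap (-e) 0) := by
    rw [← measure_union_add_inter _ (isClosed_sphereCap (-e) 0).measurableSet, measure_equator he,
      add_zero, ← sphere_eq_union]
  have htop := (measure_sphereCap_lt_top he hn1 hp1).ne
  have htop' := (measure_sphereCap_lt_top he' hn1 hp1).ne
  have hvol : hausdorffVol d (sphere (0 : E (d + 1)) 1) =
      hausdorffVol d (sphereCap e 0) + hausdorffVol d (sphereCap (-e) 0) := by
    unfold hausdorffVol
    rw [hadd, ENNReal.toReal_add htop htop']
  have h1 := isWellTiled_sphereCap he hn1 hp1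
  have h2 := isWellTiled_sphereCap he' hn1 hp1
  refine ⟨⟨e, by simp [e]⟩, ?_, ?_, ?_⟩
  · rw [hvol]; exact add_pos h1.vol_pos h2.vol_pos
  · rw [hvol, sphere_eq_union e]
    exact h1.lower.union h2.lower
  · refine UpperApprox.of_forall_exists fun ε hε => ?_
    let t : ℕ → ℝ := fun n => -1 + 1 / ((n : ℝ) + 1 + 1)
    have ht1 : ∀ n, -1 < t n := fun n => by
      have : (0 : ℝ) < 1 / ((n : ℝ) + 1 + 1) := by positivity
      simp only [t]; linarith
    have ht2 : ∀ n, t n < 1 := fun n => by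
      have : 1 / ((n : ℝ) + 1 + 1) ≤ 1 := by
        rw [div_le_one (by positivity)]
        have : (0 : ℝ) ≤ n := Nat.cast_nonneg n
        linarith
      simp only [t]; linarith
    have htanti : Antitone t := fun n m hnm => by
      simp only [t]
      gcongr
    have hmono : Monotone fun n => sphereCap e (t n) := fun n m hnm x hx =>
      ⟨hx.1, (htanti hnm).trans hx.2⟩
    have hlim := tendsto_measure_iUnion_atTop
      (μ := Measure.euclideanHausdorffMeasure d) hmono
    have hle : Measure.euclideanHausdorffMeasure d (sphere (0 : E (d + 1)) 1) ≤
        Measure.euclideanHausdorffMeasure d (⋃ n, sphereCap e (t n)) := by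
      have hsub : sphere (0 : E (d + 1)) 1 ⊆ (⋃ n, sphereCap e (t n)) ∪ {-e} := by
        intro x hx
        by_cases hxe : x = -e
        · exact Or.inr hxe
        · left
          have hx1 : ‖x‖ = 1 := by simpa using hx
          have hlt : -1 < inner ℝ e x := by
            refine lt_of_le_of_ne ?_ fun hcon => hxe ?_
            · have := abs_real_inner_le_norm e x
              rw [he, hx1, mul_one, abs_le] at this
              exact this.1
            · have h3 : ‖x + e‖ ^ 2 = 0 := by
                rw [norm_add_sq_real, real_inner_comm, ← hcon, hx1, he]; norm_num
              have h4 : x + e = 0 := norm_eq_zero.1 (by simpa using h3)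
              exact eq_neg_of_add_eq_zero_left h4
          have htt : Tendsto t atTop (𝓝 (-1)) := by
            have := ((tendsto_one_div_add_atTop_nhds_zero_nat (𝕜 := ℝ)).comp
              (tendsto_add_atTop_nat 1)).const_add (-1)
            simpa [t, Function.comp_def] using this
          obtain ⟨n, hn⟩ := (htt.eventually (gt_mem_nhds hlt)).exists
          exact Set.mem_iUnion.2 ⟨n, hx, hn.le⟩
      have hzero : Measure.euclideanHausdorffMeasure d ({-e} : Set (E (d + 1))) = 0 := by
        have := Measure.nullSingletonClass_hausdorff (E (d + 1)) (d := d) (by exact_mod_cast hd)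
        rw [Measure.euclideanHausdorffMeasure_def, Measure.smul_apply, measure_singleton, smul_zero]
      refine (measure_mono hsub).trans ((measure_union_le _ _).trans ?_)
      rw [hzero, add_zero]
    have hfin : Measure.euclideanHausdorffMeasure d (sphere (0 : E (d + 1)) 1) ≠ ⊤ := by
      rw [hadd]; exact ENNReal.add_ne_top.2 ⟨htop, htop'⟩
    have hlt : ENNReal.ofReal (hausdorffVol d (sphere (0 : E (d + 1)) 1) - ε) <
        Measure.euclideanHausdorffMeasure d (⋃ n, sphereCap e (t n)) := by
      refine lt_of_lt_of_le ?_ hle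
      have hpos : 0 < hausdorffVol d (sphere (0 : E (d + 1)) 1) := by
        rw [hvol]; exact add_pos h1.vol_pos h2.vol_pos
      rw [← ENNReal.ofReal_toReal hfin]
      exact (ENNReal.ofReal_lt_ofReal_iff hpos).2 (sub_lt_self _ hε)
    obtain ⟨n, hn⟩ := (hlim.eventually (lt_mem_nhds hlt)).exists
    refine ⟨_, ?_, upperApprox_sphere_of_cap he (ht1 n) (ht2 n)⟩
    exact (ENNReal.ofReal_le_iff_le_toReal (measure_sphereCap_lt_top he (ht1 n) (ht2 n)).ne).1 hn.le

end caps

theorem IsAdmissibleOrCube.isWellTiled {d ℓ : ℕ} (hd : 1 ≤ d) {A : Set (E ℓ)}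
    (h : IsAdmissibleOrCube d ℓ A) : IsWellTiled d A := by
  cases h with
  | admissible ℓ A hA =>
    cases hA with
    | stronglyConvex A hA => exact hA.isWellTiled
    | sphere => exact isWellTiled_sphere hd
    | cap e he t ht ht' => exact isWellTiled_sphereCap he ht ht'
  | cube => exact isWellTiled_unitCube d

/-! ### The covering constant -/

theorem hausdorffVol_unitCube (d : ℕ) : hausdorffVol d (unitCube d) = 1 := by
  unfold hausdorffVol
  rw [EuclideanSpace.euclideanHausdorffMeasure_eq_volume, volume_unitCube, ENNReal.toReal_one]

theorem cubeConst_toReal_pos {d : ℕ} (hd : 1 ≤ d) (b : Bool) {s : ℝ} (hs : (d : ℝ) < s) :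
    0 < (cubeConst b d s).toReal :=
  ENNReal.toReal_pos (cubeConst_pos b (lt_of_le_of_lt d.cast_nonneg hs)).ne'
    (cubeConst_lt_top hd b hs).ne

/-- The limit of `N^{1/d} ρ(N)` for the unit cube. -/
def coverConst (d : ℕ) : ℝ := (cubeConst false d (d + 1)).toReal ^ (-(1 / ((d : ℝ) + 1)))

theorem coverConst_pos {d : ℕ} (hd : 1 ≤ d) : 0 < coverConst d :=
  Real.rpow_pos_of_pos (cubeConst_toReal_pos hd false (by linarith)) _

theorem rpow_neg_genPol_false {n : ℕ} {d : ℕ} {s : ℝ} (hs : 0 < s) (A : Set (E n))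
    {N : ℕ} (hN : 1 ≤ N) :
    ((N : ℝ≥0∞) ^ (1 / (d : ℝ)) * bestCoveringRadius A N) ^ (-s) =
      genPol false s A N / (N : ℝ≥0∞) ^ (s / d) := by
  have h0 : (N : ℝ≥0∞) ^ (1 / (d : ℝ)) ≠ 0 := by
    simp [ENNReal.rpow_eq_zero_iff]; omega
  have ht : (N : ℝ≥0∞) ^ (1 / (d : ℝ)) ≠ ⊤ :=
    ENNReal.rpow_ne_top_of_nonneg (by positivity) (by simp)
  rw [mul_rpow_neg h0 ht hs, ← genPol_false hs, ENNReal.div_eq_inv_mul, ← ENNReal.rpow_mul,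
    ← ENNReal.rpow_neg]
  congr 2
  ring

/-- This is the max-version of the polarization limit, read off at one exponent above `d` (here `d +
1`) by taking the power `-1 / (d + 1)`. -/
theorem tendsto_bestCoveringRadius {d ℓ : ℕ} (hd : 1 ≤ d) {A : Set (E ℓ)} (hA : IsWellTiled d A) :
    Tendsto (fun N : ℕ => (N : ℝ≥0∞) ^ (1 / (d : ℝ)) * bestCoveringRadius A N) atTop
      (𝓝 (ENNReal.ofReal (coverConst d * hausdorffVol d A ^ (1 / (d : ℝ))))) := by
  have hd0 : (0 : ℝ) < d := by exact_mod_cast hd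
  have hs : (d : ℝ) < d + 1 := by linarith
  have hs0 : (0 : ℝ) < d + 1 := by linarith
  have hK := cubeConst_toReal_pos hd false hs
  have h1 := tendsto_genPol hd false hs hA.nonempty hA.vol_pos hA.lower hA.upper
  have h2 := (ENNReal.continuous_rpow_const (y := -(1 / ((d : ℝ) + 1)))).tendsto _ |>.comp h1
  have hV := hA.vol_pos
  rw [ENNReal.ofReal_rpow_of_pos (by positivity), Real.mul_rpow hK.le (by positivity),
    ← Real.rpow_mul hV.le] at h2
  have he : -(((d : ℝ) + 1) / d) * -(1 / ((d : ℝ) + 1)) = 1 / d := by field_simp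
  rw [he] at h2
  refine h2.congr' ?_
  filter_upwards [eventually_ge_atTop 1] with N hN
  simp only [Function.comp]
  rw [← rpow_neg_genPol_false hs0 A hN, ← ENNReal.rpow_mul]
  have : -((d : ℝ) + 1) * -(1 / ((d : ℝ) + 1)) = 1 := by field_simp
  rw [this, ENNReal.rpow_one]

/-- For the maximum, `s` enters only as the outer power `-s` of the normalized covering radius, so
one constant serves all exponents. -/
theorem cubeConst_false {d : ℕ} (hd : 1 ≤ d) {s : ℝ} (hs : 0 < s) :
    cubeConst false d s = ENNReal.ofReal (coverConst d ^ (-s)) := by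
  have h1 := tendsto_bestCoveringRadius hd (isWellTiled_unitCube d)
  rw [hausdorffVol_unitCube, Real.one_rpow, mul_one] at h1
  have h2 := (ENNReal.continuous_rpow_const (y := -s)).tendsto _ |>.comp h1
  rw [ENNReal.ofReal_rpow_of_pos (coverConst_pos hd)] at h2
  refine tendsto_nhds_unique (tendsto_genPol_cube hd false hs) (h2.congr' ?_)
  filter_upwards [eventually_ge_atTop 1] with N hN
  exact rpow_neg_genPol_false hs _ hN

/-- Every covering of the cube by balls obeys the asymptotic bound. -/
theorem coverConst_le {d : ℕ} (hd : 1 ≤ d) {ι : Type*} [Fintype ι] (ω : ι → E d)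
    (hω : ∀ j, ω j ∈ unitCube d) {R : ℝ} (hR : 0 < R)
    (hcov : ∀ y ∈ unitCube d, ∃ j, dist y (ω j) ≤ R) :
    coverConst d ≤ (Fintype.card ι : ℝ) ^ (1 / (d : ℝ)) * R := by
  have hd0 : (0 : ℝ) < d := by exact_mod_cast hd
  have hs : (0 : ℝ) < d := hd0
  have hc := coverConst_pos hd
  have hcard : (0 : ℝ) < Fintype.card ι := by
    obtain ⟨j, -⟩ := hcov _ (unitCube_nonempty d).some_mem
    exact_mod_cast Fintype.card_pos_iff.2 ⟨j⟩
  -- The exponent `d` is convenient: the normalization `N ^ (s / d)` becomes `N` itself.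
  have h1 : ENNReal.ofReal R ^ (-(d : ℝ)) ≤ genPol false d (unitCube d) (Fintype.card ι) := by
    refine le_genPol (unitCube_nonempty d) le_rfl ω hω fun y hy => ?_
    obtain ⟨j, hj⟩ := hcov y hy
    refine le_trans ?_ (le_agg false _ (Finset.mem_univ j))
    refine rpow_neg_le_rpow_neg hs.le ?_
    rw [edist_dist]
    exact ENNReal.ofReal_le_ofReal hj
  have h2 := h1.trans (genPol_cube_le hd false hs _)
  rw [cubeConst_false hd hs, div_self hd0.ne', ENNReal.rpow_one, ENNReal.ofReal_rpow_of_pos hR,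
    ← ENNReal.ofReal_natCast, ← ENNReal.ofReal_mul (by positivity),
    ENNReal.ofReal_le_ofReal_iff (by positivity), Real.rpow_neg hR.le, Real.rpow_neg hc.le,
    Real.rpow_natCast, Real.rpow_natCast] at h2
  have h3 : coverConst d ^ d ≤ Fintype.card ι * R ^ d := by
    have := mul_le_mul_of_nonneg_left h2 (by positivity : 0 ≤ coverConst d ^ d * R ^ d)
    have e1 : coverConst d ^ d * R ^ d * (R ^ d)⁻¹ = coverConst d ^ d := by field_simp
    have e2 : coverConst d ^ d * R ^ d * ((coverConst d ^ d)⁻¹ * (Fintype.card ι : ℝ)) =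
      Fintype.card ι * R ^ d := by field_simp
    rwa [e1, e2] at this
  refine le_of_pow_le_pow_left₀ (by omega : d ≠ 0) (by positivity) (h3.trans (le_of_eq ?_))
  rw [mul_pow, ← Real.rpow_natCast (_ ^ (1 / (d : ℝ))), ← Real.rpow_mul hcard.le,
    one_div_mul_cancel hd0.ne', Real.rpow_one]

/-! ### Large exponents -/

theorem exists_finset_cells {d : ℕ} {M : ℕ} (hM : 0 < M) (p : E d → Prop) :
    ∃ S : Finset (Fin d → ℤ),
      (∀ k ∈ S, cellMap (M : ℝ)⁻¹ k '' unitCube d ⊆ unitCube d ∧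
        ∃ u ∈ unitCube d, p (cellMap (M : ℝ)⁻¹ k u)) ∧
      ∀ y ∈ unitCube d, p y → ∃ k ∈ S, ∃ u ∈ unitCube d, y = cellMap (M : ℝ)⁻¹ k u := by
  classical
  have hcast : ∀ (k : Fin d → Fin M) (u : E d),
      cellMap (M : ℝ)⁻¹ (fun i => ((k i : ℕ) : ℤ)) u =
        (M : ℝ)⁻¹ • (WithLp.toLp 2 (fun i => ((k i : ℕ) : ℝ)) + u) := by
    intro k u; simp [cellMap]
  refine ⟨(Finset.univ.image fun (k : Fin d → Fin M) i => ((k i : ℕ) : ℤ)).filter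
    fun k => ∃ u ∈ unitCube d, p (cellMap (M : ℝ)⁻¹ k u), fun k hk => ?_, fun y hy hpy => ?_⟩
  · obtain ⟨hk1, hk2⟩ := Finset.mem_filter.1 hk
    obtain ⟨k, -, rfl⟩ := Finset.mem_image.1 hk1
    refine ⟨?_, hk2⟩
    rintro _ ⟨u, hu, rfl⟩
    rw [hcast]
    exact subcube_mem hM k hu
  · obtain ⟨k, u, hu, rfl⟩ := exists_subcube hM hy
    rw [← hcast] at hpy
    exact ⟨_, Finset.mem_filter.2 ⟨Finset.mem_image.2 ⟨k, Finset.mem_univ _, rfl⟩, u, hu, hpy⟩,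
      u, hu, (hcast k u).symm⟩

/-- A good polarizing configuration is almost a covering. At distance at least `τ` from all its
points, trading the exponent `s` for `d + 1` exposes a factor `(1 + η) ^ s`, so such points fill
little volume and few small cubes catch those still farther away. Fixing the exponent `d + 1` keeps
`K` independent of `s`. -/
theorem exists_coverConst_mul_le {d : ℕ} (hd : 1 ≤ d) {η : ℝ} (hη : 0 < η) :
    ∃ K : ℝ, 0 < K ∧ ∀ s : ℝ, (d : ℝ) + 1 < s →
      coverConst d * (cubeConst true d s).toReal ^ (1 / s) ≤
        (1 + K * (1 + η) ^ (-s)) ^ (1 / (d : ℝ)) * (1 + η) ^ 2 := by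
  have hd0 : (0 : ℝ) < d := by exact_mod_cast hd
  obtain ⟨C, hC, hvolume⟩ := exists_mul_volume_le (d := d) (s := d + 1) (by linarith)
  refine ⟨C * (Real.sqrt d / η + 1) ^ d, by positivity, fun s hs => ?_⟩
  have hs0 : 0 < s := by linarith
  have hds : (d : ℝ) < s := by linarith
  set K := C * (Real.sqrt d / η + 1) ^ d with hK
  have hσ := cubeConst_toReal_pos hd true hds
  set σ := (cubeConst true d s).toReal with hσdef
  have hσe : cubeConst true d s = ENNReal.ofReal σ :=
    (ENNReal.ofReal_toReal (cubeConst_lt_top hd true hds).ne).symm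
  have hc := coverConst_pos hd
  have main : ∀ σ' : ℝ, 0 < σ' → σ' < σ → coverConst d * σ' ^ (1 / s) ≤
      (1 + K * (1 + η) ^ (-s)) ^ (1 / (d : ℝ)) * (1 + η) ^ 2 := by
    intro σ' hσ' hlt
    have hev := (tendsto_genPol_cube hd true hs0).eventually
      (lt_mem_nhds (b := cubeConst true d s) (a := ENNReal.ofReal σ')
        (by rw [hσe]; exact (ENNReal.ofReal_lt_ofReal_iff hσ).2 hlt))
    have hτlim : Tendsto (fun N : ℕ => (1 + η) * σ' ^ (-(1 / s)) * (N : ℝ) ^ (-(1 / (d : ℝ)))) atTop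
        (𝓝 0) := by
      have := ((tendsto_rpow_neg_atTop (by positivity : 0 < 1 / (d : ℝ))).comp
        (tendsto_natCast_atTop_atTop (R := ℝ))).const_mul ((1 + η) * σ' ^ (-(1 / s)))
      simpa using this
    obtain ⟨N, hN, hτ1, hN1⟩ := (hev.and ((hτlim.eventually (gt_mem_nhds one_pos)).and
      (eventually_ge_atTop 1))).exists
    have hN0 : (0 : ℝ) < N := by exact_mod_cast hN1
    -- This is `1 + η` times the distance at which one point alone produces the potential `σ' * N ^
    -- (s / d)`.
    set τ := (1 + η) * σ' ^ (-(1 / s)) * (N : ℝ) ^ (-(1 / (d : ℝ))) with hτ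
    clear_value τ
    have hτ0 : 0 < τ := by rw [hτ]; positivity
    have hτs : τ ^ s * (σ' * (N : ℝ) ^ (s / d)) = (1 + η) ^ s := by
      rw [hτ, Real.mul_rpow (by positivity) (by positivity), Real.mul_rpow (by positivity)
        (by positivity), ← Real.rpow_mul hσ'.le, ← Real.rpow_mul hN0.le]
      have e1 : -(1 / s) * s = -1 := by field_simp
      have e2 : -(1 / (d : ℝ)) * s = -(s / d) := by ring
      rw [e1, e2, Real.rpow_neg_one, Real.rpow_neg hN0.le]
      field_simp
    have hsd : 0 < s / d := by positivity
    have hlt' : ENNReal.ofReal (σ' * (N : ℝ) ^ (s / d)) < genPol true s (unitCube d) N := by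
      rw [ENNReal.lt_div_iff_mul_lt (Or.inl (by simp [ENNReal.rpow_eq_zero_iff, hsd]; omega))
        (Or.inl (by simp [hsd.le])), ← ENNReal.ofReal_natCast, ENNReal.ofReal_rpow_of_pos hN0,
        ← ENNReal.ofReal_mul hσ'.le] at hN
      exact hN
    obtain ⟨ω, hω, hU⟩ := exists_config_of_lt_genPol hlt'
    set Y : Set (E d) := {y | y ∈ unitCube d ∧ ∀ j, τ ≤ dist y (ω j)} with hY
    have hYv : ∀ y ∈ Y, ENNReal.ofReal ((1 + η) ^ s * τ ^ (-((d : ℝ) + 1))) ≤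
        ∑ j, edist y (ω j) ^ (-((d : ℝ) + 1)) := by
      rintro y ⟨hyQ, hy⟩
      have h1 := hU y hyQ
      have h2 : (∑ j, edist y (ω j) ^ (-s)) ≤
          ENNReal.ofReal (τ ^ (-(s - (d + 1)))) * ∑ j, edist y (ω j) ^ (-((d : ℝ) + 1)) := by
        rw [Finset.mul_sum]
        refine Finset.sum_le_sum fun j _ => ?_
        have hj : 0 < dist y (ω j) := hτ0.trans_le (hy j)
        rw [edist_dist, ENNReal.ofReal_rpow_of_pos hj, ENNReal.ofReal_rpow_of_pos hj,
          ← ENNReal.ofReal_mul (by positivity)]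
        apply ENNReal.ofReal_le_ofReal
        have e1 : -s = -(s - (d + 1)) + -((d : ℝ) + 1) := by ring
        rw [e1, Real.rpow_add hj]
        refine mul_le_mul_of_nonneg_right ?_ (by positivity)
        exact Real.rpow_le_rpow_of_nonpos hτ0 (hy j) (by linarith)
      have h3 : ENNReal.ofReal (τ ^ (s - (d + 1))) * ENNReal.ofReal (σ' * (N : ℝ) ^ (s / d)) ≤
          ∑ j, edist y (ω j) ^ (-((d : ℝ) + 1)) := by
        calc _ ≤ ENNReal.ofReal (τ ^ (s - (d + 1))) * (ENNReal.ofReal (τ ^ (-(s - (d + 1)))) *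
              ∑ j, edist y (ω j) ^ (-((d : ℝ) + 1))) := mul_le_mul_right (h1.trans h2) _
          _ = _ := by
              rw [← mul_assoc, ← ENNReal.ofReal_mul (by positivity), ← Real.rpow_add hτ0]
              simp
      refine le_trans (le_of_eq ?_) h3
      rw [← ENNReal.ofReal_mul (by positivity), ← hτs, Real.rpow_sub hτ0, Real.rpow_neg hτ0.le]
      congr 1
      ring
    have hvol := hvolume N ω τ hτ0 Y _ (fun y hy => hy.2) hYv
    -- Cubes of side `1 / M` have diameter at most `η * τ`, so one containing a point at distance
    -- `(1 + η) * τ` from the configuration stays inside `Y`. Its volume bound then counts the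
    -- cubes; `τ < 1` makes `M * τ` bounded.
    set M := ⌈Real.sqrt d / (η * τ)⌉₊ with hM
    have hsqrt : 0 < Real.sqrt d := Real.sqrt_pos.2 hd0
    have hM0 : 0 < M := Nat.ceil_pos.2 (by positivity)
    have hM0' : (0 : ℝ) < M := by exact_mod_cast hM0
    have hMr : (0 : ℝ) < (M : ℝ)⁻¹ := by positivity
    have hdiam : (M : ℝ)⁻¹ * Real.sqrt d ≤ η * τ := by
      have := Nat.le_ceil (Real.sqrt d / (η * τ))
      rw [div_le_iff₀ (by positivity)] at this
      rw [inv_mul_le_iff₀ hM0']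
      exact this
    have hMτ : M * τ ≤ Real.sqrt d / η + 1 := by
      have h1 := (Nat.ceil_lt_add_one (by positivity : 0 ≤ Real.sqrt d / (η * τ))).le
      calc M * τ ≤ (Real.sqrt d / (η * τ) + 1) * τ := by gcongr
        _ = Real.sqrt d / η + τ := by field_simp
        _ ≤ _ := by linarith
    obtain ⟨S, hS1, hS2⟩ := exists_finset_cells hM0 fun y : E d => ∀ j, (1 + η) * τ ≤ dist y (ω j)
    have hcellY : (⋃ k ∈ S, cell (M : ℝ)⁻¹ k) ⊆ Y := by
      refine Set.iUnion₂_subset fun k hk x hx => ?_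
      obtain ⟨hsub, u, hu, hpu⟩ := hS1 k hk
      obtain ⟨v, hv, rfl⟩ := cell_subset hMr k hx
      refine ⟨hsub ⟨v, hv, rfl⟩, fun j => ?_⟩
      have h1 := hpu j
      have h2 := dist_triangle (cellMap (M : ℝ)⁻¹ k u) (cellMap (M : ℝ)⁻¹ k v) (ω j)
      rw [dist_cellMap hMr] at h2
      have h3 : (M : ℝ)⁻¹ * dist u v ≤ (M : ℝ)⁻¹ * Real.sqrt d := by
        gcongr
        exact dist_le_sqrt_of_mem_unitCube hu hv
      linarith
    obtain ⟨m, hm⟩ : ∃ m, S.card = m := ⟨_, rfl⟩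
    have hcard : (m : ℝ) ≤ N * (K * (1 + η) ^ (-s)) := by
      have h1 := volume_biUnion_cells hMr S.finite_toSet
      simp only [Finset.mem_coe, Finset.finite_toSet_toFinset, hm] at h1
      have h2 := (mul_le_mul_right (measure_mono hcellY)
        (ENNReal.ofReal ((1 + η) ^ s * τ ^ (-((d : ℝ) + 1))))).trans hvol
      rw [h1, ← ENNReal.ofReal_natCast, ← ENNReal.ofReal_mul (by positivity),
        ← ENNReal.ofReal_mul (by positivity), ENNReal.ofReal_le_ofReal_iff (by positivity)] at h2
      have e1 : (d : ℝ) - (d + 1) = d + -((d : ℝ) + 1) := by ring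
      rw [e1, Real.rpow_add hτ0, Real.rpow_natCast] at h2
      have hq : 0 < τ ^ (-((d : ℝ) + 1)) := by positivity
      have h3 : (1 + η) ^ s * (m * ((M : ℝ)⁻¹) ^ d) ≤ C * N * τ ^ d := by
        refine le_of_mul_le_mul_right (le_trans (le_of_eq ?_) (h2.trans (le_of_eq ?_))) hq <;> ring
      have h4 : (m : ℝ) ≤ N * (C * (M * τ) ^ d * (1 + η) ^ (-s)) := by
        have hp : (0 : ℝ) < (1 + η) ^ s := by positivity
        rw [Real.rpow_neg (by positivity)]
        have h5 := mul_le_mul_of_nonneg_left h3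
          (by positivity : 0 ≤ ((1 + η) ^ s)⁻¹ * (M : ℝ) ^ d)
        refine le_trans (le_of_eq ?_) (h5.trans (le_of_eq ?_))
        · rw [inv_pow]; field_simp
        · rw [mul_pow]; ring
      refine h4.trans ?_
      rw [hK]
      gcongr
    -- Adding one corner of each such cube to the configuration yields a covering of the cube with
    -- radius `(1 + η) * τ`.
    have hcover := coverConst_le hd (ι := Fin N ⊕ S)
      (Sum.elim ω fun k => cellMap (M : ℝ)⁻¹ (k : Fin d → ℤ) 0) (by
        rintro (j | k)
        · exact hω j
        · exact (hS1 k k.2).1 ⟨0, fun i => by simp, rfl⟩)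
      (R := (1 + η) * τ) (by positivity) (by
        intro y hy
        by_cases hp : ∀ j, (1 + η) * τ ≤ dist y (ω j)
        · obtain ⟨k, hk, u, hu, rfl⟩ := hS2 y hy hp
          refine ⟨Sum.inr ⟨k, hk⟩, ?_⟩
          simp only [Sum.elim_inr]
          rw [dist_cellMap hMr]
          have h3 : (M : ℝ)⁻¹ * dist u 0 ≤ (M : ℝ)⁻¹ * Real.sqrt d := by
            gcongr
            exact dist_le_sqrt_of_mem_unitCube hu fun i => by simp
          nlinarith
        · push Not at hp
          obtain ⟨j, hj⟩ := hp
          exact ⟨Sum.inl j, hj.le⟩)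
    rw [Fintype.card_sum, Fintype.card_fin, Fintype.card_coe, hm] at hcover
    have h5 : coverConst d ≤ (N * (1 + K * (1 + η) ^ (-s))) ^ (1 / (d : ℝ)) * ((1 + η) * τ) := by
      refine hcover.trans ?_
      push_cast
      gcongr
      linarith
    calc coverConst d * σ' ^ (1 / s)
        ≤ (N * (1 + K * (1 + η) ^ (-s))) ^ (1 / (d : ℝ)) * ((1 + η) * τ) * σ' ^ (1 / s) := by gcongr
      _ = _ := by
        rw [Real.mul_rpow hN0.le (by positivity), hτ, Real.rpow_neg hσ'.le, Real.rpow_neg hN0.le]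
        field_simp
  have hlim : Tendsto (fun σ' : ℝ => coverConst d * σ' ^ (1 / s)) (𝓝[<] σ)
      (𝓝 (coverConst d * σ ^ (1 / s))) := by
    refine Tendsto.mono_left ?_ nhdsWithin_le_nhds
    exact (tendsto_id.rpow_const (Or.inl hσ.ne')).const_mul _
  refine le_of_tendsto hlim ?_
  filter_upwards [Ioo_mem_nhdsLT hσ] with σ' hσ'
  exact main σ' hσ'.1 hσ'.2

theorem tendsto_cubeConst_rpow {d : ℕ} (hd : 1 ≤ d) :
    Tendsto (fun s : ℝ => (cubeConst true d s).toReal ^ (1 / s)) atTop (𝓝 (1 / coverConst d)) := by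
  have hc := coverConst_pos hd
  have hd0 : (0 : ℝ) < d := by exact_mod_cast hd
  refine tendsto_order.2 ⟨fun a ha => ?_, fun a ha => ?_⟩
  · filter_upwards [eventually_gt_atTop (d : ℝ)] with s hs
    have hs0 : 0 < s := hd0.trans hs
    refine ha.trans_le ?_
    have h1 : cubeConst false d s ≤ cubeConst true d s := by
      unfold cubeConst
      gcongr with N
      exact genPol_le_genPol_true false N
    rw [cubeConst_false hd hs0,
      ENNReal.ofReal_le_iff_le_toReal (cubeConst_lt_top hd true hs).ne] at h1
    calc 1 / coverConst d = (coverConst d ^ (-s)) ^ (1 / s) := by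
          rw [← Real.rpow_mul hc.le]
          have : -s * (1 / s) = -1 := by field_simp
          rw [this, Real.rpow_neg_one, one_div]
      _ ≤ _ := by gcongr
  · obtain ⟨η, hηa, hη0⟩ : ∃ η : ℝ, (1 + η) ^ 2 < a * coverConst d ∧ 0 < η := by
      have hlt : 1 < a * coverConst d := (div_lt_iff₀ hc).1 ha
      have hcont : Tendsto (fun η : ℝ => (1 + η) ^ 2) (𝓝[>] 0) (𝓝 1) := by
        have : Continuous fun η : ℝ => (1 + η) ^ 2 := by fun_prop
        simpa using (this.tendsto 0).mono_left nhdsWithin_le_nhds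
      obtain ⟨η, h1, h2⟩ := ((hcont.eventually (gt_mem_nhds hlt)).and
        (eventually_mem_nhdsWithin (s := Set.Ioi (0 : ℝ)))).exists
      exact ⟨η, h1, h2⟩
    obtain ⟨K, hK, h⟩ := exists_coverConst_mul_le hd hη0
    have hlim : Tendsto (fun s : ℝ => (1 + K * (1 + η) ^ (-s)) ^ (1 / (d : ℝ)) * (1 + η) ^ 2) atTop
        (𝓝 ((1 + η) ^ 2)) := by
      have h1 : Tendsto (fun s : ℝ => (1 + η) ^ (-s)) atTop (𝓝 0) := by
        have := tendsto_rpow_atTop_of_base_lt_one ((1 + η)⁻¹)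
          (by have : 0 < (1 + η)⁻¹ := by positivity
              linarith) (inv_lt_one_of_one_lt₀ (by linarith))
        refine this.congr fun s => ?_
        rw [Real.inv_rpow (by positivity), Real.rpow_neg (by positivity)]
      have h2 := (((h1.const_mul K).const_add 1).rpow_const (p := 1 / (d : ℝ))
        (Or.inl (by simp))).mul_const ((1 + η) ^ 2)
      simpa using h2
    filter_upwards [hlim.eventually (gt_mem_nhds hηa), eventually_gt_atTop ((d : ℝ) + 1)] with s h1 h2
    have h3 := (h s h2).trans_lt h1
    rw [mul_comm a] at h3
    exact lt_of_mul_lt_mul_left h3 hc.le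

/-! ### The covering density -/

theorem ballVolume_eq (d : ℕ) : ballVolume d = (volume (closedBall (0 : E d) 1)).toReal := by
  unfold ballVolume hausdorffVol
  rw [EuclideanSpace.euclideanHausdorffMeasure_eq_volume]

theorem ballVolume_pos (d : ℕ) : 0 < ballVolume d := by
  rw [ballVolume_eq]
  exact ENNReal.toReal_pos (measure_closedBall_pos _ _ one_pos).ne' measure_closedBall_lt_top.ne

theorem volume_closedBall_one {d : ℕ} (x : E d) :
    volume (closedBall x 1) = ENNReal.ofReal (ballVolume d) := by
  rw [ballVolume_eq, ENNReal.ofReal_toReal measure_closedBall_lt_top.ne]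
  simp only [← Measure.addHaar_closedBall_center volume x 1]

theorem abs_apply_sub_le_dist {d : ℕ} (x y : E d) (i : Fin d) : |x i - y i| ≤ dist x y := by
  rw [dist_eq_norm]
  exact PiLp.norm_apply_le (x - y) i

theorem mem_cube_add_of_dist_le {d : ℕ} {x y : E d} {R a : ℝ} (hy : y ∈ cube d R)
    (h : dist y x ≤ a) : x ∈ cube d (R + a) := by
  intro i
  have h1 := (abs_apply_sub_le_dist y x i).trans h
  rw [abs_le] at h1
  have h2 := hy i
  simp only [Set.mem_Icc] at *
  constructor <;> linarith [h1.1, h1.2, h2.1, h2.2]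

/-- Only centers in `[-(R + 1), R + 1]^d` can cover points of `[-R, R]^d`. Rescaled to the unit cube
and clamped into it, they cover with radius `1 / (2 * R)`. -/
theorem encard_lower_bound {d : ℕ} (hd : 1 ≤ d) {C : Set (E d)}
    (hC : (⋃ x ∈ C, closedBall x 1) = Set.univ) {R : ℝ} (hR : 0 < R) :
    ENNReal.ofReal ((coverConst d * (2 * R)) ^ d) ≤ ((C ∩ cube d (R + 1)).encard : ℝ≥0∞) := by
  have hd0 : (0 : ℝ) < d := by exact_mod_cast hd
  have hc := coverConst_pos hd
  by_cases hfin : (C ∩ cube d (R + 1)).Finite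
  swap
  · rw [Set.not_finite.1 hfin |>.encard_eq]
    simp
  have hF := hfin.fintype
  have key := coverConst_le hd (ι := ↥(C ∩ cube d (R + 1)))
    (fun x => clamp ((2 * R)⁻¹ • ((x : E d) + WithLp.toLp 2 fun _ => R))) (fun x => clamp_mem _)
    (R := (2 * R)⁻¹) (by positivity) (by
      intro y hy
      set z : E d := (2 * R) • y - WithLp.toLp 2 fun _ => R with hz
      have hzR : z ∈ cube d R := by
        intro i
        have := hy i
        simp only [hz, PiLp.sub_apply, PiLp.smul_apply, smul_eq_mul, Set.mem_Icc] at *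
        constructor <;> nlinarith
      have hzu : z ∈ ⋃ x ∈ C, closedBall x 1 := by rw [hC]; trivial
      obtain ⟨x, hxC, hzx⟩ := Set.mem_iUnion₂.1 hzu
      refine ⟨⟨x, hxC, mem_cube_add_of_dist_le hzR hzx⟩, (dist_clamp_le hy _).trans ?_⟩
      have hy' : y = (2 * R)⁻¹ • (z + WithLp.toLp 2 fun _ => R) := by
        rw [hz, sub_add_cancel, inv_smul_smul₀ (by positivity)]
      conv_lhs => rw [hy']
      rw [dist_smul₀, dist_add_right, Real.norm_of_nonneg (by positivity)]
      exact mul_le_of_le_one_right (by positivity) hzx)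
  rw [← Nat.card_eq_fintype_card, Nat.card_coe_set_eq] at key
  rw [← hfin.cast_ncard_eq, ENat.toENNReal_coe, ← ENNReal.ofReal_natCast]
  apply ENNReal.ofReal_le_ofReal
  have h1 : coverConst d * (2 * R) ≤ ((C ∩ cube d (R + 1)).ncard : ℝ) ^ (1 / (d : ℝ)) := by
    rwa [← div_eq_mul_inv, le_div_iff₀ (by positivity)] at key
  calc (coverConst d * (2 * R)) ^ d
      ≤ (((C ∩ cube d (R + 1)).ncard : ℝ) ^ (1 / (d : ℝ))) ^ d := by gcongr
    _ = _ := by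
        rw [← Real.rpow_natCast, ← Real.rpow_mul (Nat.cast_nonneg _), one_div_mul_cancel hd0.ne',
          Real.rpow_one]

/-- Balls centered in the cube of half-side `R + 1` lie wholly in that of half-side `R + 2`, and the
enlargement is negligible as `R → ∞`. -/
theorem density_lower_bound {d : ℕ} (hd : 1 ≤ d) {C : Set (E d)}
    (hC : (⋃ x ∈ C, closedBall x 1) = Set.univ) {δ : ℝ≥0∞} (hδ : HasBallDensity C δ) :
    ENNReal.ofReal (ballVolume d * coverConst d ^ d) ≤ δ := by
  have hc := coverConst_pos hd
  have hV := ballVolume_pos d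
  have hsum : ∀ R : ℝ, 0 < R → ENNReal.ofReal (ballVolume d * (coverConst d * (2 * R)) ^ d) ≤
      ∑' x : C, volume (closedBall (x : E d) 1 ∩ cube d (R + 2)) := by
    intro R hR
    have h1 : ∑' x : ↥(C ∩ cube d (R + 1)), volume (closedBall (x : E d) 1 ∩ cube d (R + 2)) ≤
        ∑' x : C, volume (closedBall (x : E d) 1 ∩ cube d (R + 2)) :=
      ENNReal.tsum_mono_subtype (fun x : E d => volume (closedBall x 1 ∩ cube d (R + 2)))
        Set.inter_subset_left
    have h2 : ∀ x : ↥(C ∩ cube d (R + 1)), volume (closedBall (x : E d) 1 ∩ cube d (R + 2)) =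
        ENNReal.ofReal (ballVolume d) := by
      intro x
      rw [Set.inter_eq_left.2, volume_closedBall_one]
      intro z hz
      have := mem_cube_add_of_dist_le (a := 1) (x := z) x.2.2 (by rw [dist_comm]; exact hz)
      rwa [add_assoc, one_add_one_eq_two] at this
    refine le_trans ?_ h1
    simp only [h2]
    rw [ENNReal.tsum_set_const, ENNReal.ofReal_mul hV.le, mul_comm]
    gcongr
    exact encard_lower_bound hd hC hR
  have hlim : Tendsto (fun R : ℝ => ENNReal.ofReal (ballVolume d * (coverConst d * (2 * R)) ^ d) /
      ENNReal.ofReal ((2 * (R + 2)) ^ d)) atTop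
      (𝓝 (ENNReal.ofReal (ballVolume d * coverConst d ^ d))) := by
    have h1 : Tendsto (fun R : ℝ => 1 - 2 / (R + 2)) atTop (𝓝 1) := by
      have : Tendsto (fun R : ℝ => 2 / (R + 2)) atTop (𝓝 0) :=
        (tendsto_atTop_add_const_right _ _ tendsto_id).const_div_atTop 2
      simpa using this.const_sub 1
    have h2 := ENNReal.tendsto_ofReal ((h1.pow d).const_mul (ballVolume d * coverConst d ^ d))
    rw [one_pow, mul_one] at h2
    refine h2.congr' ?_
    filter_upwards [eventually_gt_atTop 0] with R hR
    rw [← ENNReal.ofReal_div_of_pos (by positivity)]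
    congr 1
    have : 1 - 2 / (R + 2) = 2 * R / (2 * (R + 2)) := by field_simp; ring
    rw [this, mul_pow (coverConst d), div_pow]
    ring
  have hδ' := hδ.comp (tendsto_atTop_add_const_right atTop (2 : ℝ) tendsto_id)
  refine le_of_tendsto_of_tendsto hlim hδ' ?_
  filter_upwards [eventually_gt_atTop 0] with R hR
  simp only [Function.comp, id]
  gcongr
  exact hsum R hR

/-! ### Periodic coverings and their density. -/

theorem cellMap_injective_of_fract {d : ℕ} {L : ℝ} (hL : 0 < L) {F : Finset (E d)}
    (hF : ∀ f ∈ F, ∀ i, f i ∈ Set.Ico (0 : ℝ) 1) :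
    Function.Injective fun p : F × (Fin d → ℤ) => cellMap L p.2 (p.1 : E d) := by
  have hmem : ∀ p : F × (Fin d → ℤ), cellMap L p.2 (p.1 : E d) ∈ cell L p.2 := by
    intro p i
    have := hF p.1 p.1.2 i
    rw [cellMap_apply]
    simp only [Set.mem_Ico] at *
    constructor
    · nlinarith
    · have : (p.2 i : ℝ) + (p.1 : E d) i < p.2 i + 1 := by linarith
      exact mul_lt_mul_of_pos_left this hL
  intro p q hpq
  have h2 : p.2 = q.2 := by
    have hp := eq_floor_of_mem_cell hL (hmem p)
    have hq := eq_floor_of_mem_cell hL (hmem q)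
    simp only at hpq
    rw [← hpq] at hq
    exact hp.trans hq.symm
  have h1 : (p.1 : E d) = q.1 := by
    simp only [h2] at hpq
    have h3 := dist_cellMap hL q.2 (p.1 : E d) q.1
    rw [hpq, dist_self] at h3
    exact dist_eq_zero.1 ((mul_eq_zero.1 h3.symm).resolve_left hL.ne')
  exact Prod.ext (Subtype.ext h1) h2

/-- The integer points of the box `[-n, n]^d`. -/
def intBox (d n : ℕ) : Finset (Fin d → ℤ) := Fintype.piFinset fun _ => Finset.Icc (-(n : ℤ)) n

theorem card_intBox (d n : ℕ) : (intBox d n).card = (2 * n + 1) ^ d := by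
  rw [intBox, Fintype.card_piFinset]
  simp only [Int.card_Icc, Finset.prod_const, Finset.card_univ, Fintype.card_fin]
  congr 1
  omega

theorem mem_intBox {d n : ℕ} {k : Fin d → ℤ} : k ∈ intBox d n ↔ ∀ i, |(k i : ℝ)| ≤ n := by
  simp only [intBox, Fintype.mem_piFinset, Finset.mem_Icc, abs_le]
  refine forall_congr' fun i => and_congr ?_ ?_
  · rw [← Int.cast_le (R := ℝ)]; simp
  · rw [← Int.cast_le (R := ℝ)]; simp

/-- Squeeze between boxes of periods: all balls of a slightly smaller box lie in the cube, and no
ball outside a slightly larger box meets it. Both boxes have about `(2 * R / L) ^ d` periods. -/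
theorem hasBallDensity_periodic {d : ℕ} {L : ℝ} (hL : 0 < L) {F : Finset (E d)}
    (hF : ∀ f ∈ F, ∀ i, f i ∈ Set.Ico (0 : ℝ) 1) :
    HasBallDensity (Set.range fun p : F × (Fin d → ℤ) => cellMap L p.2 (p.1 : E d))
      (ENNReal.ofReal (F.card * ballVolume d * L⁻¹ ^ d)) := by
  have hV := ballVolume_pos d
  obtain ⟨m, hm⟩ : ∃ m, F.card = m := ⟨_, rfl⟩
  rw [hm]
  set g : F × (Fin d → ℤ) → E d := fun p => cellMap L p.2 (p.1 : E d) with hg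
  have hinj : Function.Injective g := cellMap_injective_of_fract hL hF
  have hgi : ∀ (p : F × (Fin d → ℤ)) i, |g p i - L * p.2 i| ≤ L := by
    intro p i
    have h1 := hF p.1 p.1.2 i
    simp only [Set.mem_Ico] at h1
    simp only [hg]
    rw [cellMap_apply, mul_add, add_sub_cancel_left, abs_of_nonneg (mul_nonneg hL.le h1.1)]
    exact mul_le_of_le_one_right hL.le h1.2.le
  have hcard : ∀ n : ℕ, ((Finset.univ : Finset F) ×ˢ intBox d n).card = m * (2 * n + 1) ^ d := by
    intro n
    rw [Finset.card_product, card_intBox, Finset.card_univ, Fintype.card_coe, hm]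
  have htsum : ∀ R : ℝ, ∑' x : Set.range g, volume (closedBall (x : E d) 1 ∩ cube d R) =
      ∑' p, volume (closedBall (g p) 1 ∩ cube d R) := fun R =>
    tsum_range (fun x : E d => volume (closedBall x 1 ∩ cube d R)) hinj
  have hlow : ∀ (n : ℕ) (R : ℝ), L * (n + 1) + 1 ≤ R →
      ENNReal.ofReal (m * ballVolume d * (2 * n + 1) ^ d) ≤
        ∑' p, volume (closedBall (g p) 1 ∩ cube d R) := by
    intro n R hn
    refine le_trans (le_of_eq ?_) (ENNReal.sum_le_tsum (Finset.univ ×ˢ intBox d n))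
    have : ∀ p ∈ (Finset.univ : Finset F) ×ˢ intBox d n,
        volume (closedBall (g p) 1 ∩ cube d R) = ENNReal.ofReal (ballVolume d) := by
      intro p hp
      rw [Set.inter_eq_left.2, volume_closedBall_one]
      have hk := mem_intBox.1 (Finset.mem_product.1 hp).2
      have hgc : g p ∈ cube d (L * (n + 1)) := by
        intro i
        have h1 := abs_le.1 (hgi p i)
        have h2 := abs_le.1 (hk i)
        have h3 := mul_le_mul_of_nonneg_left h2.1 hL.le
        have h4 := mul_le_mul_of_nonneg_left h2.2 hL.le
        constructor <;> nlinarith [h1.1, h1.2]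
      intro z hz i
      have := mem_cube_add_of_dist_le (a := 1) (x := z) hgc (by rw [dist_comm]; exact hz) i
      simp only [Set.mem_Icc] at *
      constructor <;> linarith [this.1, this.2]
    rw [Finset.sum_congr rfl this, Finset.sum_const, hcard, nsmul_eq_mul, ← ENNReal.ofReal_natCast,
      ← ENNReal.ofReal_mul (by positivity)]
    push_cast
    congr 1
    ring
  have hup : ∀ (n : ℕ) (R : ℝ), R + 1 + L < L * (n + 1) →
      ∑' p, volume (closedBall (g p) 1 ∩ cube d R) ≤
        ENNReal.ofReal (m * ballVolume d * (2 * n + 1) ^ d) := by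
    intro n R hn
    rw [tsum_eq_sum (s := (Finset.univ : Finset F) ×ˢ intBox d n)]
    · calc ∑ p ∈ (Finset.univ : Finset F) ×ˢ intBox d n, volume (closedBall (g p) 1 ∩ cube d R)
          ≤ ∑ p ∈ (Finset.univ : Finset F) ×ˢ intBox d n, ENNReal.ofReal (ballVolume d) :=
            Finset.sum_le_sum fun p _ => (measure_mono Set.inter_subset_left).trans
              (volume_closedBall_one _).le
        _ = _ := by
            rw [Finset.sum_const, hcard, nsmul_eq_mul, ← ENNReal.ofReal_natCast,
              ← ENNReal.ofReal_mul (by positivity)]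
            push_cast
            congr 1
            ring
    · intro p hp
      have hk : ¬ p.2 ∈ intBox d n := fun h => hp (Finset.mem_product.2 ⟨Finset.mem_univ _, h⟩)
      rw [mem_intBox, not_forall] at hk
      obtain ⟨i, hi⟩ := hk
      have hi' : (n : ℝ) + 1 ≤ |(p.2 i : ℝ)| := by
        rw [not_le, ← Int.cast_abs] at hi
        rw [← Int.cast_abs]
        have : (n : ℤ) < |p.2 i| := by exact_mod_cast hi
        exact_mod_cast this
      rw [Set.eq_empty_of_forall_notMem (s := closedBall (g p) 1 ∩ cube d R), measure_empty]
      rintro z ⟨hz1, hz2⟩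
      have h1 := abs_le.1 ((abs_apply_sub_le_dist z (g p) i).trans hz1)
      have h2 := abs_le.1 (hgi p i)
      have h3 := hz2 i
      simp only [Set.mem_Icc] at h3
      have h4 : L * |(p.2 i : ℝ)| ≤ R + 1 + L := by
        rw [← abs_of_pos hL, ← abs_mul, abs_of_pos hL, abs_le]
        constructor <;> linarith [h1.1, h1.2, h2.1, h2.2, h3.1, h3.2]
      have h5 := mul_le_mul_of_nonneg_left hi' hL.le
      linarith
  have hlim : ∀ a : ℝ, Tendsto (fun R : ℝ => ENNReal.ofReal (m * ballVolume d *
      ((2 * R / L + a) / (2 * R)) ^ d)) atTop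
      (𝓝 (ENNReal.ofReal (m * ballVolume d * L⁻¹ ^ d))) := by
    intro a
    refine ENNReal.tendsto_ofReal (Tendsto.const_mul _ (Tendsto.pow ?_ d))
    have h1 : Tendsto (fun R : ℝ => L⁻¹ + a / (2 * R)) atTop (𝓝 (L⁻¹ + 0)) :=
      Tendsto.const_add _ ((tendsto_id.const_mul_atTop two_pos).const_div_atTop a)
    rw [add_zero] at h1
    refine h1.congr' ?_
    filter_upwards [eventually_gt_atTop 0] with R hR
    field_simp
  have hquot : ∀ a R : ℝ, 0 < R → ENNReal.ofReal (m * ballVolume d * (2 * R / L + a) ^ d) /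
      ENNReal.ofReal ((2 * R) ^ d) =
      ENNReal.ofReal (m * ballVolume d * ((2 * R / L + a) / (2 * R)) ^ d) := by
    intro a R hR
    rw [← ENNReal.ofReal_div_of_pos (by positivity), div_pow, mul_div_assoc]
  unfold HasBallDensity
  simp only [htsum]
  refine tendsto_of_tendsto_of_tendsto_of_le_of_le' (hlim (-(2 / L + 3))) (hlim (2 / L + 5)) ?_ ?_
  · filter_upwards [eventually_gt_atTop (2 * L + 1)] with R hR
    have hR0 : 0 < R := by linarith
    rw [← hquot _ R hR0]
    gcongr
    have hx0 : 0 ≤ (R - 1) / L - 1 := by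
      rw [sub_nonneg, le_div_iff₀ hL]; linarith
    have hfl := Nat.floor_le hx0
    have hfl' := (Nat.lt_floor_add_one ((R - 1) / L - 1)).le
    refine le_trans (ENNReal.ofReal_le_ofReal ?_) (hlow ⌊(R - 1) / L - 1⌋₊ R ?_)
    · have e1 : 2 * R / L + -(2 / L + 3) = 2 * ((R - 1) / L - 1 - 1) + 1 := by field_simp; ring
      have e2 : 0 ≤ 2 * R / L + -(2 / L + 3) := by
        have : 2 ≤ (R - 1) / L := by rw [le_div_iff₀ hL]; linarith
        rw [e1]; linarith
      have e3 : 2 * R / L + -(2 / L + 3) ≤ 2 * (⌊(R - 1) / L - 1⌋₊ : ℝ) + 1 := by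
        rw [e1]; linarith
      exact mul_le_mul_of_nonneg_left (pow_le_pow_left₀ e2 e3 d) (by positivity)
    · have : L * (⌊(R - 1) / L - 1⌋₊ + 1) ≤ L * ((R - 1) / L - 1 + 1) := by gcongr
      have e : L * ((R - 1) / L - 1 + 1) = R - 1 := by field_simp; ring
      linarith
  · filter_upwards [eventually_gt_atTop 0] with R hR0
    rw [← hquot _ R hR0]
    gcongr
    have hx0 : 0 ≤ (R + 1) / L + 1 := by positivity
    have hfl' := Nat.lt_floor_add_one ((R + 1) / L + 1)
    have hfl := Nat.floor_le hx0
    refine (hup ⌊(R + 1) / L + 1⌋₊ R ?_).trans (ENNReal.ofReal_le_ofReal ?_)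
    · have : L * ((R + 1) / L + 1) < L * (⌊(R + 1) / L + 1⌋₊ + 1) := by gcongr
      have e : L * ((R + 1) / L + 1) = R + 1 + L := by field_simp
      linarith
    · have e1 : 2 * R / L + (2 / L + 5) = 2 * ((R + 1) / L + 1) + 3 := by field_simp; ring
      have e3 : 2 * (⌊(R + 1) / L + 1⌋₊ : ℝ) + 1 ≤ 2 * R / L + (2 / L + 5) := by
        rw [e1]; linarith
      exact mul_le_mul_of_nonneg_left (pow_le_pow_left₀ (by positivity) e3 d) (by positivity)

/-- Scale the covered cube by `1 / ρ` and repeat it along the lattice. Centers are reduced to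
fractional parts to give each lattice orbit once; coinciding orbits merge, whence only an inequality
for the density. -/
theorem exists_periodic_covering {d N : ℕ} {ρ : ℝ} (hρ : 0 < ρ) (ω : Fin N → E d)
    (hcov : ∀ y ∈ unitCube d, ∃ j, dist y (ω j) ≤ ρ) :
    ∃ (C : Set (E d)) (δ : ℝ≥0∞), (⋃ x ∈ C, closedBall x 1) = Set.univ ∧ HasBallDensity C δ ∧
      δ ≤ ENNReal.ofReal (N * ballVolume d * ρ ^ d) := by
  classical
  have hV := ballVolume_pos d
  let fr : E d → E d := fun x => WithLp.toLp 2 fun i => Int.fract (x i)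
  let F : Finset (E d) := Finset.univ.image fun j => fr (ω j)
  have hF : ∀ f ∈ F, ∀ i, f i ∈ Set.Ico (0 : ℝ) 1 := by
    intro f hf i
    obtain ⟨j, -, rfl⟩ := Finset.mem_image.1 hf
    exact ⟨Int.fract_nonneg _, Int.fract_lt_one _⟩
  refine ⟨_, _, ?_, hasBallDensity_periodic (inv_pos.2 hρ) hF, ?_⟩
  · refine Set.eq_univ_of_forall fun y => ?_
    obtain ⟨j, hj⟩ := hcov (fr (ρ • y)) fun i => ⟨Int.fract_nonneg _, (Int.fract_lt_one _).le⟩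
    refine Set.mem_iUnion₂.2 ⟨_, ⟨(⟨fr (ω j), Finset.mem_image_of_mem _ (Finset.mem_univ j)⟩,
      fun i => ⌊ρ * y i⌋ + ⌊ω j i⌋), rfl⟩, ?_⟩
    have e1 : y = cellMap ρ⁻¹ (fun i => ⌊ρ * y i⌋) (fr (ρ • y)) := by
      ext i
      rw [cellMap_apply]
      simp only [fr, PiLp.smul_apply, smul_eq_mul]
      rw [Int.floor_add_fract]
      field_simp
    have e2 : cellMap ρ⁻¹ (fun i => ⌊ρ * y i⌋ + ⌊ω j i⌋) (fr (ω j)) =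
        cellMap ρ⁻¹ (fun i => ⌊ρ * y i⌋) (ω j) := by
      ext i
      rw [cellMap_apply, cellMap_apply]
      simp only [fr]
      push_cast
      rw [add_assoc, Int.floor_add_fract]
    have e3 := dist_cellMap (inv_pos.2 hρ) (fun i => ⌊ρ * y i⌋) (fr (ρ • y)) (ω j)
    rw [← e1] at e3
    rw [mem_closedBall]
    simp only
    rw [e2, e3, inv_mul_le_iff₀ hρ, mul_one]
    exact hj
  · rw [inv_inv]
    apply ENNReal.ofReal_le_ofReal
    have : F.card ≤ N := Finset.card_image_le.trans (by simp)
    have : (F.card : ℝ) ≤ N := by exact_mod_cast this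
    exact mul_le_mul_of_nonneg_right (mul_le_mul_of_nonneg_right this hV.le) (by positivity)

theorem coveringDensity_eq {d : ℕ} (hd : 1 ≤ d) :
    coveringDensity d = ballVolume d * coverConst d ^ d := by
  have hd0 : (0 : ℝ) < d := by exact_mod_cast hd
  have hc := coverConst_pos hd
  have hV := ballVolume_pos d
  unfold coveringDensity
  suffices h : sInf {δ : ℝ≥0∞ | ∃ C : Set (E d),
      (⋃ x ∈ C, closedBall x 1) = Set.univ ∧ HasBallDensity C δ} =
      ENNReal.ofReal (ballVolume d * coverConst d ^ d) by
    rw [h, ENNReal.toReal_ofReal (by positivity)]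
  refine le_antisymm ?_ (le_sInf ?_)
  · have hlim : Tendsto (fun ε : ℝ => ENNReal.ofReal (ballVolume d * (coverConst d + ε) ^ d))
        (𝓝[>] 0) (𝓝 (ENNReal.ofReal (ballVolume d * coverConst d ^ d))) := by
      refine (ENNReal.tendsto_ofReal ?_).mono_left nhdsWithin_le_nhds
      have : Continuous fun ε : ℝ => ballVolume d * (coverConst d + ε) ^ d := by fun_prop
      simpa using this.tendsto 0
    refine ge_of_tendsto hlim ?_
    filter_upwards [self_mem_nhdsWithin] with ε hε
    replace hε : 0 < ε := hε
    have h1 := tendsto_bestCoveringRadius hd (isWellTiled_unitCube d)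
    rw [hausdorffVol_unitCube, Real.one_rpow, mul_one] at h1
    obtain ⟨N, hN, hN1⟩ := ((h1.eventually (gt_mem_nhds
      ((ENNReal.ofReal_lt_ofReal_iff (by positivity)).2
        (by linarith : coverConst d < coverConst d + ε)))).and (eventually_ge_atTop 1)).exists
    have hN0 : (0 : ℝ) < N := by exact_mod_cast hN1
    -- With this radius the density bound `N * V_d * ρ ^ d` equals `V_d * (coverConst d + ε) ^ d`,
    -- independently of `N`.
    set ρ : ℝ := (coverConst d + ε) * (N : ℝ) ^ (-(1 / (d : ℝ))) with hρ
    have hρ0 : 0 < ρ := by positivity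
    have hlt : bestCoveringRadius (unitCube d) N < ENNReal.ofReal ρ := by
      by_contra hcon
      refine hN.not_ge ?_
      calc ENNReal.ofReal (coverConst d + ε)
          = (N : ℝ≥0∞) ^ (1 / (d : ℝ)) * ENNReal.ofReal ρ := by
            rw [← ENNReal.ofReal_natCast, ENNReal.ofReal_rpow_of_pos hN0,
              ← ENNReal.ofReal_mul (by positivity), hρ, Real.rpow_neg hN0.le]
            congr 1
            field_simp
        _ ≤ _ := by gcongr; exact not_lt.1 hcon
    unfold bestCoveringRadius at hlt
    obtain ⟨ω, hω⟩ := iInf_lt_iff.1 hlt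
    obtain ⟨C, δ, hC, hδ, hle⟩ := exists_periodic_covering hρ0 (fun j => (ω j : E d)) (by
      intro y hy
      have h2 : (⨅ j, edist y (ω j : E d)) < ENNReal.ofReal ρ :=
        (le_iSup (fun y : unitCube d => ⨅ j, edist (y : E d) (ω j : E d)) ⟨y, hy⟩).trans_lt hω
      obtain ⟨j, hj⟩ := iInf_lt_iff.1 h2
      rw [edist_dist] at hj
      exact ⟨j, ((ENNReal.ofReal_lt_ofReal_iff hρ0).1 hj).le⟩)
    have hmem : δ ∈ {δ : ℝ≥0∞ | ∃ C : Set (E d),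
        (⋃ x ∈ C, closedBall x 1) = Set.univ ∧ HasBallDensity C δ} := ⟨C, hC, hδ⟩
    refine (sInf_le hmem).trans (hle.trans (ENNReal.ofReal_le_ofReal (le_of_eq ?_)))
    rw [hρ, mul_pow, ← Real.rpow_natCast (_ ^ _), ← Real.rpow_mul hN0.le, neg_mul,
      one_div_mul_cancel hd0.ne', Real.rpow_neg_one]
    field_simp
  · rintro δ ⟨C, hC, hδ⟩
    exact density_lower_bound hd hC hδ

/-! ### Assembling the limits -/

theorem sigma_eq {d : ℕ} (hd : 1 ≤ d) {s : ℝ} (hs : (d : ℝ) < s) :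
    sigma d s = (cubeConst true d s).toReal := by
  have h := tendsto_genPol_cube hd true (lt_of_le_of_lt d.cast_nonneg hs)
  unfold sigma polarizationLimit
  exact congrArg ENNReal.toReal h.limUnder_eq

theorem tendsto_normalizedPolarization {d ℓ : ℕ} (hd : 1 ≤ d) {A : Set (E ℓ)}
    (hA : IsWellTiled d A) {s : ℝ} (hs : (d : ℝ) < s) :
    Tendsto (normalizedPolarization d s A) atTop
      (𝓝 (ENNReal.ofReal (sigma d s / hausdorffVol d A ^ (s / d)))) := by
  have h := tendsto_genPol hd true hs hA.nonempty hA.vol_pos hA.lower hA.upper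
  rw [Real.rpow_neg hA.vol_pos.le, ← div_eq_mul_inv, ← sigma_eq hd hs] at h
  exact h

theorem polarizationLimit_eq {d ℓ : ℕ} (hd : 1 ≤ d) {A : Set (E ℓ)}
    (hA : IsWellTiled d A) {s : ℝ} (hs : (d : ℝ) < s) :
    polarizationLimit d s A = ENNReal.ofReal (sigma d s / hausdorffVol d A ^ (s / d)) :=
  (tendsto_normalizedPolarization hd hA hs).limUnder_eq

theorem tendsto_sigma_rpow {d : ℕ} (hd : 1 ≤ d) :
    Tendsto (fun s : ℝ => sigma d s ^ (1 / s)) atTop (𝓝 (1 / coverConst d)) := by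
  refine (tendsto_cubeConst_rpow hd).congr' ?_
  filter_upwards [eventually_gt_atTop (d : ℝ)] with s hs
  rw [sigma_eq hd hs]

theorem tendsto_sigma_div_rpow {d ℓ : ℕ} (hd : 1 ≤ d) {A : Set (E ℓ)} (hA : IsWellTiled d A) :
    Tendsto (fun s : ℝ => (sigma d s / hausdorffVol d A ^ (s / d)) ^ (1 / s)) atTop
      (𝓝 (1 / (coverConst d * hausdorffVol d A ^ (1 / (d : ℝ))))) := by
  have hV := hA.vol_pos
  have h := (tendsto_sigma_rpow hd).mul_const (hausdorffVol d A ^ (1 / (d : ℝ)))⁻¹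
  have e : 1 / coverConst d * (hausdorffVol d A ^ (1 / (d : ℝ)))⁻¹ =
      1 / (coverConst d * hausdorffVol d A ^ (1 / (d : ℝ))) := by
    rw [mul_comm (coverConst d), ← div_div, div_eq_mul_inv, div_eq_mul_inv, div_eq_mul_inv]
    ring
  rw [e] at h
  refine h.congr' ?_
  filter_upwards [eventually_gt_atTop (d : ℝ)] with s hs
  have hs0 : 0 < s := lt_of_le_of_lt d.cast_nonneg hs
  have hσ : 0 < sigma d s := by rw [sigma_eq hd hs]; exact cubeConst_toReal_pos hd true hs
  rw [Real.div_rpow hσ.le (by positivity), ← Real.rpow_mul hV.le, div_eq_mul_inv]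
  congr 3
  field_simp

theorem one_div_coverConst {d : ℕ} (hd : 1 ≤ d) :
    1 / coverConst d = (ballVolume d / coveringDensity d) ^ (1 / (d : ℝ)) := by
  have hd0 : (0 : ℝ) < d := by exact_mod_cast hd
  have hc := coverConst_pos hd
  have hV := ballVolume_pos d
  have e : ballVolume d / coveringDensity d = (1 / coverConst d) ^ d := by
    rw [coveringDensity_eq hd, one_div, inv_pow]
    field_simp
  rw [e, ← Real.rpow_natCast, ← Real.rpow_mul (by positivity), mul_one_div_cancel hd0.ne',
    Real.rpow_one]

end

end RieszPolarization

theorem mainTheorem2 (d : ℕ) (hd : 1 ≤ d) :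
    (∀ s : ℝ, (d : ℝ) < s → 0 < sigma d s) ∧
    (∀ (ℓ : ℕ) (A : Set (E ℓ)), IsAdmissibleOrCube d ℓ A →
      (∀ s : ℝ, (d : ℝ) < s →
        Tendsto (normalizedPolarization d s A) atTop (𝓝 (polarizationLimit d s A)) ∧
        polarizationLimit d s A = ENNReal.ofReal (sigma d s / hausdorffVol d A ^ (s / d))) ∧
      ∃ c : ℝ, 0 < c ∧
        Tendsto (fun N : ℕ => (N : ℝ≥0∞) ^ (1 / (d : ℝ)) * bestCoveringRadius A N) atTop
          (𝓝 (ENNReal.ofReal c)) ∧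
        Tendsto (fun s : ℝ => (sigma d s / hausdorffVol d A ^ (s / d)) ^ (1 / s)) atTop
          (𝓝 (1 / c)) ∧
        Tendsto (fun s : ℝ => polarizationLimit d s A ^ (1 / s)) atTop
          (𝓝 (ENNReal.ofReal (1 / c)))) ∧
    (0 < coveringDensity d ∧
      Tendsto (fun s : ℝ => sigma d s ^ (1 / s)) atTop
        (𝓝 ((ballVolume d / coveringDensity d) ^ (1 / (d : ℝ)))) ∧
      ∃ c : ℝ, 0 < c ∧
        Tendsto (fun N : ℕ => (N : ℝ≥0∞) ^ (1 / (d : ℝ)) * bestCoveringRadius (unitCube d) N) atTop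
          (𝓝 (ENNReal.ofReal c)) ∧
        1 / c = (ballVolume d / coveringDensity d) ^ (1 / (d : ℝ))) := by
  have hcov : ∀ (ℓ : ℕ) (A : Set (E ℓ)), IsWellTiled d A →
      0 < coverConst d * hausdorffVol d A ^ (1 / (d : ℝ)) := fun ℓ A hA =>
    mul_pos (coverConst_pos hd) (Real.rpow_pos_of_pos hA.vol_pos _)
  refine ⟨fun s hs => ?_, fun ℓ A hA => ?_, ?_, ?_, coverConst d, coverConst_pos hd, ?_,
    one_div_coverConst hd⟩
  · rw [sigma_eq hd hs]
    exact cubeConst_toReal_pos hd true hs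
  · replace hA := hA.isWellTiled hd
    refine ⟨fun s hs => ⟨?_, polarizationLimit_eq hd hA hs⟩,
      coverConst d * hausdorffVol d A ^ (1 / (d : ℝ)), hcov ℓ A hA,
      tendsto_bestCoveringRadius hd hA, tendsto_sigma_div_rpow hd hA, ?_⟩
    · rw [polarizationLimit_eq hd hA hs]
      exact tendsto_normalizedPolarization hd hA hs
    · refine (ENNReal.tendsto_ofReal (tendsto_sigma_div_rpow hd hA)).congr' ?_
      filter_upwards [eventually_gt_atTop (d : ℝ)] with s hs
      have hs0 : 0 < s := lt_of_le_of_lt d.cast_nonneg hs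
      have hσ : 0 < sigma d s := by rw [sigma_eq hd hs]; exact cubeConst_toReal_pos hd true hs
      rw [polarizationLimit_eq hd hA hs, ENNReal.ofReal_rpow_of_nonneg
        (div_nonneg hσ.le (Real.rpow_nonneg hA.vol_pos.le _)) (by positivity)]
  · rw [coveringDensity_eq hd]
    exact mul_pos (ballVolume_pos d) (pow_pos (coverConst_pos hd) d)
  · rw [← one_div_coverConst hd]
    exact tendsto_sigma_rpow hd
  · have h := tendsto_bestCoveringRadius hd (isWellTiled_unitCube d)
    rwa [hausdorffVol_unitCube, Real.one_rpow, mul_one] at h
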